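/- **Setting.** All transformations are measure preserving on $\sigma$-finite spaces. For such a $(X,\mathcal B,m,T)$ and $F\in\mathcal B$ with $0<m(F)<\infty$ put $S_n(1_F)=\sum_{k=0}^{n-1}1_F\circ T^k$, $u_k(F)=m(F\cap T^{-k}F)/m(F)^2$ and $a_n(F)=\sum_{k=0}^{n-1}u_k(F)$. * $T$ is *weakly mixing* if $T\times R$ is ergodic for every ergodic probability preserving transformation $R$ (of a standard Borel space). * $T$ is *zero type* if $m(B\cap T^{-n}B)\to0$ for every $B\in\mathcal B$ with $m(B)<\infty$. * $F$ satisfies a *Rényi inequality* if there is $M$ with $\int_F S_n(1_F)^2\,dm\le M\left(\int_F S_n(1_F)\,dm\right)^2$ for all $n\ge1$. $T$ is *rationally ergodic* if it is conservative, ergodic, and some $F$ with $0<m(F)<\infty$ satisfies a Rényi inequality. * $R(T)$ is the class of $F$ with $0<m(F)<\infty$ such that $\frac1{a_n(F)}\sum_{k=0}^{n-1}m(B\cap T^{-k}C)\to m(B)m(C)$ for all measurable $B,C\subseteq F$. * $T$ is *subsequence rationally weakly mixing* if there are $F$ with $0<m(F)<\infty$ and $n_j\uparrow\infty$ such that $\frac1{a_{n_j}(F)}\sum_{k=0}^{n_j-1}\left|m(B\cap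 T^{-k}C)-m(B)m(C)u_k(F)\right|\to0$ as $j\to\infty$ for all measurable $B,C\subseteq F$. **Dyadic towers.** Let $\Omega=\{0,1\}^{\mathbb N}$ with the symmetric product measure $P$, and let $\tau$ be the dyadic odometer, $\tau(1,\dots,1,0,\omega_{\ell+1},\dots)=(0,\dots,0,1,\omega_{\ell+1},\dots)$, $\ell=\ell(\omega)=\min\{n\ge1:\omega_n=0\}$. An increasing sequence $q=(q_n)_{n\ge1}$ of positive integers is a *super growth sequence* if $q_n>2\sum_{1\le k<n}q_k$ for all $n$. Put $\varphi(\omega)=q_{\ell(\omega)}-\sum_{k=1}^{\ell(\omega)-1}q_k$. The *dyadic tower* of $q$ is $X=\{(\omega,n):\omega\in\Omega,\ 1\le n\le\varphi(\omega)\}$ with $\mu(B\times\{n\})=P(B\cap[\varphi\ge n])$ and $T(\omega,n)=(\omega,n+1)$ if $n<\varphi(\omega)$, $T(\omega,n)=(\tau\omega,1)$ if $n=\varphi(\omega)$. Identify $\Omega$ with the base $\Omega\times\{1\}\subseteq X$. **Markov shifts.** Let $(Y,\mathcal C,\nu,S)$ be the two-sided Markov shift of a stochastic matrix $(p_{s,t})$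 on a countable state space with positive finite weights $(w_s)$: $S$ is the shift and $\nu([y_k=s_0,\dots,y_{k+n}=s_n])=w_{s_0}p_{s_0,s_1}\cdots p_{s_{n-1},s_n}$ for all $k\in\mathbb Z$, $n\ge0$. It is aperiodic if $\gcd\{n\ge1:p^{(n)}_{s,s}>0\}=1$ for every state $s$. Let $M(S)$ be the class of recurrent events: the $A\in\mathcal C$ with $0<\nu(A)<\infty$ such that, with $u_n=\nu(A\cap S^{-n}A)/\nu(A)$, one has $\nu\left(\bigcap_{i=0}^{n}S^{-(j_1+\cdots+j_i)}A\right)=\nu(A)\,u_{j_1}\cdots u_{j_n}$ for all $n\ge0$ and $j_1,\dots,j_n\ge0$ (for instance $A=[y_0=s]$). Write $u(A)=(u_n)_{n\ge0}$; it is *Kaluza* if $u_0=1$, $u_n>0$ and $u_{n+1}^2\le u_nu_{n+2}$ for all $n\ge0$. **Theorem.** Let $T$ be a weakly mixing dyadic tower with a super growth sequence $q$. Let $S$ be a conservative, ergodic, aperiodic Markov shift, let $A\in M(S)$ be such that $u(A)$ is Kaluza, and suppose that $S\times T$ is conservative on $(Y\times X,\nu\times\mu)$. Then: 1. if $\nu(Y)=\infty$,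 then $S\times T$ is zero type; 2. $S\times T$ is rationally ergodic, the set $A\times\Omega$ satisfies a Rényi inequality for $S\times T$, and $A\times\Omega\in R(S\times T)$; 3. $S\times T$ is weakly mixing; 4. $S\times T$ is not subsequence rationally weakly mixing. -/

import Mathlib

open MeasureTheory Filter Topology Set
open scoped ENNReal

/-! ### Notions from infinite ergodic theory -/

section InfiniteErgodicTheory

/-- `T` is weakly mixing: its product with every ergodic probability preserving transformation
of a standard Borel space is ergodic. -/
def IsWeaklyMixing {X : Type*} [MeasurableSpace X] (T : X → X) (m : Measure X) : Prop :=
  ∀ (Z : Type) [MeasurableSpace Z] [StandardBorelSpace Z] (ρ : Measure Z)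
    [IsProbabilityMeasure ρ] (R : Z → Z),
    Ergodic R ρ → Ergodic (Prod.map T R) (m.prod ρ)

/-- `T` is of zero type: `m (B ∩ T⁻ⁿ B) → 0` for every set `B` of finite measure. -/
def IsZeroType {X : Type*} [MeasurableSpace X] (T : X → X) (m : Measure X) : Prop :=
  ∀ B : Set X, MeasurableSet B → m B ≠ ∞ →
    Tendsto (fun n : ℕ => m (B ∩ T^[n] ⁻¹' B)) atTop (𝓝 0)

/-- `u_k(F) = m (F ∩ T⁻ᵏ F) / m(F)²`. -/
noncomputable def returnProb {X : Type*} [MeasurableSpace X] (T : X → X) (m : Measure X)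
    (F : Set X) (k : ℕ) : ℝ :=
  m.real (F ∩ T^[k] ⁻¹' F) / m.real F ^ 2

/-- `a_n(F) = ∑_{k < n} u_k(F)`. -/
noncomputable def returnSeq {X : Type*} [MeasurableSpace X] (T : X → X) (m : Measure X)
    (F : Set X) (n : ℕ) : ℝ :=
  ∑ k ∈ Finset.range n, returnProb T m F k

/-- `F` has positive finite measure and satisfies a Rényi inequality:
`∫_F S_n(1_F)² dm ≤ M (∫_F S_n(1_F) dm)²` for all `n`, where `S_n(1_F) = ∑_{k < n} 1_F ∘ Tᵏ`. -/
structure IsRenyiSet {X : Type*} [MeasurableSpace X] (T : X → X) (m : Measure X)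
    (F : Set X) : Prop where
  measurableSet : MeasurableSet F
  pos : 0 < m F
  lt_top : m F < ∞
  renyi : ∃ M : ℝ, ∀ n : ℕ,
    ∫ x in F, (birkhoffSum T (F.indicator fun _ => (1 : ℝ)) n x) ^ 2 ∂m ≤
      M * (∫ x in F, birkhoffSum T (F.indicator fun _ => (1 : ℝ)) n x ∂m) ^ 2

/-- Rational ergodicity: conservative, ergodic, with a set satisfying a Rényi inequality. -/
def IsRationallyErgodic {X : Type*} [MeasurableSpace X] (T : X → X) (m : Measure X) : Prop :=
  Conservative T m ∧ Ergodic T m ∧ ∃ F : Set X, IsRenyiSet T m F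

/-- The class `R(T)`: the sets `F` of positive finite measure such that
`(1 / a_n(F)) ∑_{k < n} m (B ∩ T⁻ᵏ C) → m(B) m(C)` for all measurable `B, C ⊆ F`. -/
def rationalSets {X : Type*} [MeasurableSpace X] (T : X → X) (m : Measure X) : Set (Set X) :=
  {F | MeasurableSet F ∧ 0 < m F ∧ m F < ∞ ∧
    ∀ B C : Set X, MeasurableSet B → MeasurableSet C → B ⊆ F → C ⊆ F →
      Tendsto (fun n : ℕ =>
          (∑ k ∈ Finset.range n, m.real (B ∩ T^[k] ⁻¹' C)) / returnSeq T m F n)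
        atTop (𝓝 (m.real B * m.real C))}

/-- Subsequence rational weak mixing: for some set `F` of positive finite measure and some
subsequence `N j → ∞`,
`(1 / a_n(F)) ∑_{k < n} |m (B ∩ T⁻ᵏ C) - m(B) m(C) u_k(F)| → 0` along `n = N j`,
for all measurable `B, C ⊆ F`. -/
def IsSubseqRationallyWeaklyMixing {X : Type*} [MeasurableSpace X] (T : X → X)
    (m : Measure X) : Prop :=
  ∃ F : Set X, MeasurableSet F ∧ 0 < m F ∧ m F < ∞ ∧
    ∃ N : ℕ → ℕ, StrictMono N ∧
      ∀ B C : Set X, MeasurableSet B → MeasurableSet C → B ⊆ F → C ⊆ F →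
        Tendsto (fun j : ℕ =>
            (∑ k ∈ Finset.range (N j),
              |m.real (B ∩ T^[k] ⁻¹' C) - m.real B * m.real C * returnProb T m F k|) /
              returnSeq T m F (N j))
          atTop (𝓝 0)

/-- The sequence `u(A)`, `u_n = m (A ∩ T⁻ⁿ A) / m(A)`. -/
noncomputable def renewalSeq {X : Type*} [MeasurableSpace X] (T : X → X) (m : Measure X)
    (A : Set X) (n : ℕ) : ℝ :=
  m.real (A ∩ T^[n] ⁻¹' A) / m.real A

/-- `A` is a recurrent event for `T`: it has positive finite measure, and the returns to `A` form
a renewal process, i.e. for all `j 0, j 1, …` the intersection of the sets `T^{-(j 0 + ⋯ + j (i-1))} A`,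
`0 ≤ i ≤ n`, has measure `m(A) u_{j 0} ⋯ u_{j (n-1)}`. Every one-state cylinder of a Markov shift
is of this kind. -/
structure IsRecurrentEvent {X : Type*} [MeasurableSpace X] (T : X → X) (m : Measure X)
    (A : Set X) : Prop where
  measurableSet : MeasurableSet A
  pos : 0 < m A
  lt_top : m A < ∞
  renewal : ∀ (n : ℕ) (j : ℕ → ℕ),
    m.real {x | ∀ i ≤ n, T^[∑ l ∈ Finset.range i, j l] x ∈ A} =
      m.real A * ∏ i ∈ Finset.range n, renewalSeq T m A (j i)

/-- A Kaluza sequence: `u_0 = 1`, `u_n > 0` and `u_{n+1}² ≤ u_n u_{n+2}`. -/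
def IsKaluza (u : ℕ → ℝ) : Prop :=
  u 0 = 1 ∧ (∀ n, 0 < u n) ∧ ∀ n, u (n + 1) ^ 2 ≤ u n * u (n + 2)

end InfiniteErgodicTheory

/-! ### Two-sided Markov shifts on a countable state space -/

section MarkovShift

/-- The left shift on two-sided sequences. -/
def biShift (ι : Type*) (y : ℤ → ι) : ℤ → ι := fun i => y (i + 1)

/-- `ν` is the (possibly infinite) measure of the two-sided Markov shift with stochastic matrix `p`
and positive invariant weights `w`; it is determined by its values on cylinders. Invariance
`∑_s w_s p_{s,t} = w_t` follows since the formula holds for cylinders at every position `k`. -/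
structure IsMarkovMeasure {ι : Type*} [MeasurableSpace ι] (p : ι → ι → ℝ≥0∞) (w : ι → ℝ≥0∞)
    (ν : Measure (ℤ → ι)) : Prop where
  stochastic : ∀ s, ∑' t, p s t = 1
  weight_pos : ∀ s, 0 < w s
  weight_lt_top : ∀ s, w s < ∞
  cylinder : ∀ (k : ℤ) (n : ℕ) (s : ℕ → ι),
    ν {y | ∀ i : ℕ, i ≤ n → y (k + i) = s i} =
      w (s 0) * ∏ i ∈ Finset.range n, p (s i) (s (i + 1))

open scoped Classical in
/-- The `n`-step transition probabilities. -/
noncomputable def stepProb {ι : Type*} (p : ι → ι → ℝ≥0∞) : ℕ → ι → ι → ℝ≥0∞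
  | 0 => fun s t => if s = t then 1 else 0
  | n + 1 => fun s t => ∑' r, p s r * stepProb p n r t

/-- Every state has period one: the only common divisor of its return times is `1`. -/
def IsAperiodic {ι : Type*} (p : ι → ι → ℝ≥0∞) : Prop :=
  ∀ (s : ι) (d : ℕ), (∀ n : ℕ, 0 < stepProb p n s s → d ∣ n) → d = 1

end MarkovShift

/-! ### DyadicSeq towers. Coordinates are numbered from `0`, so that `ω i` and `q i` are the
`(i+1)`-st coordinate and the `(i+1)`-st term. -/

section DyadicTower

/-- The dyadic sequence space, with `true` for `1` and `false` for `0`. -/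
abbrev DyadicSeq : Type := ℕ → Bool

/-- The symmetric product measure on the dyadic sequence space. -/
noncomputable def dyadicMeasure : Measure DyadicSeq :=
  Measure.infinitePi fun _ : ℕ => (PMF.uniformOfFintype Bool).toMeasure

/-- The dyadic odometer (adding one with carry), `(1,…,1,0,*) ↦ (0,…,0,1,*)`; the point
`(1,1,1,…)` is sent to `(0,0,0,…)`. -/
def odometer (ω : DyadicSeq) : DyadicSeq := fun n =>
  if ∀ k < n, ω k = true then !(ω n) else ω n

/-- The index of the first coordinate `0` (with value `0` at the point `(1,1,1,…)`). -/
noncomputable def firstZero (ω : DyadicSeq) : ℕ := sInf {n | ω n = false}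

/-- Growth sequences: increasing, each term larger than the sum of the preceding ones. -/
def IsGrowthSeq (q : ℕ → ℕ) : Prop :=
  StrictMono q ∧ ∀ n, ∑ k ∈ Finset.range n, q k < q n

/-- Super growth sequences: each term is larger than twice the sum of the preceding ones. -/
def IsSuperGrowthSeq (q : ℕ → ℕ) : Prop :=
  StrictMono q ∧ ∀ n, 2 * ∑ k ∈ Finset.range n, q k < q n

theorem IsSuperGrowthSeq.isGrowthSeq {q : ℕ → ℕ} (hq : IsSuperGrowthSeq q) : IsGrowthSeq q :=
  ⟨hq.1, fun n => lt_of_le_of_lt (Nat.le_mul_of_pos_left _ two_pos) (hq.2 n)⟩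

/-- The dyadic cocycle; the subtraction does not truncate when `q` is a growth sequence. -/
noncomputable def dyadicCocycle (q : ℕ → ℕ) (ω : DyadicSeq) : ℕ :=
  q (firstZero ω) - ∑ k ∈ Finset.range (firstZero ω), q k

theorem IsGrowthSeq.one_le_dyadicCocycle {q : ℕ → ℕ} (hq : IsGrowthSeq q) (ω : DyadicSeq) :
    1 ≤ dyadicCocycle q ω :=
  Nat.sub_pos_of_lt (hq.2 (firstZero ω))

/-- The tower with height function the dyadic cocycle. -/
abbrev DyadicTower (q : ℕ → ℕ) : Type :=
  {z : DyadicSeq × ℕ // 1 ≤ z.2 ∧ z.2 ≤ dyadicCocycle q z.1}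

/-- The tower measure: `m (A × {n}) = P (A ∩ [φ ≥ n])`. -/
noncomputable def towerMeasure (q : ℕ → ℕ) : Measure (DyadicTower q) :=
  (dyadicMeasure.prod Measure.count).comap Subtype.val

/-- The tower transformation: go up one level, or from the top level of the column of `ω` to the
bottom level of the column of `τ ω`. -/
noncomputable def towerMap {q : ℕ → ℕ} (hq : IsGrowthSeq q) (z : DyadicTower q) :
    DyadicTower q :=
  if h : z.1.2 + 1 ≤ dyadicCocycle q z.1.1 then
    ⟨(z.1.1, z.1.2 + 1), Nat.le_add_left 1 _, h⟩
  else
    ⟨(odometer z.1.1, 1), le_refl 1, hq.one_le_dyadicCocycle _⟩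

/-- The base `Ω` of the tower, i.e. its bottom level. -/
def towerBase (q : ℕ → ℕ) : Set (DyadicTower q) := {z | z.1.2 = 1}

end DyadicTower

/-!
Write `V = S × T` and `F = A × Ω`. Let `u` be the renewal sequence of `A` and
`v k = μ (Ω ∩ T⁻ᵏ Ω)`, so that the return sequence of `F` is a multiple of `∑ u k * v k`. A bounded
Kaluza sequence is antitone (`IsKaluza.antitone`).

Zero type. If `ν` is infinite, the mean ergodic theorem makes the averages of `u` tend to `0`, hence
so does `u` (`tendsto_renewalSeq_zero`), and `F` meets `V⁻ⁿ F` in measure at most `ν(A) u n`. Since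
the preimages of `F` exhaust the space, one such set suffices (`isZeroType_of_tendsto`).

Rényi inequality. The tower has a strong form of it: from almost every point of the base, the number
of visits to the base before time `n` is at most `8` times its mean (`card_baseVisits_le_mul_sum`).
Indeed a return time is a difference of the digit sums `∑ q_l ω_l` of two points on the same orbit,
and super growth means that such differences determine the change of every digit. By summation by
parts the bound survives weighting with the antitone `u`, and the renewal property factors the measure
of three visits over the two gaps (`IsRecurrentEvent.hasRenyiBound_prod`).

Membership in `R(V)`. The Rényi inequality bounds the normalized sums `a_n⁻¹ ∑ 1_D ∘ Vᵏ` in `L²(F)`,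
and a weak limit assigns the same integral to `B` and to `V⁻ⁱ B` inside `F`, so it is constant by
ergodicity. The same argument for the inverse of `V`, which is injective, identifies the constant
(`tendsto_sum_measureReal_inter_sub_average`, `HasRenyiBound.mem_rationalSets`).

Weak mixing. Let `R` be ergodic and probability preserving and put `W = T × R`, which is ergodic. An
invariant set of `S × W` depends only on the future of the Markov chain, because it can be
approximated by sets depending on the coordinates after time `-N` and looked at again at the `N`-th
return to a set of finite measure (`exists_oneSided_ae_mem_iff`). The conditional probabilities of its
sections, given the state, are then harmonic along the orbits of `W`; by aperiodicity and the
Choquet–Deny property they are `W`-invariant, so constant, and a set whose sections are independent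
of all cylinders is trivial (`oneSided_trivial_of_invariant`, `IsMarkovMeasure.ergodic_prod`).

Failure of subsequence rational weak mixing. Inside a level of the tower let `B` and `C` be the parts
of a set on which one fixed base coordinate is `0`, respectively `1`. Uniqueness of the digits shows
that no time `k` carries both a point of `B` into `C` and a point of `C` into `B`, so at each `k` one
of the two correlations vanishes (`not_isSubseqRationallyWeaklyMixing_prod`).
-/

/-! ### Conservative ergodic transformations -/

section GeneralErgodicTheory

variable {X : Type*} [MeasurableSpace X] {T : X → X} {m : Measure X}

theorem measurableSet_setOf_frequently (hT : Measurable T) {D : Set X} (hD : MeasurableSet D) :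
    MeasurableSet {x | ∃ᶠ n in atTop, T^[n] x ∈ D} := by
  have : {x | ∃ᶠ n in atTop, T^[n] x ∈ D} = limsup (fun n => T^[n] ⁻¹' D) atTop := by
    ext x; rw [mem_limsup_iff_frequently_mem]; rfl
  rw [this]
  exact MeasurableSet.measurableSet_limsup fun n => hT.iterate n hD

theorem frequently_iterate_succ_mem_iff {X : Type*} (T : X → X) (D : Set X) (x : X) :
    (∃ᶠ n in atTop, T^[n] (T x) ∈ D) ↔ ∃ᶠ n in atTop, T^[n] x ∈ D := by
  conv_rhs => rw [← map_add_atTop_eq_nat 1, frequently_map]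
  simp only [Function.iterate_succ_apply]

/-- Under a conservative ergodic transformation almost every point visits a given set of positive
measure infinitely often. -/
theorem ae_frequently_mem (hc : Conservative T m) (he : Ergodic T m) {D : Set X}
    (hD : MeasurableSet D) (h0 : m D ≠ 0) : ∀ᵐ x ∂m, ∃ᶠ n in atTop, T^[n] x ∈ D := by
  have hG := measurableSet_setOf_frequently he.measurable hD
  rcases he.toPreErgodic.ae_mem_or_ae_notMem hG
    (by ext x; exact frequently_iterate_succ_mem_iff T D x) with h | h
  · exact h
  · exfalso
    apply h0
    have h1 := hc.ae_mem_imp_frequently_image_mem hD.nullMeasurableSet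
    rw [measure_eq_zero_iff_ae_notMem]
    filter_upwards [h, h1] with x hx hx1 hxD
    exact hx (hx1 hxD)

theorem exists_measure_inter_preimage_ne_zero (hc : Conservative T m) (he : Ergodic T m)
    {D D' : Set X} (h0 : m D ≠ 0) (hD' : MeasurableSet D') (h0' : m D' ≠ 0) :
    ∃ i : ℕ, m (D ∩ T^[i] ⁻¹' D') ≠ 0 := by
  by_contra! h
  apply h0
  have h1 : ∀ᵐ x ∂m, ∀ i : ℕ, x ∉ D ∩ T^[i] ⁻¹' D' :=
    ae_all_iff.2 fun i => measure_eq_zero_iff_ae_notMem.1 (h i)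
  rw [measure_eq_zero_iff_ae_notMem]
  filter_upwards [h1, ae_frequently_mem hc he hD' h0'] with x hx hx1 hxD
  obtain ⟨i, hi⟩ := hx1.exists
  exact hx i ⟨hxD, hi⟩

theorem measure_preimage_inter_preimage (hT : MeasurePreserving T m m) {B C : Set X}
    (hB : MeasurableSet B) (hC : MeasurableSet C) {i j : ℕ} (hij : i ≤ j) :
    m (T^[i] ⁻¹' B ∩ T^[j] ⁻¹' C) = m (B ∩ T^[j - i] ⁻¹' C) := by
  have : T^[i] ⁻¹' B ∩ T^[j] ⁻¹' C = T^[i] ⁻¹' (B ∩ T^[j - i] ⁻¹' C) := by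
    rw [preimage_inter, ← preimage_comp, ← Function.iterate_add, Nat.sub_add_cancel hij]
  rw [this]
  exact (hT.iterate i).measure_preimage
    (hB.inter ((hT.iterate _).measurable hC)).nullMeasurableSet

/-- A conservative ergodic transformation is of zero type as soon as `m (F ∩ T⁻ⁿ F) → 0` for one
set `F` of positive measure: the sets `T⁻ʲ F` exhaust the space. -/
theorem isZeroType_of_tendsto (hc : Conservative T m) (he : Ergodic T m) {F : Set X}
    (hF : MeasurableSet F) (h0 : m F ≠ 0)
    (h : Tendsto (fun n : ℕ => m (F ∩ T^[n] ⁻¹' F)) atTop (𝓝 0)) : IsZeroType T m := by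
  intro B hB hBtop
  have hmp := he.toMeasurePreserving
  set G : ℕ → Set X := fun J => ⋃ j ∈ Finset.range J, T^[j] ⁻¹' F with hG
  have hGm : ∀ J, MeasurableSet (G J) := fun J =>
    Finset.measurableSet_biUnion _ fun j _ => (hmp.iterate j).measurable hF
  have hlim : Tendsto (fun J => m (B \ G J)) atTop (𝓝 0) := by
    have h1 : m (⋂ J, B \ G J) = 0 := by
      rw [measure_eq_zero_iff_ae_notMem]
      filter_upwards [ae_frequently_mem hc he hF h0] with x hx hx1
      obtain ⟨i, hi⟩ := hx.exists
      have := (mem_iInter.1 hx1 (i + 1)).2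
      exact this (mem_biUnion (Finset.mem_coe.2 (Finset.self_mem_range_succ i)) hi)
    rw [← h1]
    refine tendsto_measure_iInter_atTop (fun J => (hB.diff (hGm J)).nullMeasurableSet) ?_
      ⟨0, ne_top_of_le_ne_top hBtop (measure_mono sdiff_subset)⟩
    intro J J' hJ
    refine sdiff_subset_sdiff_right (biUnion_subset_biUnion_left ?_)
    exact_mod_cast Finset.range_mono hJ
  rw [ENNReal.tendsto_nhds_zero]
  intro ε hε
  have hε4 : 0 < ε / 2 / 2 := ENNReal.half_pos (ENNReal.half_pos hε.ne').ne'
  obtain ⟨J, hJ⟩ := ((ENNReal.tendsto_nhds_zero.1 hlim) (ε / 2 / 2) hε4).exists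
  have hsum : Tendsto (fun n : ℕ => ∑ i ∈ Finset.range J, ∑ j ∈ Finset.range J,
      m (F ∩ T^[n + j - i] ⁻¹' F)) atTop (𝓝 0) := by
    rw [show (0 : ℝ≥0∞) = ∑ i ∈ Finset.range J, ∑ j ∈ Finset.range J, 0 by simp]
    refine tendsto_finsetSum _ fun i _ => tendsto_finsetSum _ fun j _ => h.comp ?_
    exact tendsto_atTop_mono (fun n => by omega) (tendsto_sub_atTop_nat i)
  filter_upwards [ENNReal.tendsto_nhds_zero.1 hsum (ε / 2) (ENNReal.half_pos hε.ne'),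
    eventually_ge_atTop J] with n hn hnJ
  -- outside the small set `B \ G J`, a visit to `B` comes shortly before a visit to `F`
  have hsub : B ∩ T^[n] ⁻¹' B ⊆ (B \ G J) ∪ T^[n] ⁻¹' (B \ G J) ∪
      ⋃ i ∈ Finset.range J, ⋃ j ∈ Finset.range J, (T^[i] ⁻¹' F ∩ T^[n + j] ⁻¹' F) := by
    rintro x ⟨hx, hx'⟩
    by_cases h1 : x ∈ G J
    · by_cases h2 : T^[n] x ∈ G J
      · right
        obtain ⟨i, hi, hi'⟩ := mem_iUnion₂.1 h1
        obtain ⟨j, hj, hj'⟩ := mem_iUnion₂.1 h2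
        refine mem_biUnion hi (mem_biUnion hj ⟨hi', ?_⟩)
        rw [mem_preimage, add_comm, Function.iterate_add_apply]
        exact hj'
      · exact Or.inl (Or.inr ⟨hx', h2⟩)
    · exact Or.inl (Or.inl ⟨hx, h1⟩)
  calc m (B ∩ T^[n] ⁻¹' B) ≤ _ := measure_mono hsub
    _ ≤ m (B \ G J) + m (T^[n] ⁻¹' (B \ G J)) + ∑ i ∈ Finset.range J, ∑ j ∈ Finset.range J,
        m (T^[i] ⁻¹' F ∩ T^[n + j] ⁻¹' F) := by
      refine (measure_union_le _ _).trans (add_le_add (measure_union_le _ _) ?_)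
      exact (measure_biUnion_finset_le _ _).trans
        (Finset.sum_le_sum fun i _ => measure_biUnion_finset_le _ _)
    _ ≤ ε / 2 / 2 + ε / 2 / 2 + ε / 2 := by
      rw [(hmp.iterate n).measure_preimage (hB.diff (hGm J)).nullMeasurableSet]
      refine add_le_add (add_le_add hJ hJ) (le_trans (le_of_eq ?_) hn)
      refine Finset.sum_congr rfl fun i hi => Finset.sum_congr rfl fun j _ =>
        measure_preimage_inter_preimage hmp hF hF ?_
      have := Finset.mem_range.1 hi
      omega
    _ = ε := by rw [ENNReal.add_halves, ENNReal.add_halves]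

/-- The one-point system is ergodic, and the product with it is the transformation itself. -/
theorem IsWeaklyMixing.ergodic [SFinite m] (h : IsWeaklyMixing T m) (hT : Measurable T) :
    Ergodic T m := by
  have h1 := h Unit (Measure.dirac ()) id
    ⟨MeasurePreserving.id _, ⟨fun s _ _ => by
      rcases s.eq_empty_or_nonempty with rfl | ⟨⟨⟩, hs⟩
      · exact eventuallyConst_set'.2 (Or.inl (EventuallyEq.refl _ _))
      · rw [show s = univ by ext ⟨⟩; simp [hs]]
        exact eventuallyConst_set'.2 (Or.inr (EventuallyEq.refl _ _))⟩⟩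
  exact measurePreserving_fst.ergodic_of_ergodic_semiconj h1 hT fun _ => rfl

end GeneralErgodicTheory

/-! ### Weak limits of normalized sums in `L²(F)` -/

section RationalSets

open scoped RealInnerProductSpace

/-- For a bounded sequence in a Hilbert space, the vectors against which its inner products tend
to `0` form a closed subspace. -/
def weakNullSubmodule {H : Type*} [NormedAddCommGroup H] [InnerProductSpace ℝ H] (x : ℕ → H) :
    Submodule ℝ H where
  carrier := {f | Tendsto (fun n => ⟪x n, f⟫) atTop (𝓝 0)}
  add_mem' {f g} hf hg := by
    simpa [inner_add_right] using Tendsto.add hf hg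
  zero_mem' := by simp
  smul_mem' c f hf := by
    simpa [inner_smul_right] using Tendsto.const_mul c hf

theorem isClosed_weakNullSubmodule {H : Type*} [NormedAddCommGroup H] [InnerProductSpace ℝ H]
    {x : ℕ → H} {M : ℝ} (hM : ∀ᶠ n in atTop, ‖x n‖ ≤ M) :
    IsClosed (weakNullSubmodule x : Set H) := by
  rw [← isSeqClosed_iff_isClosed]
  intro f g hf hfg
  have hM0 : 0 ≤ M := (norm_nonneg _).trans hM.exists.choose_spec
  change Tendsto (fun n => ⟪x n, g⟫) atTop (𝓝 0)
  rw [Metric.tendsto_atTop'] at hfg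
  rw [Metric.tendsto_nhds]
  intro ε hε
  obtain ⟨N, hN⟩ := hfg (ε / (2 * (M + 1))) (by positivity)
  have h1 : Tendsto (fun n => ⟪x n, f (N + 1)⟫) atTop (𝓝 0) := hf (N + 1)
  rw [Metric.tendsto_nhds] at h1
  filter_upwards [h1 (ε / 2) (by positivity), hM] with n hn hMn
  rw [Real.dist_eq, sub_zero] at hn ⊢
  have h2 : ⟪x n, g⟫ = ⟪x n, f (N + 1)⟫ - ⟪x n, f (N + 1) - g⟫ := by
    rw [inner_sub_right]; ring
  have h3 : |⟪x n, f (N + 1) - g⟫| ≤ M * ‖f (N + 1) - g‖ :=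
    (abs_real_inner_le_norm _ _).trans (by gcongr)
  have h4 : M * ‖f (N + 1) - g‖ ≤ ε / 2 := by
    have h5 := hN (N + 1) (Nat.lt_succ_self N)
    rw [dist_eq_norm] at h5
    calc M * ‖f (N + 1) - g‖ ≤ (M + 1) * (ε / (2 * (M + 1))) := by gcongr; linarith
      _ = ε / 2 := by field_simp
  rw [h2]
  calc _ ≤ |⟪x n, f (N + 1)⟫| + |⟪x n, f (N + 1) - g⟫| := abs_sub _ _
    _ < ε := by linarith

variable {X : Type*} [MeasurableSpace X] {T : X → X} {m : Measure X}

/-- A function on `F` whose integrals over `B` and over `T⁻ⁱ B` agree whenever both sets lie in `F`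
is constant: otherwise some `Tⁱ` carries a piece of `{g > c}` into `{g < c}`. -/
theorem ae_eq_const_of_setIntegral_preimage_eq [StandardBorelSpace X] (hc : Conservative T m)
    (he : Ergodic T m) (hinj : Function.Injective T) {F : Set X} (hF : MeasurableSet F)
    (hFtop : m F < ∞) {g : X → ℝ} (hgm : Measurable g) (hg : IntegrableOn g F m)
    (h : ∀ (B : Set X) (i : ℕ), MeasurableSet B → B ⊆ F → T^[i] ⁻¹' B ⊆ F →
      ∫ x in B, g x ∂m = ∫ x in T^[i] ⁻¹' B, g x ∂m) :
    ∃ c : ℝ, g =ᵐ[m.restrict F] fun _ => c := by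
  by_cases h0 : m F = 0
  · exact ⟨0, by rw [Measure.restrict_eq_zero.2 h0]; exact ae_zero.symm ▸ eventually_bot⟩
  have hFr : m.real F ≠ 0 := (ENNReal.toReal_pos h0 hFtop.ne).ne'
  set c : ℝ := (∫ x in F, g x ∂m) / m.real F with hcdef
  have hconst : IntegrableOn (fun _ => c) F m := integrableOn_const hFtop.ne
  have hzero : ∫ x in F, (c - g x) ∂m = 0 := by
    rw [integral_sub hconst hg, setIntegral_const, smul_eq_mul, hcdef]
    field_simp
    ring
  have hzero' : ∫ x in F, (g x - c) ∂m = 0 := by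
    rw [← neg_zero, ← hzero, ← integral_neg]
    simp
  refine ⟨c, ?_⟩
  -- if `g ≥ c` or `g ≤ c` almost everywhere, then `g = c`, as `c` is the mean of `g`
  have key1 : (∀ᵐ x ∂m.restrict F, 0 ≤ g x - c) → g =ᵐ[m.restrict F] fun _ => c := by
    intro h1
    filter_upwards [(integral_eq_zero_iff_of_nonneg_ae h1 (hg.sub hconst)).1 hzero'] with x hx
    simpa [sub_eq_zero] using hx
  have key2 : (∀ᵐ x ∂m.restrict F, 0 ≤ c - g x) → g =ᵐ[m.restrict F] fun _ => c := by
    intro h1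
    filter_upwards [(integral_eq_zero_iff_of_nonneg_ae h1 (hconst.sub hg)).1 hzero] with x hx
    have : c - g x = 0 := hx
    linarith
  by_contra hne
  set D : Set X := F ∩ {x | c < g x}
  set D' : Set X := F ∩ {x | g x < c}
  have hD : MeasurableSet D := hF.inter (measurableSet_lt measurable_const hgm)
  have hD' : MeasurableSet D' := hF.inter (measurableSet_lt hgm measurable_const)
  have hD0 : m D ≠ 0 := by
    intro h1
    refine hne (key2 ?_)
    rw [ae_restrict_iff' hF]
    filter_upwards [measure_eq_zero_iff_ae_notMem.1 h1] with x hx hxF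
    by_contra h2
    exact hx ⟨hxF, by simp only [mem_ofPred_eq]; linarith⟩
  have hD0' : m D' ≠ 0 := by
    intro h1
    refine hne (key1 ?_)
    rw [ae_restrict_iff' hF]
    filter_upwards [measure_eq_zero_iff_ae_notMem.1 h1] with x hx hxF
    by_contra h2
    exact hx ⟨hxF, by simp only [mem_ofPred_eq]; linarith⟩
  obtain ⟨i, hi⟩ := exists_measure_inter_preimage_ne_zero hc he hD0 hD' hD0'
  have hmp := he.toMeasurePreserving.iterate i
  set E := D ∩ T^[i] ⁻¹' D' with hE
  have hEm : MeasurableSet E := hD.inter (hmp.measurable hD')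
  -- the image is measurable because `T` is injective on a standard Borel space
  set B := T^[i] '' E with hB
  have hBm : MeasurableSet B :=
    hEm.image_of_measurable_injOn hmp.measurable (hinj.iterate i).injOn
  have hpre : T^[i] ⁻¹' B = E := preimage_image_eq _ (hinj.iterate i)
  have hBD : B ⊆ D' := by
    rintro _ ⟨x, hx, rfl⟩
    exact hx.2
  have hBF : B ⊆ F := hBD.trans inter_subset_left
  have hEF : E ⊆ F := inter_subset_left.trans inter_subset_left
  have hmeas : m B = m E := by rw [← hpre, hmp.measure_preimage hBm.nullMeasurableSet]
  have h1 := h B i hBm hBF (hpre ▸ hEF)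
  rw [hpre] at h1
  have hBc : IntegrableOn (fun _ => c) B m := hconst.mono_set hBF
  have hEc : IntegrableOn (fun _ => c) E m := hconst.mono_set hEF
  have h2 : ∫ x in B, (c - g x) ∂m = c * m.real B - ∫ x in B, g x ∂m := by
    rw [integral_sub hBc (hg.mono_set hBF), setIntegral_const, smul_eq_mul, mul_comm]
  have h3 : ∫ x in E, (g x - c) ∂m = (∫ x in E, g x ∂m) - c * m.real E := by
    rw [integral_sub (hg.mono_set hEF) hEc, setIntegral_const, smul_eq_mul, mul_comm]
  have h4 : 0 ≤ ∫ x in E, (g x - c) ∂m :=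
    setIntegral_nonneg hEm fun x hx => by have := hx.1.2; simp only [mem_ofPred_eq] at this; linarith
  have h5 : ∀ x ∈ B, 0 ≤ c - g x := fun x hx => by
    have := (hBD hx).2; simp only [mem_ofPred_eq] at this; linarith
  have h6 : 0 ≤ ∫ x in B, (c - g x) ∂m := setIntegral_nonneg hBm h5
  have h7 : ∫ x in B, (c - g x) ∂m = 0 := by
    have : m.real B = m.real E := by simp only [measureReal_def, hmeas]
    rw [this] at h2
    linarith
  have h8 := (integral_eq_zero_iff_of_nonneg_ae ((ae_restrict_iff' hBm).2 (ae_of_all _ h5))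
    (hBc.sub (hg.mono_set hBF))).1 h7
  apply hi
  rw [← hmeas, measure_eq_zero_iff_ae_notMem]
  filter_upwards [(ae_restrict_iff' hBm).1 h8] with x hx hxB
  have h9 : c - g x = 0 := hx hxB
  have h10 := (hBD hxB).2
  simp only [mem_ofPred_eq] at h10
  linarith

/-- Let `x_n` be the function `∑_{k < n} 1_{G k n}` divided by `A_n`. If it is bounded in `L²(F)`
and asymptotically gives the same mass to `B` and to `T⁻ⁱ B`, then all its weak limits in `L²(F)`
are constant. -/
theorem tendsto_sum_measureReal_inter_sub_average [StandardBorelSpace X] (hc : Conservative T m)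
    (he : Ergodic T m) (hinj : Function.Injective T) {F : Set X} (hF : MeasurableSet F)
    (hFtop : m F < ∞) (h0 : m F ≠ 0) {A : ℕ → ℝ} (hA : Tendsto A atTop atTop)
    {G : ℕ → ℕ → Set X} (hG : ∀ n k, MeasurableSet (G n k)) {C : ℝ}
    (hC : ∀ n, ∑ j ∈ Finset.range n, ∑ k ∈ Finset.range n, m.real (F ∩ (G n j ∩ G n k)) ≤
      C * A n ^ 2)
    (hinv : ∀ (B : Set X) (i : ℕ), MeasurableSet B → B ⊆ F → T^[i] ⁻¹' B ⊆ F → ∃ c : ℝ, ∀ n,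
      |∑ k ∈ Finset.range n, (m.real (B ∩ G n k) - m.real (T^[i] ⁻¹' B ∩ G n k))| ≤ c)
    {B : Set X} (hB : MeasurableSet B) (hBF : B ⊆ F) :
    Tendsto (fun n => (∑ k ∈ Finset.range n,
      (m.real (B ∩ G n k) - m.real B / m.real F * m.real (F ∩ G n k))) / A n) atTop (𝓝 0) := by
  have hFr : m.real F ≠ 0 := (ENNReal.toReal_pos h0 hFtop.ne).ne'
  have : IsFiniteMeasure (m.restrict F) := ⟨by rwa [Measure.restrict_apply_univ]⟩
  let ind : ∀ s : Set X, MeasurableSet s → Lp ℝ 2 (m.restrict F) :=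
    fun s hs => indicatorConstLp 2 hs (measure_ne_top _ s) 1
  have hind : ∀ s hs t ht, ⟪ind s hs, ind t ht⟫ = m.real (F ∩ (s ∩ t)) := by
    intro s hs t ht
    rw [L2.real_inner_indicatorConstLp_one_indicatorConstLp_one,
      measureReal_restrict_apply (hs.inter ht), inter_comm]
  have hind1 : ∀ s hs (f : Lp ℝ 2 (m.restrict F)), s ⊆ F →
      ⟪ind s hs, f⟫ = ∫ x in s, f x ∂m := by
    intro s hs f hsF
    rw [L2.inner_indicatorConstLp_one, Measure.restrict_restrict hs, inter_eq_left.2 hsF]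
  let x : ℕ → Lp ℝ 2 (m.restrict F) := fun n =>
    (A n)⁻¹ • ∑ k ∈ Finset.range n, ind (G n k) (hG n k)
  have hx : ∀ n s hs, s ⊆ F → ⟪x n, ind s hs⟫ =
      (∑ k ∈ Finset.range n, m.real (s ∩ G n k)) / A n := by
    intro n s hs hsF
    simp only [x, inner_smul_left, sum_inner, hind, RCLike.conj_to_real]
    rw [div_eq_inv_mul]
    congr 1
    refine Finset.sum_congr rfl fun k _ => ?_
    rw [inter_comm (G n k), ← inter_assoc, inter_eq_right.2 hsF]
  have hbdd : ∀ᶠ n in atTop, ‖x n‖ ≤ √C := by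
    filter_upwards [hA.eventually_gt_atTop 0] with n hn
    refine Real.le_sqrt_of_sq_le ?_
    rw [← real_inner_self_eq_norm_sq]
    simp only [x, inner_smul_left, inner_smul_right, sum_inner, inner_sum, hind,
      RCLike.conj_to_real]
    rw [← Finset.mul_sum, ← mul_assoc, ← mul_inv, ← div_eq_inv_mul, div_le_iff₀ (by positivity),
      ← sq, Finset.sum_comm]
    exact hC n
  set K := weakNullSubmodule x
  have : CompleteSpace K := (isClosed_weakNullSubmodule hbdd).completeSpace_coe
  -- functions orthogonal to `K` are constant, so `K` contains all functions in `F` of mean zero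
  have hmem : ind B hB - (m.real B / m.real F) • ind F hF ∈ K := by
    rw [← K.orthogonal_orthogonal, Submodule.mem_orthogonal]
    intro g hg
    rw [Submodule.mem_orthogonal] at hg
    have hgi : IntegrableOn g F m := (Lp.memLp g).integrable (by norm_num)
    obtain ⟨c, hgc⟩ := ae_eq_const_of_setIntegral_preimage_eq hc he hinj hF hFtop
      (Lp.stronglyMeasurable g).measurable hgi (by
        intro B i hB hBF hBF'
        have hB' : MeasurableSet (T^[i] ⁻¹' B) := he.measurable.iterate i hB
        have h1 : ind B hB - ind (T^[i] ⁻¹' B) hB' ∈ K := by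
          change Tendsto (fun n => ⟪x n, ind B hB - ind (T^[i] ⁻¹' B) hB'⟫) atTop (𝓝 0)
          simp only [inner_sub_right, hx _ _ _ hBF, hx _ _ _ hBF', ← sub_div,
            ← Finset.sum_sub_distrib]
          obtain ⟨b, hb⟩ := hinv B i hB hBF hBF'
          refine squeeze_zero_norm' ?_
            (tendsto_const_nhds.div_atTop hA : Tendsto (fun n => b / A n) atTop (𝓝 0))
          filter_upwards [hA.eventually_gt_atTop 0] with n hn
          rw [norm_div, Real.norm_eq_abs, Real.norm_of_nonneg hn.le]
          exact div_le_div_of_nonneg_right (hb n) hn.le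
        have h2 := hg _ h1
        rw [inner_sub_left, hind1 _ _ _ hBF, hind1 _ _ _ hBF', sub_eq_zero] at h2
        exact h2)
    have h3 : ∀ s : Set X, MeasurableSet s → s ⊆ F → ∫ x in s, g x ∂m = m.real s * c := by
      intro s hs hsF
      rw [integral_congr_ae (ae_restrict_of_ae_restrict_of_subset hsF hgc), setIntegral_const,
        smul_eq_mul]
    rw [real_inner_comm, inner_sub_left, inner_smul_left, hind1 _ _ _ hBF, hind1 _ _ _ subset_rfl,
      h3 B hB hBF, h3 F hF subset_rfl]
    simp only [RCLike.conj_to_real]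
    field_simp
    ring
  have h1 : Tendsto (fun n => ⟪x n, ind B hB - (m.real B / m.real F) • ind F hF⟫) atTop (𝓝 0) :=
    hmem
  refine h1.congr fun n => ?_
  rw [inner_sub_right, inner_smul_right, hx _ _ _ hBF, hx _ _ _ subset_rfl,
    Finset.sum_sub_distrib, ← Finset.mul_sum, sub_div, mul_div_assoc]

end RationalSets

/-! ### The Rényi inequality and the class `R(T)` -/

section RenyiSets

theorem sum_sum_le_two_mul_sum_sum_add {t : ℕ → ℕ → ℝ} (hsymm : ∀ j k, t j k = t k j)
    (h0 : ∀ j k, 0 ≤ t j k) (n : ℕ) :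
    ∑ j ∈ Finset.range n, ∑ k ∈ Finset.range n, t j k ≤
      2 * ∑ j ∈ Finset.range n, ∑ b ∈ Finset.range n, t j (j + b) := by
  have h1 : ∀ j ∈ Finset.range n, ∑ k ∈ Finset.range n, (if j ≤ k then t j k else 0) ≤
      ∑ b ∈ Finset.range n, t j (j + b) := by
    intro j hj
    rw [← Finset.sum_filter]
    have : (Finset.range n).filter (fun k => j ≤ k) = Finset.Ico j n := by
      ext k; simp [and_comm]
    rw [this, Finset.sum_Ico_eq_sum_range]
    exact Finset.sum_le_sum_of_subset_of_nonneg (Finset.range_mono (Nat.sub_le _ _))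
      fun _ _ _ => h0 _ _
  have h2 : ∑ j ∈ Finset.range n, ∑ k ∈ Finset.range n, t j k ≤
      ∑ j ∈ Finset.range n, ∑ k ∈ Finset.range n,
        ((if j ≤ k then t j k else 0) + (if k ≤ j then t k j else 0)) := by
    refine Finset.sum_le_sum fun j _ => Finset.sum_le_sum fun k _ => ?_
    rcases le_total j k with h | h
    · rw [if_pos h]; split_ifs <;> linarith [h0 k j]
    · rw [if_pos h, hsymm k j]; split_ifs <;> linarith [h0 j k]
  refine h2.trans ?_
  simp only [Finset.sum_add_distrib]
  rw [two_mul, Finset.sum_comm (f := fun j k => if k ≤ j then t k j else 0)]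
  exact add_le_add (Finset.sum_le_sum h1) (Finset.sum_le_sum h1)

theorem abs_sum_shift_sub_le {g : ℕ → ℝ} {M : ℝ} (h0 : ∀ k, 0 ≤ g k) (hM : ∀ k, g k ≤ M)
    (i n : ℕ) : |∑ k ∈ Finset.range n, (g (k + i) - g k)| ≤ i * M := by
  induction i with
  | zero => simp
  | succ i ih =>
    have h1 : ∑ k ∈ Finset.range n, (g (k + (i + 1)) - g k) =
        (g (n + i) - g (0 + i)) + ∑ k ∈ Finset.range n, (g (k + i) - g k) := by
      rw [← Finset.sum_range_sub (fun k => g (k + i)), ← Finset.sum_add_distrib]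
      refine Finset.sum_congr rfl fun k _ => ?_
      rw [show k + 1 + i = k + (i + 1) by ring]
      ring
    rw [h1]
    refine (abs_add_le _ _).trans ?_
    have h2 : |g (n + i) - g (0 + i)| ≤ M :=
      abs_sub_le_iff.2 ⟨by linarith [h0 (0 + i), hM (n + i)], by linarith [h0 (n + i), hM (0 + i)]⟩
    push_cast
    linarith

variable {X : Type*} [MeasurableSpace X] {T : X → X} {m : Measure X}

/-- The expected number of returns is infinite, by the Borel–Cantelli lemma and recurrence. -/
theorem tendsto_sum_measureReal_inter_preimage_self (hc : Conservative T m) {F : Set X}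
    (hF : MeasurableSet F) (h0 : m F ≠ 0) (hFtop : m F < ∞) :
    Tendsto (fun n => ∑ k ∈ Finset.range n, m.real (F ∩ T^[k] ⁻¹' F)) atTop atTop := by
  rw [← not_summable_iff_tendsto_nat_atTop_of_nonneg fun _ => measureReal_nonneg]
  intro hs
  have h1 : ∑' k : ℕ, m (F ∩ T^[k] ⁻¹' F) ≠ ∞ := by
    have h2 := hs.tsum_ofReal_ne_top
    simpa only [measureReal_def, ENNReal.ofReal_toReal
      (measure_ne_top_of_subset (inter_subset_left (s := F)) hFtop.ne)] using h2
  have h2 := measure_setOfPred_frequently_eq_zero h1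
  apply h0
  rw [measure_eq_zero_iff_ae_notMem] at h2 ⊢
  filter_upwards [h2, hc.ae_mem_imp_frequently_image_mem hF.nullMeasurableSet] with x hx hx1 hxF
  exact hx ((hx1 hxF).mono fun n hn => ⟨hxF, hn⟩)

/-- The diagonal form of the Rényi inequality: the sum runs over the two successive gaps `a`, `b`
between three visits to `F`. -/
def HasRenyiBound (T : X → X) (m : Measure X) (F : Set X) (C : ℝ) : Prop :=
  ∀ n : ℕ, ∑ a ∈ Finset.range n, ∑ b ∈ Finset.range n,
      m.real (F ∩ (T^[a] ⁻¹' F ∩ T^[a + b] ⁻¹' F)) ≤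
    C * (∑ k ∈ Finset.range n, m.real (F ∩ T^[k] ⁻¹' F)) ^ 2

theorem HasRenyiBound.sum_sum_le {F : Set X} {C : ℝ} (h : HasRenyiBound T m F C) (n : ℕ) :
    ∑ j ∈ Finset.range n, ∑ k ∈ Finset.range n, m.real (F ∩ (T^[j] ⁻¹' F ∩ T^[k] ⁻¹' F)) ≤
      2 * C * (∑ k ∈ Finset.range n, m.real (F ∩ T^[k] ⁻¹' F)) ^ 2 := by
  refine (sum_sum_le_two_mul_sum_sum_add (fun j k => ?_) (fun _ _ => measureReal_nonneg) n).trans ?_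
  · rw [inter_comm (T^[j] ⁻¹' F)]
  · rw [mul_assoc]
    exact mul_le_mul_of_nonneg_left (h n) two_pos.le

/-- The factor `2` accounts for the order of the two visits in the double sum. -/
theorem HasRenyiBound.isRenyiSet {F : Set X} {C : ℝ} (h : HasRenyiBound T m F C)
    (hT : Measurable T) (hF : MeasurableSet F) (h0 : m F ≠ 0) (hFtop : m F < ∞) :
    IsRenyiSet T m F := by
  refine ⟨hF, pos_iff_ne_zero.2 h0, hFtop, 2 * C, fun n => ?_⟩
  have : IsFiniteMeasure (m.restrict F) := ⟨by rwa [Measure.restrict_apply_univ]⟩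
  have hm : ∀ k, MeasurableSet (T^[k] ⁻¹' F) := fun k => hT.iterate k hF
  have hb : ∀ x, birkhoffSum T (F.indicator fun _ => (1 : ℝ)) n x =
      ∑ k ∈ Finset.range n, (T^[k] ⁻¹' F).indicator (fun _ => (1 : ℝ)) x := fun x => rfl
  have hint : ∀ s : Set X, MeasurableSet s →
      Integrable (s.indicator fun _ => (1 : ℝ)) (m.restrict F) := fun s hs =>
    (integrable_const _).indicator hs
  have hval : ∀ s : Set X, MeasurableSet s →
      ∫ x in F, s.indicator (fun _ => (1 : ℝ)) x ∂m = m.real (F ∩ s) := fun s hs => by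
    rw [integral_indicator_const _ hs, smul_eq_mul, mul_one, measureReal_restrict_apply hs,
      inter_comm]
  simp only [hb]
  rw [integral_finsetSum _ fun k _ => hint _ (hm k)]
  have hsq : ∀ x, (∑ k ∈ Finset.range n, (T^[k] ⁻¹' F).indicator (fun _ => (1 : ℝ)) x) ^ 2 =
      ∑ j ∈ Finset.range n, ∑ k ∈ Finset.range n,
        (T^[j] ⁻¹' F ∩ T^[k] ⁻¹' F).indicator (fun _ => (1 : ℝ)) x := fun x => by
    rw [sq, Finset.sum_mul_sum]
    refine Finset.sum_congr rfl fun j _ => Finset.sum_congr rfl fun k _ => ?_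
    rw [← inter_indicator_mul]
    simp
  simp only [hsq]
  rw [integral_finsetSum _ fun j _ => integrable_finsetSum _ fun k _ =>
    hint _ ((hm j).inter (hm k))]
  simp only [hval _ (hm _)]
  refine le_trans (le_of_eq (Finset.sum_congr rfl fun j _ => ?_)) (h.sum_sum_le n)
  rw [integral_finsetSum _ fun k _ => hint _ ((hm j).inter (hm k))]
  exact Finset.sum_congr rfl fun k _ => hval _ ((hm j).inter (hm k))

/-- Sets with a Rényi inequality belong to `R(T)`. The sums `∑ m (B ∩ T⁻ᵏ D)` do not depend on where
in `F` the set `B` lies, nor, by the same argument for the inverse of `T`, on where `D` lies. -/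
theorem HasRenyiBound.mem_rationalSets [StandardBorelSpace X] (hc : Conservative T m)
    (he : Ergodic T m) (hinj : Function.Injective T) {F : Set X} {C : ℝ}
    (h : HasRenyiBound T m F C) (hF : MeasurableSet F) (h0 : m F ≠ 0) (hFtop : m F < ∞) :
    F ∈ rationalSets T m := by
  refine ⟨hF, pos_iff_ne_zero.2 h0, hFtop, fun B D hB hD hBF hDF => ?_⟩
  have hFr : m.real F ≠ 0 := (ENNReal.toReal_pos h0 hFtop.ne).ne'
  have hmp := he.toMeasurePreserving
  have hA := tendsto_sum_measureReal_inter_preimage_self hc hF h0 hFtop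
  set A : ℕ → ℝ := fun n => ∑ k ∈ Finset.range n, m.real (F ∩ T^[k] ⁻¹' F) with hAdef
  have hpm : ∀ k {s : Set X}, MeasurableSet s → MeasurableSet (T^[k] ⁻¹' s) :=
    fun k s hs => hmp.measurable.iterate k hs
  have hle : ∀ {s t : Set X}, s ⊆ F → m.real (s ∩ t) ≤ m.real F := fun hs =>
    measureReal_mono (inter_subset_left.trans hs) hFtop.ne
  -- visits to `D` at the times `k < n`, seen from `F`
  have hforw := tendsto_sum_measureReal_inter_sub_average hc he hinj hF hFtop h0 hA
    (G := fun _ k => T^[k] ⁻¹' D) (fun _ k => hpm k hD) (C := 2 * C) (fun n => by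
      refine le_trans (Finset.sum_le_sum fun j _ => Finset.sum_le_sum fun k _ => ?_)
        (h.sum_sum_le n)
      exact measureReal_mono (inter_subset_inter_right _ (inter_subset_inter
        (preimage_mono hDF) (preimage_mono hDF)))
        (measure_ne_top_of_subset inter_subset_left hFtop.ne)) (by
      intro B' i hB' hBF' hBF''
      refine ⟨i * m.real F, fun n => ?_⟩
      refine le_trans (le_of_eq ?_) (abs_sum_shift_sub_le
        (g := fun k => m.real (T^[i] ⁻¹' B' ∩ T^[k] ⁻¹' D)) (fun _ => measureReal_nonneg)
        (fun k => hle hBF'') i n)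
      congr 1
      refine Finset.sum_congr rfl fun k _ => ?_
      simp only [measureReal_def]
      rw [measure_preimage_inter_preimage hmp hB' hD (Nat.le_add_left i k), Nat.add_sub_cancel])
    hB hBF
  -- visits from `F`, seen from `D`: the same for the inverse of `T`
  have himg : ∀ k, MeasurableSet (T^[k] '' F) := fun k =>
    hF.image_of_measurable_injOn (hmp.measurable.iterate k) (hinj.iterate k).injOn
  have himg1 : ∀ k (s : Set X), MeasurableSet s →
      m.real (s ∩ T^[k] '' F) = m.real (F ∩ T^[k] ⁻¹' s) := fun k s hs => by
    simp only [measureReal_def]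
    rw [← (hmp.iterate k).measure_preimage (hs.inter (himg k)).nullMeasurableSet, preimage_inter,
      preimage_image_eq _ (hinj.iterate k), inter_comm]
  have hback := tendsto_sum_measureReal_inter_sub_average hc he hinj hF hFtop h0 hA
    (G := fun _ k => T^[k] '' F) (fun _ k => himg k) (C := 2 * C) (fun n => by
      refine (sum_sum_le_two_mul_sum_sum_add (fun j k => ?_)
        (fun _ _ => measureReal_nonneg) n).trans ?_
      · rw [inter_comm (T^[j] '' F)]
      · rw [mul_assoc, Finset.sum_comm]
        refine mul_le_mul_of_nonneg_left (le_trans (le_of_eq ?_) (h n)) two_pos.le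
        refine Finset.sum_congr rfl fun a _ => Finset.sum_congr rfl fun b _ => ?_
        have hpre : T^[b + a] ⁻¹' (T^[b] '' F) = T^[a] ⁻¹' F := by
          rw [Function.iterate_add, preimage_comp, preimage_image_eq _ (hinj.iterate b)]
        rw [← inter_assoc, himg1 _ _ (hF.inter (himg _)), preimage_inter, hpre, add_comm b a,
          inter_comm (T^[a + b] ⁻¹' F)]) (by
      intro B' i hB' hBF' hBF''
      refine ⟨i * m.real F, fun n => ?_⟩
      refine le_trans (le_of_eq ?_) (abs_sum_shift_sub_le
        (g := fun k => m.real (F ∩ T^[k] ⁻¹' B')) (fun _ => measureReal_nonneg)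
        (fun k => hle subset_rfl) i n)
      rw [← abs_neg, ← Finset.sum_neg_distrib]
      congr 1
      refine Finset.sum_congr rfl fun k _ => ?_
      rw [himg1 _ _ hB', himg1 _ _ (hpm i hB'), ← preimage_comp, ← Function.iterate_add,
        add_comm i k, neg_sub])
    hD hDF
  have hback' : Tendsto (fun n => (∑ k ∈ Finset.range n, m.real (F ∩ T^[k] ⁻¹' D)) / A n) atTop
      (𝓝 (m.real D / m.real F)) := by
    have h1 := hback.add_const (m.real D / m.real F)
    rw [zero_add] at h1
    refine h1.congr' ?_
    filter_upwards [hA.eventually_gt_atTop 0] with n hn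
    simp only [himg1 _ _ hD, himg1 _ _ hF, Finset.sum_sub_distrib, ← Finset.mul_sum]
    rw [sub_div, mul_div_assoc, show (∑ k ∈ Finset.range n, m.real (F ∩ T^[k] ⁻¹' F)) / A n = 1
      from div_self hn.ne', mul_one, sub_add_cancel]
  have h1 := (hforw.add (hback'.const_mul (m.real B / m.real F))).mul_const (m.real F ^ 2)
  have h2 : (0 + m.real B / m.real F * (m.real D / m.real F)) * m.real F ^ 2 =
      m.real B * m.real D := by field_simp; ring
  rw [h2] at h1
  refine h1.congr' ?_
  filter_upwards [hA.eventually_gt_atTop 0] with n hn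
  have h3 : returnSeq T m F n = A n / m.real F ^ 2 := by
    simp only [returnSeq, returnProb, hAdef, Finset.sum_div]
  rw [h3, Finset.sum_sub_distrib, ← Finset.mul_sum]
  field_simp
  ring

end RenyiSets

/-! ### Kaluza sequences and null recurrence -/

section Kaluza

/-- The ratios `u (n + 1) / u n` of a Kaluza sequence increase, so a ratio above `1` would force
exponential growth. -/
theorem IsKaluza.antitone {u : ℕ → ℝ} (h : IsKaluza u) (h1 : ∀ n, u n ≤ 1) : Antitone u := by
  obtain ⟨-, hpos, hk⟩ := h
  refine antitone_nat_of_succ_le fun n => ?_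
  by_contra! hlt
  set r := u (n + 1) / u n
  have hr : 1 < r := (one_lt_div (hpos n)).2 hlt
  have hstep : ∀ k, r * u (n + k) ≤ u (n + k + 1) := by
    intro k
    induction k with
    | zero => simp [r, (hpos n).ne']
    | succ k ih =>
      have h2 := hk (n + k)
      have h3 : u (n + (k + 1)) = u (n + k + 1) := rfl
      have h4 : u (n + (k + 1) + 1) = u (n + k + 2) := rfl
      rw [h3, h4]
      have h5 : r * u (n + k) * u (n + k + 1) ≤ u (n + k) * u (n + k + 2) := by
        refine le_trans ?_ h2
        rw [sq]
        exact mul_le_mul_of_nonneg_right ih (hpos _).le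
      have h6 : u (n + k) * (r * u (n + k + 1)) ≤ u (n + k) * u (n + k + 2) := by linarith
      exact le_of_mul_le_mul_left h6 (hpos _)
  have hpow : ∀ k, r ^ k * u n ≤ u (n + k) := by
    intro k
    induction k with
    | zero => simp
    | succ k ih =>
      calc r ^ (k + 1) * u n = r * (r ^ k * u n) := by ring
        _ ≤ r * u (n + k) := by gcongr
        _ ≤ u (n + (k + 1)) := hstep k
  obtain ⟨k, hk'⟩ := pow_unbounded_of_one_lt (1 / u n) hr
  have h7 := hpow k
  rw [div_lt_iff₀ (hpos n)] at hk'
  linarith [h1 (n + k)]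

open scoped RealInnerProductSpace in
/-- In an ergodic system of infinite measure the correlations of a set of finite measure tend to `0`
in the mean, by the mean ergodic theorem: there are no invariant vectors in `L²`. -/
theorem tendsto_average_measureReal_inter_preimage {X : Type*} [MeasurableSpace X] {T : X → X}
    {m : Measure X} (he : Ergodic T m) (htop : m univ = ∞) {A : Set X} (hA : MeasurableSet A)
    (hAtop : m A ≠ ∞) :
    Tendsto (fun n : ℕ => (n : ℝ)⁻¹ * ∑ k ∈ Finset.range n, m.real (A ∩ T^[k] ⁻¹' A)) atTop
      (𝓝 0) := by
  have hmp := he.toMeasurePreserving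
  let K : Lp ℝ 2 m →L[ℝ] Lp ℝ 2 m :=
    (Lp.compMeasurePreservingₗᵢ ℝ T hmp).toContinuousLinearMap
  have hK : ‖K‖ ≤ 1 := LinearIsometry.norm_toContinuousLinearMap_le _
  have h1 := K.tendsto_birkhoffAverage_orthogonalProjection hK (indicatorConstLp 2 hA hAtop (1 : ℝ))
  set p := (K.eqLocus (1 : Lp ℝ 2 m →L[ℝ] Lp ℝ 2 m)).orthogonalProjectionOnto
    (indicatorConstLp 2 hA hAtop (1 : ℝ)) with hp
  have hp0 : (p : Lp ℝ 2 m) = 0 := by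
    have hfix : K (p : Lp ℝ 2 m) = p := p.2
    have hfix' : (p : Lp ℝ 2 m) ∘ T =ᵐ[m] (p : Lp ℝ 2 m) := by
      have h2 := Lp.coeFn_compMeasurePreserving (p : Lp ℝ 2 m) hmp
      have h3 : Lp.compMeasurePreserving T hmp (p : Lp ℝ 2 m) = p := hfix
      rw [h3] at h2
      exact h2.symm
    obtain ⟨c, hc⟩ := he.ae_eq_const_of_ae_eq_comp_ae (Lp.aestronglyMeasurable _) hfix'
    have h4 : MemLp (fun _ : X => c) 2 m := (memLp_congr_ae hc).1 (Lp.memLp _)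
    rw [memLp_const_iff (by norm_num) (by norm_num)] at h4
    have hc0 : c = 0 := by
      rcases h4 with h4 | h4
      · exact h4
      · exact absurd htop h4.ne
    rw [Lp.eq_zero_iff_ae_eq_zero]
    filter_upwards [hc] with x hx
    rw [hx]; simp [hc0]
  rw [hp0] at h1
  have h2 : Tendsto (fun n => ⟪indicatorConstLp 2 hA hAtop (1 : ℝ),
      birkhoffAverage ℝ K id n (indicatorConstLp 2 hA hAtop (1 : ℝ))⟫) atTop (𝓝 0) := by
    have := (tendsto_const_nhds (x := indicatorConstLp 2 hA hAtop (1 : ℝ))).inner (𝕜 := ℝ) h1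
    simpa using this
  refine h2.congr fun n => ?_
  have hit : ∀ k, K^[k] (indicatorConstLp 2 hA hAtop (1 : ℝ)) =
      indicatorConstLp 2 ((hmp.iterate k).measurable hA)
        (by rwa [(hmp.iterate k).measure_preimage hA.nullMeasurableSet]) 1 := by
    intro k
    induction k with
    | zero => rfl
    | succ k ih =>
      rw [Function.iterate_succ_apply', ih]
      change Lp.compMeasurePreserving T hmp _ = _
      rw [Lp.indicatorConstLp_compMeasurePreserving]
      rfl
  simp only [birkhoffAverage, birkhoffSum, id, hit, inner_smul_right, inner_sum,
    L2.real_inner_indicatorConstLp_one_indicatorConstLp_one]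

/-- In infinite measure an antitone renewal sequence tends to `0`, since its limit is also its limit
in the mean. -/
theorem tendsto_renewalSeq_zero {X : Type*} [MeasurableSpace X] {T : X → X}
    {m : Measure X} (he : Ergodic T m) (htop : m univ = ∞) {A : Set X} (hA : MeasurableSet A)
    (hAtop : m A < ∞) (h0 : m A ≠ 0) (hanti : Antitone (renewalSeq T m A)) :
    Tendsto (renewalSeq T m A) atTop (𝓝 0) := by
  have hAr : 0 < m.real A := ENNReal.toReal_pos h0 hAtop.ne
  have hnn : ∀ n, 0 ≤ renewalSeq T m A n := fun n => div_nonneg measureReal_nonneg hAr.le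
  have hlim := tendsto_atTop_ciInf hanti ⟨0, by rintro _ ⟨n, rfl⟩; exact hnn n⟩
  set c := ⨅ n, renewalSeq T m A n
  have hc : ∀ n, c ≤ renewalSeq T m A n := fun n =>
    ciInf_le ⟨0, by rintro _ ⟨n, rfl⟩; exact hnn n⟩ n
  have hc0 : 0 ≤ c := le_ciInf hnn
  have h1 : c * m.real A ≤ 0 := by
    refine ge_of_tendsto (tendsto_average_measureReal_inter_preimage he htop hA hAtop.ne) ?_
    filter_upwards [eventually_gt_atTop 0] with n hn
    rw [inv_mul_eq_div, le_div_iff₀ (by exact_mod_cast hn)]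
    calc c * m.real A * n = ∑ k ∈ Finset.range n, c * m.real A := by simp; ring
      _ ≤ _ := Finset.sum_le_sum fun k _ => (le_div_iff₀ hAr).1 (hc k)
  have h2 : c = 0 := le_antisymm (nonpos_of_mul_nonpos_left h1 hAr) hc0
  rwa [h2] at hlim

theorem renewalSeq_le_one {X : Type*} [MeasurableSpace X] {T : X → X}
    {m : Measure X} {A : Set X} (hAtop : m A < ∞) (n : ℕ) : renewalSeq T m A n ≤ 1 :=
  div_le_one_of_le₀ (measureReal_mono inter_subset_left hAtop.ne) measureReal_nonneg

/-- Summation by parts: comparing partial sums persists under antitone weights. -/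
theorem sum_antitone_mul_le {u x y : ℕ → ℝ} (hu : Antitone u) (hu0 : ∀ n, 0 ≤ u n)
    (h : ∀ n, ∑ k ∈ Finset.range n, x k ≤ ∑ k ∈ Finset.range n, y k) (n : ℕ) :
    ∑ k ∈ Finset.range n, u k * x k ≤ ∑ k ∈ Finset.range n, u k * y k := by
  suffices H : u n * (∑ k ∈ Finset.range n, y k - ∑ k ∈ Finset.range n, x k) ≤
      ∑ k ∈ Finset.range n, u k * y k - ∑ k ∈ Finset.range n, u k * x k by
    have := mul_nonneg (hu0 n) (sub_nonneg.2 (h n))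
    linarith
  induction n with
  | zero => simp
  | succ n ih =>
    simp only [Finset.sum_range_succ]
    have h1 := mul_le_mul_of_nonneg_right (hu (Nat.le_succ n)) (sub_nonneg.2 (h (n + 1)))
    simp only [Finset.sum_range_succ] at h1
    rw [Nat.succ_eq_add_one] at h1
    linarith

end Kaluza

/-! ### Successive returns to a set -/

section Returns

open scoped Classical in
/-- The points of `D` whose `N`-th return to `D` takes place at time `j` (the visit at time `0`
being numbered `0`). -/
def nthReturnSet {X : Type*} (V : X → X) (D : Set X) (N j : ℕ) : Set X :=
  {x | x ∈ D ∧ V^[j] x ∈ D ∧ Nat.count (fun i => V^[i] x ∈ D) j = N}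

theorem le_of_mem_nthReturnSet {X : Type*} {V : X → X} {D : Set X} {N j : ℕ} {x : X}
    (hx : x ∈ nthReturnSet V D N j) : N ≤ j := by
  classical
  exact hx.2.2 ▸ Nat.count_le _

theorem exists_mem_nthReturnSet {X : Type*} {V : X → X} {D : Set X} {x : X} (hx : x ∈ D)
    (h : ∃ᶠ n in atTop, V^[n] x ∈ D) (N : ℕ) : ∃ j, x ∈ nthReturnSet V D N j := by
  classical
  rw [Nat.frequently_atTop_iff_infinite] at h
  exact ⟨Nat.nth (fun i => V^[i] x ∈ D) N, hx, Nat.nth_mem_of_infinite h N,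
    by convert Nat.count_nth_of_infinite h N⟩

theorem measurableSet_nthReturnSet {X : Type*} [MeasurableSpace X] {V : X → X}
    (hV : Measurable V) {D : Set X} (hD : MeasurableSet D) (N j : ℕ) :
    MeasurableSet (nthReturnSet V D N j) := by
  classical
  have h1 : Measurable fun x => Nat.count (fun i => V^[i] x ∈ D) j := by
    have : (fun x => Nat.count (fun i => V^[i] x ∈ D) j) = fun x =>
        ∑ i ∈ Finset.range j, (V^[i] ⁻¹' D).indicator (fun _ => 1) x := by
      ext x
      rw [Nat.count_eq_card_filter_range, Finset.card_filter]
      exact Finset.sum_congr rfl fun i _ => by simp [indicator_apply]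
    rw [this]
    exact Finset.measurable_sum _ fun i _ => measurable_const.indicator (hV.iterate i hD)
  have h2 : nthReturnSet V D N j =
      D ∩ (V^[j] ⁻¹' D ∩ (fun x => Nat.count (fun i => V^[i] x ∈ D) j) ⁻¹' {N}) := by
    ext x
    simp only [nthReturnSet, mem_ofPred_eq, mem_inter_iff, mem_preimage, mem_singleton_iff]
  rw [h2]
  exact hD.inter ((hV.iterate j hD).inter (h1 (measurableSet_singleton N)))

theorem preimage_nthReturnSet {X X' : Type*} {V : X → X} {V' : X' → X'} {f : X → X'}
    (hf : Function.Semiconj f V V') (D : Set X') (N j : ℕ) :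
    f ⁻¹' nthReturnSet V' D N j = nthReturnSet V (f ⁻¹' D) N j := by
  ext x
  have h : (fun i => V^[i] x ∈ f ⁻¹' D) = fun i => V'^[i] (f x) ∈ D := by
    ext i
    rw [mem_preimage, (hf.iterate_right i).eq]
  simp only [nthReturnSet, mem_preimage, mem_ofPred_eq, (hf.iterate_right _).eq]
  congr!
  exact (congrFun h _).symm.to_iff

theorem not_mem_nthReturnSet_of_lt {X : Type*} {V : X → X} {D : Set X} {N j j' : ℕ} (h : j < j')
    {x : X} (hx' : x ∈ nthReturnSet V D N j')
    (hx : V^[j' - j] x ∈ nthReturnSet V D N j) : False := by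
  classical
  have h1 : Nat.count (fun i => V^[i] x ∈ D) j' = N := by convert hx'.2.2
  have h2 : Nat.count (fun i => V^[i] (V^[j' - j] x) ∈ D) j = N := by convert hx.2.2
  have h3 : j' = (j' - j) + j := by omega
  rw [h3, Nat.count_add] at h1
  have h4 : Nat.count (fun k => V^[j' - j + k] x ∈ D) j = N := by
    rw [← h2]
    congr 1
    ext k
    rw [add_comm, Function.iterate_add_apply]
  rw [h4] at h1
  have h5 : 0 < Nat.count (fun i => V^[i] x ∈ D) (j' - j) :=
    (Nat.zero_le _).trans_lt (Nat.count_strict_mono (m := 0) hx'.1 (by omega))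
  omega

/-- The `N`-th return map does not increase the measure. The map need not be injective: pulling all
pieces back to a common time makes them disjoint. -/
theorem tsum_measure_nthReturnSet_inter_le {X : Type*} [MeasurableSpace X] {m : Measure X}
    {V : X → X} (hV : MeasurePreserving V m m) {D : Set X} (hD : MeasurableSet D) (N : ℕ)
    {B : Set X} (hB : MeasurableSet B) :
    ∑' j, m (nthReturnSet V D N j ∩ V^[j] ⁻¹' B) ≤ m B := by
  refine ENNReal.tsum_le_of_sum_range_le fun J => ?_
  have hm : ∀ j, MeasurableSet (nthReturnSet V D N j ∩ V^[j] ⁻¹' B) := fun j =>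
    (measurableSet_nthReturnSet hV.measurable hD N j).inter (hV.measurable.iterate j hB)
  have h1 : ∀ j ∈ Finset.range J, m (nthReturnSet V D N j ∩ V^[j] ⁻¹' B) =
      m (V^[J - j] ⁻¹' (nthReturnSet V D N j ∩ V^[j] ⁻¹' B)) := fun j _ =>
    ((hV.iterate (J - j)).measure_preimage (hm j).nullMeasurableSet).symm
  rw [Finset.sum_congr rfl h1, ← measure_biUnion_finset _ fun j _ =>
    hV.measurable.iterate (J - j) (hm j), ← (hV.iterate J).measure_preimage hB.nullMeasurableSet]
  · refine measure_mono (iUnion₂_subset fun j hj x hx => ?_)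
    have h2 := hx.2
    rw [mem_preimage, ← Function.iterate_add_apply] at h2
    rwa [Nat.add_sub_cancel' (Finset.mem_range.1 hj).le] at h2
  · have key : ∀ j j', j < j' → j' < J →
        Disjoint (V^[J - j] ⁻¹' (nthReturnSet V D N j ∩ V^[j] ⁻¹' B))
          (V^[J - j'] ⁻¹' (nthReturnSet V D N j' ∩ V^[j'] ⁻¹' B)) := by
      intro j j' h hJ
      rw [disjoint_left]
      intro x hx hx'
      refine not_mem_nthReturnSet_of_lt h hx'.1 ?_
      rw [← Function.iterate_add_apply, show j' - j + (J - j') = J - j by omega]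
      exact hx.1
    intro j hj j' hj' hne
    have hj1 := Finset.mem_range.1 (Finset.mem_coe.1 hj)
    have hj2 := Finset.mem_range.1 (Finset.mem_coe.1 hj')
    rcases lt_or_gt_of_ne hne with h | h
    · exact key j j' h hj2
    · exact (key j' j h hj1).symm

end Returns

/-! ### Invariant sets of products with a shift depend on the future -/

section OneSided

variable {ι M : Type*}

/-- The coordinates of a two-sided sequence from time `k` on. -/
def futureFrom (k : ℤ) (y : ℤ → ι) : ℕ → ι := fun j => y (k + j)

/-- The one-sided shift. -/
def uniShift (ι : Type*) (a : ℕ → ι) : ℕ → ι := fun j => a (j + 1)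

theorem biShift_iterate_apply (n : ℕ) (y : ℤ → ι) (i : ℤ) : (biShift ι)^[n] y i = y (i + n) := by
  induction n generalizing y with
  | zero => simp
  | succ n ih =>
    rw [Function.iterate_succ_apply, ih]
    simp only [biShift]
    congr 1
    push_cast
    ring

theorem uniShift_iterate_apply (n : ℕ) (a : ℕ → ι) (i : ℕ) : (uniShift ι)^[n] a i = a (i + n) := by
  induction n generalizing a with
  | zero => simp
  | succ n ih =>
    rw [Function.iterate_succ_apply, ih]
    rfl

theorem futureFrom_iterate (k : ℤ) (n : ℕ) (y : ℤ → ι) :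
    futureFrom k ((biShift ι)^[n] y) = futureFrom (k + n) y := by
  ext j
  simp only [futureFrom, biShift_iterate_apply]
  congr 1
  ring

theorem uniShift_iterate_futureFrom (k : ℤ) (n : ℕ) (y : ℤ → ι) :
    (uniShift ι)^[n] (futureFrom k y) = futureFrom (k + n) y := by
  ext j
  simp only [futureFrom, uniShift_iterate_apply]
  congr 1
  push_cast
  ring

theorem semiconj_futureFrom (W : M → M) :
    Function.Semiconj (Prod.map (futureFrom (ι := ι) 0) id) (Prod.map (biShift ι) W)
      (Prod.map (uniShift ι) W) := by
  rintro ⟨y, w⟩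
  ext j
  · simp only [Prod.map_apply, futureFrom, biShift, uniShift]
    congr 1
  · rfl

variable [MeasurableSpace ι] [MeasurableSpace M]

theorem measurable_futureFrom (k : ℤ) : Measurable (futureFrom (ι := ι) k) :=
  measurable_pi_lambda _ fun _ => measurable_pi_apply _

theorem measurable_uniShift : Measurable (uniShift ι) :=
  measurable_pi_lambda _ fun _ => measurable_pi_apply _

/-- Measurable sets are approximated by sets depending on the coordinates after some time `-N`. -/
theorem exists_measure_symmDiff_futureFrom_lt (μ : Measure ((ℤ → ι) × M)) [IsFiniteMeasure μ]
    {E : Set ((ℤ → ι) × M)} (hE : MeasurableSet E) {ε : ℝ≥0∞} (hε : 0 < ε) :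
    ∃ (N : ℕ) (U : Set ((ℕ → ι) × M)), MeasurableSet U ∧
      μ (symmDiff (Prod.map (futureFrom (-N : ℤ)) id ⁻¹' U) E) < ε := by
  set C : Set (Set ((ℤ → ι) × M)) := {s | ∃ (N : ℕ) (U : Set ((ℕ → ι) × M)), MeasurableSet U ∧
      s = Prod.map (futureFrom (-N : ℤ)) id ⁻¹' U} with hCdef
  have hshift : ∀ (N N' : ℕ), N ≤ N' → ∀ U : Set ((ℕ → ι) × M), MeasurableSet U →
      ∃ U' : Set ((ℕ → ι) × M), MeasurableSet U' ∧ Prod.map (futureFrom (-N : ℤ)) id ⁻¹' U =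
        (Prod.map (futureFrom (-N' : ℤ)) id ⁻¹' U' : Set ((ℤ → ι) × M)) := by
    intro N N' h U hU
    refine ⟨Prod.map (uniShift ι)^[N' - N] id ⁻¹' U,
      (measurable_uniShift.iterate _).prodMap measurable_id hU, ?_⟩
    rw [← preimage_comp, Prod.map_comp_map]
    have : (uniShift ι)^[N' - N] ∘ futureFrom (-N' : ℤ) = futureFrom (-N : ℤ) := by
      ext y : 1
      rw [Function.comp_apply, uniShift_iterate_futureFrom]
      congr 1
      omega
    rw [this]
    rfl
  have hC2 : ∀ s ∈ C, ∀ t ∈ C, ∃ (N : ℕ) (U U' : Set ((ℕ → ι) × M)), MeasurableSet U ∧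
      MeasurableSet U' ∧ s = Prod.map (futureFrom (-N : ℤ)) id ⁻¹' U ∧
      t = Prod.map (futureFrom (-N : ℤ)) id ⁻¹' U' := by
    rintro s ⟨N, U, hU, rfl⟩ t ⟨N', U', hU', rfl⟩
    obtain ⟨U1, hU1, h1⟩ := hshift N (max N N') (le_max_left _ _) U hU
    obtain ⟨U2, hU2, h2⟩ := hshift N' (max N N') (le_max_right _ _) U' hU'
    exact ⟨max N N', U1, U2, hU1, hU2, h1, h2⟩
  have hring : IsSetRing C := by
    refine ⟨⟨0, ∅, MeasurableSet.empty, by simp⟩, fun s t hs ht => ?_, fun s t hs ht => ?_⟩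
    · obtain ⟨N, U, U', hU, hU', rfl, rfl⟩ := hC2 s hs t ht
      exact ⟨N, U ∪ U', hU.union hU', rfl⟩
    · obtain ⟨N, U, U', hU, hU', rfl, rfl⟩ := hC2 s hs t ht
      exact ⟨N, U \ U', hU.diff hU', rfl⟩
  have hgen : (inferInstance : MeasurableSpace ((ℤ → ι) × M)) = MeasurableSpace.generateFrom C := by
    apply le_antisymm
    · refine sup_le ?_ ?_
      · rw [MeasurableSpace.pi, MeasurableSpace.comap_iSup]
        refine iSup_le fun i => ?_
        rw [MeasurableSpace.comap_comp]
        rintro _ ⟨s, hs, rfl⟩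
        refine MeasurableSpace.measurableSet_generateFrom
          ⟨i.natAbs, (fun z => z.1 (i + i.natAbs).toNat) ⁻¹' s, ?_, ?_⟩
        · exact ((measurable_pi_apply _).comp measurable_fst) hs
        · ext z
          simp only [mem_preimage, Prod.map_fst, futureFrom, Function.comp_apply]
          rw [show -(i.natAbs : ℤ) + ((i + i.natAbs).toNat : ℤ) = i by omega]
      · rintro _ ⟨s, hs, rfl⟩
        exact MeasurableSpace.measurableSet_generateFrom
          ⟨0, Prod.snd ⁻¹' s, measurable_snd hs, rfl⟩
    · refine MeasurableSpace.generateFrom_le ?_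
      rintro _ ⟨N, U, hU, rfl⟩
      exact (measurable_futureFrom _).prodMap measurable_id hU
  obtain ⟨t, ⟨N, U, hU, rfl⟩, h⟩ := exists_measure_symmDiff_lt_of_generateFrom_isSetRing (μ := μ)
    hring ⟨{univ}, countable_singleton _, by
      rintro _ rfl; exact ⟨0, univ, MeasurableSet.univ, rfl⟩, by simp⟩ hgen hE hε
  exact ⟨N, U, hU, h⟩

/-- On a set of finite measure which is defined by the future and to which almost every point returns
infinitely often, an invariant set is determined by the future: approximate it by a set depending
on the coordinates after time `-N`, and look at the latter at the `N`-th return. -/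
theorem exists_oneSided_ae_mem_iff {μ : Measure ((ℤ → ι) × M)} {W : M → M} (hW : Measurable W)
    (hV : MeasurePreserving (Prod.map (biShift ι) W) μ μ) {D : Set ((ℕ → ι) × M)}
    (hD : MeasurableSet D) (hDtop : μ (Prod.map (futureFrom 0) id ⁻¹' D) ≠ ∞)
    (hrec : ∀ᵐ z ∂μ, z ∈ Prod.map (futureFrom 0) id ⁻¹' D →
      ∃ᶠ n in atTop, (Prod.map (biShift ι) W)^[n] z ∈ Prod.map (futureFrom 0) id ⁻¹' D)
    {E : Set ((ℤ → ι) × M)} (hE : MeasurableSet E) (hinv : Prod.map (biShift ι) W ⁻¹' E = E) :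
    ∃ U : Set ((ℕ → ι) × M), MeasurableSet U ∧ ∀ᵐ z ∂μ, z ∈ Prod.map (futureFrom 0) id ⁻¹' D →
      (z ∈ E ↔ Prod.map (futureFrom 0) id z ∈ U) := by
  set V := Prod.map (biShift ι) W with hVdef
  set V' := Prod.map (uniShift ι) W with hVdef'
  set f : (ℤ → ι) × M → (ℕ → ι) × M := Prod.map (futureFrom 0) id with hf
  have hfm : Measurable f := (measurable_futureFrom 0).prodMap measurable_id
  have hVm' : Measurable V' := measurable_uniShift.prodMap hW
  have hsemi : Function.Semiconj f V V' := semiconj_futureFrom W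
  have hDm := hfm hD
  have hinvn : ∀ n, V^[n] ⁻¹' E = E := fun n => by
    induction n with
    | zero => rfl
    | succ n ih => rw [Function.iterate_succ, preimage_comp, ih, hinv]
  have : IsFiniteMeasure (μ.restrict (f ⁻¹' D)) :=
    ⟨by rw [Measure.restrict_apply_univ]; exact hDtop.lt_top⟩
  have key : ∀ ε : ℝ≥0∞, 0 < ε → ∃ U : Set ((ℕ → ι) × M), MeasurableSet U ∧
      μ (f ⁻¹' D ∩ symmDiff E (f ⁻¹' U)) ≤ ε := by
    intro ε hε
    obtain ⟨N, U, hU, hlt⟩ := exists_measure_symmDiff_futureFrom_lt (μ.restrict (f ⁻¹' D)) hE hε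
    set EN : Set ((ℤ → ι) × M) := Prod.map (futureFrom (-N : ℤ)) id ⁻¹' U with hEN
    have hENm : MeasurableSet EN := (measurable_futureFrom _).prodMap measurable_id hU
    rw [Measure.restrict_apply (hENm.symmDiff hE)] at hlt
    refine ⟨⋃ j, nthReturnSet V' D N j ∩ Prod.map (uniShift ι)^[j - N] W^[j] ⁻¹' U,
      MeasurableSet.iUnion fun j => (measurableSet_nthReturnSet hVm' hD N j).inter
        ((measurable_uniShift.iterate _).prodMap (hW.iterate _) hU), ?_⟩
    have hpre : ∀ j, f ⁻¹' (nthReturnSet V' D N j ∩ Prod.map (uniShift ι)^[j - N] W^[j] ⁻¹' U) =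
        nthReturnSet V (f ⁻¹' D) N j ∩ V^[j] ⁻¹' EN := by
      intro j
      rw [preimage_inter, preimage_nthReturnSet hsemi]
      ext z
      simp only [mem_inter_iff]
      refine and_congr_right fun hz => ?_
      have hjN := le_of_mem_nthReturnSet hz
      have : Prod.map (uniShift ι)^[j - N] W^[j] (f z) =
          Prod.map (futureFrom (-N : ℤ)) id (V^[j] z) := by
        rw [hVdef, Prod.map_iterate]
        ext l
        · simp only [hf, Prod.map_fst, uniShift_iterate_futureFrom, futureFrom_iterate]
          congr 1
          omega
        · rfl
      rw [mem_preimage, mem_preimage, this]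
      rfl
    have hae : ∀ᵐ z ∂μ, z ∈ f ⁻¹' D ∩ symmDiff E (f ⁻¹' ⋃ j, nthReturnSet V' D N j ∩
        Prod.map (uniShift ι)^[j - N] W^[j] ⁻¹' U) →
        z ∈ ⋃ j, nthReturnSet V (f ⁻¹' D) N j ∩ V^[j] ⁻¹' (f ⁻¹' D ∩ symmDiff EN E) := by
      filter_upwards [hrec] with z hz ⟨hzD, hzE⟩
      obtain ⟨j, hj⟩ := exists_mem_nthReturnSet hzD (hz hzD) N
      refine mem_iUnion.2 ⟨j, hj, hj.2.1, ?_⟩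
      have hEj : V^[j] z ∈ E ↔ z ∈ E := by rw [← mem_preimage, hinvn]
      rw [preimage_iUnion] at hzE
      simp only [hpre] at hzE
      rw [symmDiff_comm, mem_symmDiff, hEj]
      rw [mem_symmDiff] at hzE
      have huniq : ∀ j', z ∈ nthReturnSet V (f ⁻¹' D) N j' → V^[j'] z ∈ EN →
          V^[j] z ∈ EN := by
        intro j' hj' h
        have h1 := hj.2.2
        have h2 := hj'.2.2
        classical
        have h3 : j = j' := Nat.count_injective hj.2.1 hj'.2.1 (by rw [h1, h2])
        rwa [h3]
      rcases hzE with ⟨h1, h2⟩ | ⟨h1, h2⟩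
      · exact Or.inl ⟨h1, fun h3 => h2 (mem_iUnion.2 ⟨j, hj, h3⟩)⟩
      · obtain ⟨j', hj', h3⟩ := mem_iUnion.1 h1
        exact Or.inr ⟨huniq j' hj' h3, h2⟩
    calc _ ≤ μ (⋃ j, nthReturnSet V (f ⁻¹' D) N j ∩ V^[j] ⁻¹' (f ⁻¹' D ∩ symmDiff EN E)) :=
          measure_mono_ae hae
      _ ≤ _ := measure_iUnion_le _
      _ ≤ μ (f ⁻¹' D ∩ symmDiff EN E) :=
          tsum_measure_nthReturnSet_inter_le hV hDm N (hDm.inter (hENm.symmDiff hE))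
      _ ≤ ε := by rw [inter_comm]; exact hlt.le
  choose! U hUm hU using fun n : ℕ => key ((1 / 2) ^ n) (by
    apply ENNReal.pow_pos; norm_num)
  refine ⟨limsup U atTop, MeasurableSet.measurableSet_limsup hUm, ?_⟩
  have hsum : ∑' n, μ (f ⁻¹' D ∩ symmDiff E (f ⁻¹' U n)) ≠ ∞ := by
    refine ne_top_of_le_ne_top ?_ (ENNReal.tsum_le_tsum hU)
    rw [ENNReal.tsum_geometric]
    norm_num
  have h0 := measure_setOfPred_frequently_eq_zero hsum
  rw [measure_eq_zero_iff_ae_notMem] at h0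
  filter_upwards [h0] with z hz hzD
  rw [mem_limsup_iff_frequently_mem]
  have hz' : ∀ᶠ n in atTop, ¬ z ∈ f ⁻¹' D ∩ symmDiff E (f ⁻¹' U n) := not_frequently.1 hz
  constructor
  · intro hzE
    refine Eventually.frequently (hz'.mono fun n hn => ?_)
    by_contra h
    exact hn ⟨hzD, Or.inl ⟨hzE, h⟩⟩
  · intro h
    obtain ⟨n, h1, h2⟩ := (h.and_eventually hz').exists
    by_contra h3
    exact h2 ⟨hzD, Or.inr ⟨h1, h3⟩⟩

end OneSided

/-! ### Harmonic functions of random walks on `ℕ` -/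

section ChoquetDeny

/-- A bounded function on `ℕ` which is harmonic for a random walk with nonnegative steps does not
increase along a step `a` of positive probability: where the increment `k (i + a) - k i` is close
to its supremum it stays so along many steps `a`, and if the supremum were positive the increments
would add up to an unbounded quantity. -/
theorem le_of_harmonic {α : Type*} {φ : α → ℝ} {n : α → ℕ} {k : ℕ → ℝ} {M : ℝ}
    (hM : ∀ i, |k i| ≤ M) (hφ0 : ∀ x, 0 ≤ φ x) (hφ : HasSum φ 1)
    (hk : ∀ i, HasSum (fun x => φ x * k (i + n x)) (k i)) {x0 : α} (hx0 : 0 < φ x0) (i : ℕ) :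
    k (i + n x0) ≤ k i := by
  set a := n x0
  set d : ℕ → ℝ := fun i => k (i + a) - k i with hd
  have hdM : ∀ i, d i ≤ 2 * M := fun i => by
    have h1 := (abs_le.1 (hM (i + a))).2
    have h2 := (abs_le.1 (hM i)).1
    simp only [hd]
    linarith
  have hbdd : BddAbove (range d) := ⟨2 * M, by rintro _ ⟨i, rfl⟩; exact hdM i⟩
  set D := ⨆ i, d i
  have hD : ∀ i, d i ≤ D := fun i => le_ciSup hbdd i
  have hstep : ∀ i, φ x0 * (D - d (i + a)) ≤ D - d i := by
    intro i
    have h1 : HasSum (fun x => φ x * (D - d (i + n x))) (D - d i) := by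
      have h2 := ((hφ.mul_right D).sub ((hk (i + a)).sub (hk i)))
      rw [one_mul] at h2
      refine h2.congr_fun fun x => ?_
      simp only [hd]
      rw [show i + a + n x = i + n x + a by ring]
      ring
    exact le_hasSum h1 x0 fun x _ => mul_nonneg (hφ0 x) (sub_nonneg.2 (hD _))
  by_contra! hlt
  have hDpos : 0 < D := lt_of_lt_of_le (by simp only [hd]; linarith) (hD i)
  obtain ⟨R, hR⟩ := exists_nat_gt (4 * M / D)
  rw [div_lt_iff₀ hDpos] at hR
  have hφ1 : φ x0 ≤ 1 := le_hasSum hφ x0 fun x _ => hφ0 x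
  obtain ⟨i, hi⟩ := exists_lt_of_lt_ciSup (show D - D / 2 * φ x0 ^ R < D by
    have : 0 < D / 2 * φ x0 ^ R := by positivity
    linarith)
  have hchain : ∀ r, φ x0 ^ r * (D - d (i + r * a)) ≤ D - d i := by
    intro r
    induction r with
    | zero => simp
    | succ r ih =>
      refine le_trans ?_ ih
      have h3 := mul_le_mul_of_nonneg_left (hstep (i + r * a)) (pow_nonneg hx0.le r)
      rw [show i + (r + 1) * a = i + r * a + a by ring, pow_succ]
      linarith
  have hlow : ∀ r ∈ Finset.range R, D / 2 ≤ d (i + r * a) := by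
    intro r hr
    have h4 := hchain r
    have h5 : φ x0 ^ R ≤ φ x0 ^ r :=
      pow_le_pow_of_le_one hx0.le hφ1 (Finset.mem_range.1 hr).le
    have h6 : φ x0 ^ r * (D - d (i + r * a)) ≤ φ x0 ^ r * (D / 2) := by
      have h7 : D / 2 * φ x0 ^ R ≤ D / 2 * φ x0 ^ r :=
        mul_le_mul_of_nonneg_left h5 (by positivity)
      linarith
    have := le_of_mul_le_mul_left h6 (by positivity)
    linarith
  have htel : ∑ r ∈ Finset.range R, d (i + r * a) = k (i + R * a) - k i := by
    have := Finset.sum_range_sub (fun r => k (i + r * a)) R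
    simp only [zero_mul, add_zero] at this
    rw [← this]
    refine Finset.sum_congr rfl fun r _ => ?_
    simp only [hd]
    rw [show i + (r + 1) * a = i + r * a + a by ring]
  have h8 := Finset.sum_le_sum hlow
  rw [htel, Finset.sum_const, Finset.card_range, nsmul_eq_mul] at h8
  have h9 := (abs_le.1 (hM (i + R * a))).2
  have h10 := (abs_le.1 (hM i)).1
  linarith

/-- The Choquet–Deny property of random walks on `ℕ`. -/
theorem eq_of_harmonic {α : Type*} {φ : α → ℝ} {n : α → ℕ} {k : ℕ → ℝ} {M : ℝ}
    (hM : ∀ i, |k i| ≤ M) (hφ0 : ∀ x, 0 ≤ φ x) (hφ : HasSum φ 1)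
    (hk : ∀ i, HasSum (fun x => φ x * k (i + n x)) (k i)) {x0 : α} (hx0 : 0 < φ x0) (i : ℕ) :
    k (i + n x0) = k i := by
  refine le_antisymm (le_of_harmonic hM hφ0 hφ hk hx0 i) ?_
  have h1 := le_of_harmonic (k := fun i => - k i) (M := M) (by simpa using hM) hφ0 hφ
    (fun i => by simpa using (hk i).neg) hx0 i
  simpa using h1

/-- The least period of `k` divides all its periods: otherwise the remainder would be a smaller one. -/
theorem apply_one_eq_apply_zero_of_periods {β : Type*} {k : ℕ → β} {Q : ℕ → Prop}
    (hQ : ∀ a, Q a → ∀ i, k (i + a) = k i) (hgcd : ∀ d : ℕ, (∀ a, Q a → d ∣ a) → d = 1) :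
    k 1 = k 0 := by
  classical
  by_cases h : ∃ d, 0 < d ∧ ∀ i, k (i + d) = k i
  · set d := Nat.find h
    obtain ⟨hd0, hd⟩ := Nat.find_spec h
    have hmul : ∀ r i, k (i + r * d) = k i := by
      intro r
      induction r with
      | zero => simp
      | succ r ih =>
        intro i
        rw [show i + (r + 1) * d = i + r * d + d by ring]
        exact (hd _).trans (ih i)
    have hd1 : d = 1 := by
      refine hgcd d fun a ha => ?_
      rw [Nat.dvd_iff_mod_eq_zero]
      by_contra hne
      refine Nat.find_min h (Nat.mod_lt a hd0) ⟨Nat.pos_of_ne_zero hne, fun i => ?_⟩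
      have h1 := hmul (a / d) (i + a % d)
      rw [add_assoc, mul_comm, Nat.mod_add_div] at h1
      rw [← h1]
      exact hQ a ha i
    have := hd 0
    rw [show Nat.find h = 1 from hd1] at this
    simpa using this
  · exfalso
    have := hgcd 0 fun a ha => by
      rw [zero_dvd_iff]
      by_contra hne
      exact h ⟨a, Nat.pos_of_ne_zero hne, hQ a ha⟩
    omega

end ChoquetDeny

/-! ### One-sided Markov measures -/

section OneSidedMarkov

variable {ι : Type*}

/-- The sequences which agree with `s` up to time `n`. -/
def uniCyl (n : ℕ) (s : ℕ → ι) : Set (ℕ → ι) := {a | ∀ i ≤ n, a i = s i}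

/-- The sequence which starts with the word `u` and repeats its last letter. -/
def wordExt {n : ℕ} (u : Fin (n + 1) → ι) : ℕ → ι := fun i => u ⟨min i n, by omega⟩

theorem wordExt_of_le {n : ℕ} (u : Fin (n + 1) → ι) {i : ℕ} (hi : i ≤ n) :
    wordExt u i = u ⟨i, by omega⟩ := by
  simp only [wordExt, min_eq_left hi]

theorem mem_uniCyl_wordExt (n : ℕ) (a : ℕ → ι) :
    a ∈ uniCyl n (wordExt fun i : Fin (n + 1) => a i) := fun i hi => by
  rw [wordExt_of_le _ hi]

theorem uniCyl_append_mem_iff (n m : ℕ) (s s' : ℕ → ι) (h : s' 0 = s n) (a : ℕ → ι) :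
    (a ∈ uniCyl n s ∧ (uniShift ι)^[n] a ∈ uniCyl m s') ↔
      a ∈ uniCyl (n + m) fun i => if i ≤ n then s i else s' (i - n) := by
  simp only [uniCyl, mem_ofPred_eq, uniShift_iterate_apply]
  constructor
  · rintro ⟨h1, h2⟩ i hi
    by_cases hin : i ≤ n
    · rw [if_pos hin, h1 i hin]
    · rw [if_neg hin, ← h2 (i - n) (by omega), Nat.sub_add_cancel (by omega)]
  · intro h1
    refine ⟨fun i hi => by rw [h1 i (by omega), if_pos hi], fun i hi => ?_⟩
    rw [h1 (i + n) (by omega)]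
    split_ifs with h2
    · have : i = 0 := by omega
      subst this
      rw [zero_add, h]
    · rw [Nat.add_sub_cancel]

variable [MeasurableSpace ι] [DiscreteMeasurableSpace ι]

theorem measurableSet_uniCyl (n : ℕ) (s : ℕ → ι) : MeasurableSet (uniCyl n s) := by
  have : uniCyl n s = ⋂ i, ⋂ (_ : i ≤ n), (fun a : ℕ → ι => a i) ⁻¹' {s i} := by
    ext a; simp [uniCyl]
  rw [this]
  exact MeasurableSet.iInter fun i => MeasurableSet.iInter fun _ =>
    measurable_pi_apply i (MeasurableSet.of_discrete)

variable [Countable ι]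

/-- A measure on the one-sided sequences is determined by its values on cylinders, if these are
finite. -/
theorem ext_of_uniCyl {μ₁ μ₂ : Measure (ℕ → ι)} (hfin : ∀ s, μ₁ (uniCyl 0 s) ≠ ∞)
    (h : ∀ n s, μ₁ (uniCyl n s) = μ₂ (uniCyl n s)) : μ₁ = μ₂ := by
  refine Measure.ext_of_generateFrom_of_cover_subset (S := {t | ∃ n s, t = uniCyl n s})
    (T := range fun x : ι => uniCyl 0 fun _ => x) ?_ ?_ ?_ (countable_range _) ?_ ?_ ?_
  · apply le_antisymm
    · rw [MeasurableSpace.pi]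
      refine iSup_le fun i => ?_
      rintro _ ⟨s, -, rfl⟩
      have : (fun a : ℕ → ι => a i) ⁻¹' s =
          ⋃ u : {u : Fin (i + 1) → ι // u (Fin.last i) ∈ s}, uniCyl i (wordExt u.1) := by
        ext a
        simp only [mem_preimage, mem_iUnion]
        constructor
        · intro ha
          exact ⟨⟨fun j => a j, ha⟩, mem_uniCyl_wordExt i a⟩
        · rintro ⟨⟨u, hu⟩, ha⟩
          rw [ha i le_rfl, wordExt_of_le _ le_rfl]
          exact hu
      rw [this]
      exact MeasurableSet.iUnion fun u =>
        MeasurableSpace.measurableSet_generateFrom ⟨i, _, rfl⟩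
    · refine MeasurableSpace.generateFrom_le ?_
      rintro _ ⟨n, s, rfl⟩
      exact measurableSet_uniCyl n s
  · have key : ∀ n n' (s s' : ℕ → ι), n ≤ n' → (uniCyl n s ∩ uniCyl n' s').Nonempty →
        uniCyl n s ∩ uniCyl n' s' = uniCyl n' s' := by
      rintro n n' s s' hn ⟨a, ha, ha'⟩
      refine inter_eq_right.2 fun b hb i hi => ?_
      rw [hb i (hi.trans hn), ← ha' i (hi.trans hn), ha i hi]
    rintro _ ⟨n, s, rfl⟩ _ ⟨n', s', rfl⟩ hne
    rcases le_total n n' with hn | hn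
    · exact ⟨n', s', key n n' s s' hn hne⟩
    · rw [inter_comm] at hne ⊢
      exact ⟨n, s, key n' n s' s hn hne⟩
  · rintro _ ⟨x, rfl⟩
    exact ⟨0, _, rfl⟩
  · refine eq_univ_of_forall fun a => ⟨_, ⟨a 0, rfl⟩, fun i hi => ?_⟩
    rw [Nat.le_zero.1 hi]
  · rintro _ ⟨x, rfl⟩
    exact hfin _
  · rintro _ ⟨n, s, rfl⟩
    exact h n s

variable {p : ι → ι → ℝ≥0∞} {w : ι → ℝ≥0∞} {lam : Measure (ℕ → ι)}

/-- The Markov property: the past up to time `n` and the future from time `n` on are independent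
given the state at time `n`. -/
theorem markov_property (hw0 : ∀ s, w s ≠ 0) (hwtop : ∀ s, w s ≠ ∞)
    (hp : ∀ s t, p s t ≠ ∞)
    (hcyl : ∀ n s, lam (uniCyl n s) = w (s 0) * ∏ i ∈ Finset.range n, p (s i) (s (i + 1)))
    (n : ℕ) (s : ℕ → ι) {G : Set (ℕ → ι)} (hG : MeasurableSet G) :
    lam (uniCyl n s ∩ (uniShift ι)^[n] ⁻¹' G) =
      lam (uniCyl n s) / w (s n) * lam (uniCyl 0 (fun _ => s n) ∩ G) := by
  have hsm : Measurable (uniShift ι)^[n] := measurable_uniShift.iterate n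
  have hcyltop : ∀ n s, lam (uniCyl n s) ≠ ∞ := fun n s => by
    rw [hcyl]
    exact ENNReal.mul_ne_top (hwtop _) (ENNReal.prod_ne_top fun i _ => hp _ _)
  have H : (lam.restrict (uniCyl n s)).map (uniShift ι)^[n] =
      (lam (uniCyl n s) / w (s n)) • lam.restrict (uniCyl 0 fun _ => s n) := by
    refine ext_of_uniCyl (fun s' => ?_) fun m s' => ?_
    · rw [Measure.map_apply hsm (measurableSet_uniCyl _ _)]
      refine ne_top_of_le_ne_top (hcyltop n s) ?_
      exact (measure_mono (subset_univ _)).trans (by rw [Measure.restrict_apply_univ])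
    · rw [Measure.map_apply hsm (measurableSet_uniCyl _ _),
        Measure.restrict_apply (hsm (measurableSet_uniCyl _ _)), Measure.smul_apply,
        Measure.restrict_apply (measurableSet_uniCyl _ _), smul_eq_mul]
      by_cases h : s' 0 = s n
      · have h1 : (uniShift ι)^[n] ⁻¹' uniCyl m s' ∩ uniCyl n s =
            uniCyl (n + m) fun i => if i ≤ n then s i else s' (i - n) := by
          ext a
          rw [← uniCyl_append_mem_iff n m s s' h a, and_comm]
          rfl
        have h2 : uniCyl m s' ∩ uniCyl 0 (fun _ => s n) = uniCyl m s' := by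
          refine inter_eq_left.2 fun a ha i hi => ?_
          rw [Nat.le_zero.1 hi, ha 0 (Nat.zero_le _), h]
        rw [h1, h2, hcyl, hcyl, hcyl, Finset.prod_range_add, if_pos (Nat.zero_le _), h]
        have h3 : ∏ x ∈ Finset.range n, p (if x ≤ n then s x else s' (x - n))
            (if x + 1 ≤ n then s (x + 1) else s' (x + 1 - n)) =
            ∏ x ∈ Finset.range n, p (s x) (s (x + 1)) := by
          refine Finset.prod_congr rfl fun x hx => ?_
          have := Finset.mem_range.1 hx
          rw [if_pos (by omega), if_pos (by omega)]
        have h4 : ∏ x ∈ Finset.range m, p (if n + x ≤ n then s (n + x) else s' (n + x - n))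
            (if n + x + 1 ≤ n then s (n + x + 1) else s' (n + x + 1 - n)) =
            ∏ x ∈ Finset.range m, p (s' x) (s' (x + 1)) := by
          refine Finset.prod_congr rfl fun x _ => ?_
          rw [if_neg (show ¬ n + x + 1 ≤ n by omega), show n + x + 1 - n = x + 1 by omega]
          split_ifs with h5
          · have : x = 0 := by omega
            subst this
            rw [add_zero, h]
          · rw [Nat.add_sub_cancel_left]
        rw [h3, h4, ENNReal.div_eq_inv_mul]
        calc _ = ((w (s n))⁻¹ * w (s n)) * (w (s 0) * (∏ x ∈ Finset.range n, p (s x) (s (x + 1))) *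
              ∏ x ∈ Finset.range m, p (s' x) (s' (x + 1))) := by
              rw [ENNReal.inv_mul_cancel (hw0 _) (hwtop _), one_mul, mul_assoc]
          _ = _ := by ring
      · have h1 : (uniShift ι)^[n] ⁻¹' uniCyl m s' ∩ uniCyl n s = ∅ := by
          rw [eq_empty_iff_forall_notMem]
          rintro a ⟨ha, ha'⟩
          have h2 := ha 0 (Nat.zero_le _)
          rw [uniShift_iterate_apply, zero_add, ha' n le_rfl] at h2
          exact h h2.symm
        have h2 : uniCyl m s' ∩ uniCyl 0 (fun _ => s n) = ∅ := by
          rw [eq_empty_iff_forall_notMem]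
          rintro a ⟨ha, ha'⟩
          exact h ((ha 0 (Nat.zero_le _)).symm.trans (ha' 0 le_rfl))
        rw [h1, h2]
        simp
  have H' := congrArg (fun μ : Measure (ℕ → ι) => μ G) H
  rw [Measure.map_apply hsm hG, Measure.restrict_apply (hsm hG), Measure.smul_apply,
    Measure.restrict_apply hG, smul_eq_mul] at H'
  rw [inter_comm, H', inter_comm G]

end OneSidedMarkov

/-! ### Ergodicity of products with a one-sided Markov shift -/

section HarmonicSections

variable {ι : Type*}

/-- The finite paths from `s` which end with their first visit to `t` at or after time `N`. -/
@[ext]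
structure HittingWord (s t : ι) (N : ℕ) where
  /-- the number of steps -/
  length : ℕ
  /-- the states visited -/
  word : Fin (length + 1) → ι
  word_zero : word 0 = s
  word_last : word (Fin.last length) = t
  le_length : N ≤ length
  word_ne : ∀ i : Fin (length + 1), N ≤ i → (i : ℕ) < length → word i ≠ t

instance [Countable ι] (s t : ι) (N : ℕ) : Countable (HittingWord s t N) :=
  Function.Injective.countable (β := Σ n : ℕ, (Fin (n + 1) → ι))
    (f := fun u => ⟨u.length, u.word⟩) fun u v h => by
      rw [Sigma.mk.injEq] at h
      exact HittingWord.ext h.1 h.2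

/-- A finite path, continued as a sequence. -/
def HittingWord.seq {s t : ι} {N : ℕ} (u : HittingWord s t N) : ℕ → ι := wordExt u.word

theorem HittingWord.seq_zero {s t : ι} {N : ℕ} (u : HittingWord s t N) : u.seq 0 = s :=
  (wordExt_of_le _ (Nat.zero_le _)).trans u.word_zero

theorem HittingWord.seq_length {s t : ι} {N : ℕ} (u : HittingWord s t N) :
    u.seq u.length = t :=
  (wordExt_of_le _ le_rfl).trans u.word_last

theorem HittingWord.seq_ne {s t : ι} {N : ℕ} (u : HittingWord s t N) {i : ℕ} (hN : N ≤ i)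
    (hi : i < u.length) : u.seq i ≠ t := by
  rw [HittingWord.seq, wordExt_of_le _ (le_of_lt hi)]
  exact u.word_ne ⟨i, by omega⟩ hN hi

theorem HittingWord.disjoint {s t : ι} {N : ℕ} {u v : HittingWord s t N} (h : u ≠ v) :
    Disjoint (uniCyl u.length u.seq) (uniCyl v.length v.seq) := by
  rw [disjoint_left]
  intro a ha hb
  apply h
  have key : ∀ u v : HittingWord s t N, a ∈ uniCyl u.length u.seq → a ∈ uniCyl v.length v.seq →
      ¬ u.length < v.length := by
    intro u v ha hb hlt
    refine v.seq_ne u.le_length hlt ?_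
    rw [← hb u.length hlt.le, ha u.length le_rfl]
    exact u.seq_length
  have hlen : u.length = v.length :=
    le_antisymm (not_lt.1 (key v u hb ha)) (not_lt.1 (key u v ha hb))
  obtain ⟨n, u, _, _, _, _⟩ := u
  obtain ⟨n', v, _, _, _, _⟩ := v
  obtain rfl : n = n' := hlen
  congr 1
  ext i
  have h1 := ha i (Nat.lt_succ_iff.1 i.2)
  have h2 := hb i (Nat.lt_succ_iff.1 i.2)
  simp only [HittingWord.seq] at h1 h2
  rw [wordExt_of_le _ (Nat.lt_succ_iff.1 i.2)] at h1 h2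
  rw [h1] at h2
  exact h2

theorem exists_hittingWord {t : ι} {a : ℕ → ι} (h : ∃ᶠ n in atTop, a n = t) (N : ℕ) :
    ∃ u : HittingWord (a 0) t N, a ∈ uniCyl u.length u.seq := by
  classical
  have hex : ∃ n, N ≤ n ∧ a n = t := by
    obtain ⟨n, hn, hn'⟩ := frequently_atTop.1 h N
    exact ⟨n, hn, hn'⟩
  obtain ⟨h1, h2⟩ := Nat.find_spec hex
  refine ⟨⟨Nat.find hex, fun i => a i, rfl, h2, h1, fun i hNi hi hat => ?_⟩,
    mem_uniCyl_wordExt _ a⟩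
  exact Nat.find_min hex hi ⟨hNi, hat⟩

theorem exists_path_of_stepProb_pos {p : ι → ι → ℝ≥0∞} {n : ℕ} {s t : ι}
    (h : 0 < stepProb p n s t) :
    ∃ u : ℕ → ι, u 0 = s ∧ u n = t ∧ ∏ i ∈ Finset.range n, p (u i) (u (i + 1)) ≠ 0 := by
  classical
  induction n generalizing s with
  | zero =>
    simp only [stepProb] at h
    split_ifs at h with hst
    · exact ⟨fun _ => s, rfl, hst, by simp⟩
    · simp at h
  | succ n ih =>
    simp only [stepProb] at h
    obtain ⟨r, hr⟩ : ∃ r, p s r * stepProb p n r t ≠ 0 := by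
      by_contra! h0
      simp [h0] at h
    obtain ⟨u, hu0, hun, hu⟩ := ih (pos_iff_ne_zero.2 (right_ne_zero_of_mul hr))
    refine ⟨fun i => Nat.casesOn i s u, rfl, hun, ?_⟩
    rw [Finset.prod_range_succ']
    refine mul_ne_zero hu ?_
    simpa [hu0] using left_ne_zero_of_mul hr

/-- The conditional probability of the section `{a | (a, x) ∈ U}` given that the chain
starts in `s`. -/
noncomputable def sectionProb {ι M : Type*} [MeasurableSpace ι] (lam : Measure (ℕ → ι))
    (U : Set ((ℕ → ι) × M)) (s : ι) (x : M) : ℝ :=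
  lam.real (uniCyl 0 (fun _ => s) ∩ {a | (a, x) ∈ U}) / lam.real (uniCyl 0 fun _ => s)

theorem abs_sectionProb_le {ι M : Type*} [MeasurableSpace ι] {lam : Measure (ℕ → ι)}
    (hfin : ∀ s, lam (uniCyl 0 fun _ => s) ≠ ∞) (U : Set ((ℕ → ι) × M)) (s : ι) (x : M) :
    |sectionProb lam U s x| ≤ 1 := by
  rw [sectionProb, abs_of_nonneg (div_nonneg measureReal_nonneg measureReal_nonneg)]
  exact div_le_one_of_le₀ (measureReal_mono inter_subset_left (hfin s)) measureReal_nonneg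

variable [Countable ι] [MeasurableSpace ι] [DiscreteMeasurableSpace ι]

/-- If `t` is visited infinitely often, the cylinder of `s` splits according to the path up to
the first visit to `t` at or after time `N`. -/
theorem hasSum_hittingWord {lam : Measure (ℕ → ι)} {s t : ι}
    (hrec : ∀ᵐ a ∂lam, ∃ᶠ n in atTop, a n = t) (hfin : lam (uniCyl 0 fun _ => s) ≠ ∞) (N : ℕ)
    {G : Set (ℕ → ι)} (hG : MeasurableSet G) :
    HasSum (fun u : HittingWord s t N => lam.real (uniCyl u.length u.seq ∩ G))
      (lam.real (uniCyl 0 (fun _ => s) ∩ G)) := by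
  have h1 : lam (uniCyl 0 (fun _ => s) ∩ G) =
      ∑' u : HittingWord s t N, lam (uniCyl u.length u.seq ∩ G) := by
    rw [← measure_iUnion]
    · apply measure_congr
      filter_upwards [hrec] with a ha
      apply propext
      change a ∈ uniCyl 0 (fun _ => s) ∩ G ↔
        a ∈ ⋃ u : HittingWord s t N, uniCyl u.length u.seq ∩ G
      rw [← iUnion_inter]
      refine and_congr_left fun _ => ?_
      rw [mem_iUnion]
      constructor
      · intro h
        have h0 : a 0 = s := h 0 le_rfl
        subst h0
        exact exists_hittingWord ha N
      · rintro ⟨u, hu⟩ i hi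
        rw [Nat.le_zero.1 hi, hu 0 (Nat.zero_le _), u.seq_zero]
    · exact fun u v h => (HittingWord.disjoint h).mono inter_subset_left inter_subset_left
    · exact fun u => (measurableSet_uniCyl _ _).inter hG
  have h2 : ∑' u : HittingWord s t N, lam (uniCyl u.length u.seq ∩ G) ≠ ∞ := by
    rw [← h1]
    exact measure_ne_top_of_subset inter_subset_left hfin
  simp only [measureReal_def]
  rw [h1, ENNReal.tsum_toReal_eq fun u => ENNReal.ne_top_of_tsum_ne_top h2 u]
  exact (ENNReal.summable_toReal h2).hasSum

variable {p : ι → ι → ℝ≥0∞} {w : ι → ℝ≥0∞} {lam : Measure (ℕ → ι)} {M : Type*}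
  [MeasurableSpace M] {m : Measure M} {W : M → M}

/-- A set in the product of a one-sided recurrent aperiodic Markov shift and an ergodic
transformation which is invariant almost everywhere under the product is trivial. Given the initial
state, the conditional probability of its section at `x` is an average of those at later points of the
orbit of `x`, hence constant. -/
theorem oneSided_trivial_of_invariant [SFinite m] [SFinite lam]
    (hw0 : ∀ s, w s ≠ 0) (hwtop : ∀ s, w s ≠ ∞) (hp : ∀ s t, p s t ≠ ∞)
    (hcyl : ∀ n s, lam (uniCyl n s) = w (s 0) * ∏ i ∈ Finset.range n, p (s i) (s (i + 1)))
    (hper : IsAperiodic p) (hrec : ∀ t, ∀ᵐ a ∂lam, ∃ᶠ n in atTop, a n = t)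
    (hW : Ergodic W m) {U : Set ((ℕ → ι) × M)} (hU : MeasurableSet U)
    (hinv : ∀ᵐ z ∂lam.prod m, ∀ n, z ∈ U ↔ (Prod.map (uniShift ι) W)^[n] z ∈ U) :
    (∀ᵐ z ∂lam.prod m, z ∈ U) ∨ ∀ᵐ z ∂lam.prod m, z ∉ U := by
  have hfin0 : ∀ s, lam (uniCyl 0 fun _ => s) = w s := fun s => by rw [hcyl]; simp
  have hfin : ∀ s, lam (uniCyl 0 fun _ => s) ≠ ∞ := fun s => by rw [hfin0]; exact hwtop s
  have hpos : ∀ s, 0 < lam.real (uniCyl 0 fun _ => s) := fun s =>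
    ENNReal.toReal_pos (by rw [hfin0]; exact hw0 s) (hfin s)
  have hcyltop : ∀ n s, lam (uniCyl n s) ≠ ∞ := fun n s => by
    rw [hcyl]
    exact ENNReal.mul_ne_top (hwtop _) (ENNReal.prod_ne_top fun i _ => hp _ _)
  have hUs : ∀ x, MeasurableSet {a : ℕ → ι | (a, x) ∈ U} := fun x => measurable_prodMk_right hU
  -- fibrewise invariance
  have hinv' : ∀ᵐ x ∂m, ∀ᵐ a ∂lam, ∀ n, (a, x) ∈ U ↔ ((uniShift ι)^[n] a, W^[n] x) ∈ U := by
    have h1 : ∀ᵐ z ∂m.prod lam, ∀ n, z.swap ∈ U ↔ (Prod.map (uniShift ι) W)^[n] z.swap ∈ U := by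
      rw [← Measure.prod_swap] at hinv
      exact ae_of_ae_map measurable_swap.aemeasurable hinv
    filter_upwards [Measure.ae_ae_of_ae_prod h1] with x hx
    filter_upwards [hx] with a ha n
    simpa only [Prod.swap_prod_mk, Prod.map_iterate, Prod.map_apply] using ha n
  -- the Markov property expresses the section of `U` in a cylinder by the states
  have hmark : ∀ᵐ x ∂m, ∀ n s, lam.real (uniCyl n s ∩ {a | (a, x) ∈ U}) =
      lam.real (uniCyl n s) * sectionProb lam U (s n) (W^[n] x) := by
    filter_upwards [hinv'] with x hx n s
    have h1 : lam (uniCyl n s ∩ {a | (a, x) ∈ U}) =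
        lam (uniCyl n s ∩ (uniShift ι)^[n] ⁻¹' {a | (a, W^[n] x) ∈ U}) := by
      apply measure_congr
      filter_upwards [hx] with a ha
      exact propext (and_congr_right fun _ => ha n)
    rw [markov_property hw0 hwtop hp hcyl n s (hUs _), ← hfin0 (s n)] at h1
    simp only [measureReal_def, sectionProb]
    rw [h1, ENNReal.toReal_mul, ENNReal.toReal_div]
    ring
  -- hence the section probabilities are harmonic
  have hharm : ∀ᵐ x ∂m, ∀ s t N, HasSum (fun u : HittingWord s t N =>
      lam.real (uniCyl u.length u.seq) / lam.real (uniCyl 0 fun _ => s) *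
        sectionProb lam U t (W^[u.length] x)) (sectionProb lam U s x) := by
    filter_upwards [hmark] with x hx s t N
    have h1 := (hasSum_hittingWord (hrec t) (hfin s) N (hUs x)).div_const
      (lam.real (uniCyl 0 fun _ => s))
    refine h1.congr_fun fun u => ?_
    rw [hx, u.seq_length]
    ring
  have hsum1 : ∀ s t N, HasSum (fun u : HittingWord s t N =>
      lam.real (uniCyl u.length u.seq) / lam.real (uniCyl 0 fun _ => s)) 1 := by
    intro s t N
    have h1 := (hasSum_hittingWord (hrec t) (hfin s) N MeasurableSet.univ).div_const
      (lam.real (uniCyl 0 fun _ => s))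
    simpa only [inter_univ, div_self (hpos s).ne'] using h1
  have hiter : ∀ {P : M → Prop}, (∀ᵐ x ∂m, P x) → ∀ᵐ x ∂m, ∀ n, P (W^[n] x) := fun h =>
    ae_all_iff.2 fun n => (hW.toMeasurePreserving.iterate n).quasiMeasurePreserving.ae h
  rcases isEmpty_or_nonempty ι with hι | ⟨⟨s₀⟩⟩
  · left
    have : IsEmpty (ℕ → ι) := ⟨fun a => hι.elim (a 0)⟩
    exact ae_of_all _ fun z => this.elim z.1
  -- along the orbit of `x` harmonic functions are constant, by aperiodicity
  have hconst : ∀ᵐ x ∂m, sectionProb lam U s₀ (W x) = sectionProb lam U s₀ x := by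
    filter_upwards [hiter hharm] with x hx
    refine apply_one_eq_apply_zero_of_periods (k := fun i => sectionProb lam U s₀ (W^[i] x))
      (Q := fun a => 0 < stepProb p a s₀ s₀) (fun a ha i => ?_) (fun d hd => hper s₀ d hd)
    obtain ⟨u, hu0, hua, hu⟩ := exists_path_of_stepProb_pos ha
    -- with `N` equal to the length `a`, the path `u` first visits `s₀` at or after `N` at its end
    let u₀ : HittingWord s₀ s₀ a := ⟨a, fun i => u i, hu0, hua, le_rfl, fun i h1 h2 =>
      absurd h1 (not_le.2 h2)⟩
    have hu₀ : 0 < lam.real (uniCyl u₀.length u₀.seq) := by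
      refine ENNReal.toReal_pos ?_ (hcyltop _ _)
      rw [hcyl]
      refine mul_ne_zero (hw0 _) ?_
      convert hu using 1
      refine Finset.prod_congr rfl fun j hj => ?_
      have hj' : j < a := Finset.mem_range.1 hj
      simp only [HittingWord.seq]
      rw [wordExt_of_le _ hj'.le, wordExt_of_le _ hj']
    refine eq_of_harmonic (k := fun i => sectionProb lam U s₀ (W^[i] x))
      (n := fun v : HittingWord s₀ s₀ a => v.length) (x0 := u₀) (M := 1)
      (fun i => abs_sectionProb_le hfin U _ _)
      (fun v => div_nonneg measureReal_nonneg measureReal_nonneg) (hsum1 s₀ s₀ a) (fun i => ?_)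
      (div_pos hu₀ (hpos s₀)) i
    refine (hx i s₀ s₀ a).congr_fun fun v => ?_
    rw [add_comm i, Function.iterate_add_apply]
  have hmeas : ∀ s, Measurable (sectionProb lam U s) := by
    intro s
    have h1 : Measurable fun x => lam ((fun a => (a, x)) ⁻¹'
        (U ∩ Prod.fst ⁻¹' uniCyl 0 fun _ => s)) :=
      measurable_measure_prodMk_right (hU.inter (measurable_fst (measurableSet_uniCyl _ _)))
    convert h1.ennreal_toReal.div_const (lam.real (uniCyl 0 fun _ => s)) using 2 with x
    rw [sectionProb, measureReal_def, inter_comm]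
    rfl
  obtain ⟨c, hc⟩ := hW.ae_eq_const_of_ae_eq_comp_ae (hmeas s₀).aestronglyMeasurable hconst
  have hc' : ∀ᵐ x ∂m, ∀ n s, sectionProb lam U s (W^[n] x) = c := by
    filter_upwards [hiter hharm, hiter hc] with x hx hcx n s
    have h1 := hx n s s₀ 0
    have h2 := (hsum1 s s₀ 0).mul_right c
    rw [one_mul] at h2
    refine h1.unique (h2.congr_fun fun u => ?_)
    rw [← Function.iterate_add_apply, hcx]
    rfl
  -- so the section of `U` at almost every point is independent of all cylinders
  have hrestr : ∀ᵐ x ∂m, lam.restrict {a | (a, x) ∈ U} = ENNReal.ofReal c • lam := by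
    filter_upwards [hmark, hc'] with x hx hcx
    have hc0 : 0 ≤ c := by
      rw [← hcx 0 s₀]
      exact div_nonneg measureReal_nonneg measureReal_nonneg
    refine ext_of_uniCyl (fun s => ?_) fun n s => ?_
    · refine ne_top_of_le_ne_top (hcyltop 0 s) (Measure.restrict_apply_le _ _)
    · have h1 := hx n s
      rw [hcx] at h1
      rw [Measure.restrict_apply (measurableSet_uniCyl _ _), Measure.smul_apply, smul_eq_mul,
        ← ENNReal.ofReal_toReal (measure_ne_top_of_subset
          (inter_subset_left (t := {a | (a, x) ∈ U})) (hcyltop n s)),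
        ← ENNReal.ofReal_toReal (hcyltop n s), ← ENNReal.ofReal_mul hc0]
      simp only [measureReal_def] at h1
      rw [h1, mul_comm]
  have htriv : ∀ {P : (ℕ → ι) × M → Prop}, MeasurableSet {z | P z} →
      (∀ᵐ x ∂m, ∀ᵐ a ∂lam, P (a, x)) → ∀ᵐ z ∂lam.prod m, P z := by
    intro P hP h
    rw [← Measure.prod_swap, ae_map_iff measurable_swap.aemeasurable hP]
    exact (Measure.ae_prod_iff_ae_ae (measurable_swap hP)).2 h
  by_cases hc0 : ENNReal.ofReal c = 0
  · right
    refine htriv hU.compl ?_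
    filter_upwards [hrestr] with x hx
    rw [hc0, zero_smul, Measure.restrict_eq_zero] at hx
    exact measure_eq_zero_iff_ae_notMem.1 hx
  · left
    refine htriv hU ?_
    filter_upwards [hrestr] with x hx
    have h1 := congrArg (fun μ : Measure (ℕ → ι) => μ {a | (a, x) ∈ U}ᶜ) hx
    simp only [Measure.restrict_apply (hUs x).compl, compl_inter_self, measure_empty,
      Measure.smul_apply, smul_eq_mul] at h1
    have h2 := (mul_eq_zero.1 h1.symm).resolve_left hc0
    filter_upwards [measure_eq_zero_iff_ae_notMem.1 h2] with a ha
    exact not_not.1 ha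

end HarmonicSections

/-! ### Ergodicity of products with a two-sided Markov shift -/

section TwoSidedMarkov

variable {ι : Type*} [MeasurableSpace ι] [DiscreteMeasurableSpace ι]
  {p : ι → ι → ℝ≥0∞} {w : ι → ℝ≥0∞} {ν : Measure (ℤ → ι)}

theorem IsMarkovMeasure.map_futureFrom_uniCyl (hν : IsMarkovMeasure p w ν) (n : ℕ) (s : ℕ → ι) :
    ν.map (futureFrom 0) (uniCyl n s) = w (s 0) * ∏ i ∈ Finset.range n, p (s i) (s (i + 1)) := by
  rw [Measure.map_apply (measurable_futureFrom 0) (measurableSet_uniCyl n s)]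
  exact hν.cylinder 0 n s

theorem IsMarkovMeasure.measure_state {ι : Type*} [MeasurableSpace ι] {p : ι → ι → ℝ≥0∞}
    {w : ι → ℝ≥0∞} {ν : Measure (ℤ → ι)} (hν : IsMarkovMeasure p w ν) (s : ι) :
    ν {y | y 0 = s} = w s := by
  have h1 := hν.cylinder 0 0 fun _ => s
  simpa using h1

theorem measurableSet_state (s : ι) : MeasurableSet {y : ℤ → ι | y 0 = s} :=
  measurable_pi_apply (X := fun _ : ℤ => ι) 0 (MeasurableSet.of_discrete (s := {s}))

theorem IsMarkovMeasure.sigmaFinite {ι : Type*} [Countable ι] [MeasurableSpace ι]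
    {p : ι → ι → ℝ≥0∞} {w : ι → ℝ≥0∞} {ν : Measure (ℤ → ι)} (hν : IsMarkovMeasure p w ν) :
    SigmaFinite ν := by
  refine Measure.sigmaFinite_of_countable (S := range fun s : ι => {y : ℤ → ι | y 0 = s})
    (countable_range _) ?_ ?_
  · rintro _ ⟨s, rfl⟩
    rw [hν.measure_state]
    exact hν.weight_lt_top s
  · exact eq_univ_of_forall fun y => ⟨_, ⟨y 0, rfl⟩, rfl⟩

variable [Countable ι] {M : Type*} [MeasurableSpace M] {m : Measure M} {W : M → M}

/-- The product of a conservative ergodic aperiodic Markov shift with an ergodic transformation is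
ergodic if it is recurrent. -/
theorem IsMarkovMeasure.ergodic_prod (hν : IsMarkovMeasure p w ν)
    (hScons : Conservative (biShift ι) ν) (hSerg : Ergodic (biShift ι) ν)
    (hSaper : IsAperiodic p) [SigmaFinite m] (hW : Ergodic W m) {K : ℕ → Set M}
    (hK : ∀ i, MeasurableSet (K i)) (hKfin : ∀ i, m (K i) ≠ ∞) (hKcov : ⋃ i, K i = univ)
    (hrec : ∀ s i, ∀ᵐ z ∂ν.prod m, z ∈ {y : ℤ → ι | y 0 = s} ×ˢ K i →
      ∃ᶠ n in atTop, (Prod.map (biShift ι) W)^[n] z ∈ {y : ℤ → ι | y 0 = s} ×ˢ K i) :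
    Ergodic (Prod.map (biShift ι) W) (ν.prod m) := by
  have := hν.sigmaFinite
  have hV : MeasurePreserving (Prod.map (biShift ι) W) (ν.prod m) (ν.prod m) :=
    hSerg.toMeasurePreserving.prod hW.toMeasurePreserving
  refine ⟨hV, ⟨fun E hE hinv => ?_⟩⟩
  have hpre : ∀ s i, Prod.map (futureFrom 0) id ⁻¹' ((uniCyl 0 fun _ => s) ×ˢ K i) =
      {y : ℤ → ι | y 0 = s} ×ˢ K i := by
    intro s i
    ext ⟨y, x⟩
    simp [uniCyl, futureFrom]
  have hone : ∀ s i, ∃ U : Set ((ℕ → ι) × M), MeasurableSet U ∧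
      ∀ᵐ z ∂ν.prod m, z ∈ {y : ℤ → ι | y 0 = s} ×ˢ K i →
        (z ∈ E ↔ Prod.map (futureFrom 0) id z ∈ U) := by
    intro s i
    have h1 := exists_oneSided_ae_mem_iff hW.measurable hV
      (D := (uniCyl 0 fun _ => s) ×ˢ K i) ((measurableSet_uniCyl _ _).prod (hK i))
    rw [hpre] at h1
    refine h1 ?_ (hrec s i) hE hinv
    rw [Measure.prod_prod, hν.measure_state]
    exact ENNReal.mul_ne_top (hν.weight_lt_top s).ne (hKfin i)
  choose U hUm hU using hone
  set U' : Set ((ℕ → ι) × M) := ⋃ s, ⋃ i, U s i ∩ (uniCyl 0 fun _ => s) ×ˢ K i with hU'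
  have hUm' : MeasurableSet U' := MeasurableSet.iUnion fun s => MeasurableSet.iUnion fun i =>
    (hUm s i).inter ((measurableSet_uniCyl _ _).prod (hK i))
  have hEU : ∀ᵐ z ∂ν.prod m, z ∈ E ↔ Prod.map (futureFrom 0) id z ∈ U' := by
    have h1 : ∀ᵐ z ∂ν.prod m, ∀ s i, z ∈ {y : ℤ → ι | y 0 = s} ×ˢ K i →
        (z ∈ E ↔ Prod.map (futureFrom 0) id z ∈ U s i) :=
      ae_all_iff.2 fun s => ae_all_iff.2 fun i => hU s i
    filter_upwards [h1] with z hz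
    simp only [hU', mem_iUnion, mem_inter_iff]
    have hmem : ∀ s i, Prod.map (futureFrom 0) id z ∈ (uniCyl 0 fun _ => s) ×ˢ K i ↔
        z ∈ {y : ℤ → ι | y 0 = s} ×ˢ K i := fun s i => by rw [← hpre]; rfl
    simp only [hmem]
    constructor
    · intro hzE
      obtain ⟨i, hi⟩ := mem_iUnion.1 (hKcov ▸ mem_univ z.2)
      have h2 : z ∈ {y : ℤ → ι | y 0 = z.1 0} ×ˢ K i := ⟨rfl, hi⟩
      exact ⟨_, i, (hz _ i h2).1 hzE, h2⟩
    · rintro ⟨s, i, h2, h3⟩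
      exact (hz s i h3).2 h2
  have hfm : Measurable (Prod.map (futureFrom (ι := ι) 0) (id : M → M)) :=
    (measurable_futureFrom 0).prodMap measurable_id
  have : SigmaFinite (ν.map (futureFrom 0)) := by
    refine Measure.sigmaFinite_of_countable (S := range fun s : ι => uniCyl 0 fun _ => s)
      (countable_range _) ?_ ?_
    · rintro _ ⟨s, rfl⟩
      rw [hν.map_futureFrom_uniCyl]
      simpa using hν.weight_lt_top s
    · refine eq_univ_of_forall fun a => ⟨_, ⟨a 0, rfl⟩, fun i hi => ?_⟩
      rw [Nat.le_zero.1 hi]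
  have hmap : (ν.prod m).map (Prod.map (futureFrom 0) id) = (ν.map (futureFrom 0)).prod m := by
    rw [← Measure.map_prod_map _ _ (measurable_futureFrom 0) measurable_id, Measure.map_id]
  have hinvn : ∀ n, (Prod.map (biShift ι) W)^[n] ⁻¹' E = E := fun n => by
    induction n with
    | zero => rfl
    | succ n ih => rw [Function.iterate_succ, preimage_comp, ih, hinv]
  have hinvU : ∀ᵐ z ∂(ν.map (futureFrom 0)).prod m, ∀ n,
      z ∈ U' ↔ (Prod.map (uniShift ι) W)^[n] z ∈ U' := by
    rw [← hmap]
    have hms : MeasurableSet {z : (ℕ → ι) × M | ∀ n,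
        z ∈ U' ↔ (Prod.map (uniShift ι) W)^[n] z ∈ U'} := by
      have : {z : (ℕ → ι) × M | ∀ n, z ∈ U' ↔ (Prod.map (uniShift ι) W)^[n] z ∈ U'} =
          ⋂ n, {z : (ℕ → ι) × M | z ∈ U' ↔ (Prod.map (uniShift ι) W)^[n] z ∈ U'} := by
        ext z; simp
      rw [this]
      exact MeasurableSet.iInter fun n => MeasurableSet.iff hUm'
        ((measurable_uniShift.prodMap hW.measurable).iterate n hUm')
    rw [ae_map_iff hfm.aemeasurable hms]
    have h1 : ∀ᵐ z ∂ν.prod m, ∀ n, ((Prod.map (biShift ι) W)^[n] z ∈ E ↔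
        Prod.map (futureFrom 0) id ((Prod.map (biShift ι) W)^[n] z) ∈ U') :=
      ae_all_iff.2 fun n => (hV.iterate n).quasiMeasurePreserving.ae hEU
    filter_upwards [hEU, h1] with z hz hz1 n
    rw [← hz, ← ((semiconj_futureFrom W).iterate_right n).eq, ← hz1 n, ← mem_preimage, hinvn]
  have hfr : ∀ t, ∀ᵐ a ∂ν.map (futureFrom 0), ∃ᶠ n in atTop, a n = t := by
    intro t
    have h1 := ae_frequently_mem hScons hSerg (measurableSet_state t)
      (by rw [hν.measure_state]; exact (hν.weight_pos t).ne')
    have hms : MeasurableSet {a : ℕ → ι | ∃ᶠ n in atTop, a n = t} := by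
      have h2 := measurableSet_setOf_frequently (measurable_uniShift (ι := ι))
        (measurableSet_uniCyl 0 fun _ => t)
      convert h2 using 4 with a n
      simp [uniCyl, uniShift_iterate_apply]
    rw [ae_map_iff (measurable_futureFrom 0).aemeasurable hms]
    filter_upwards [h1] with y hy
    refine hy.mono fun n hn => ?_
    simpa [biShift_iterate_apply, futureFrom] using hn
  have hp : ∀ s t, p s t ≠ ∞ := fun s t =>
    ne_top_of_le_ne_top ENNReal.one_ne_top ((ENNReal.le_tsum t).trans (hν.stochastic s).le)
  rcases oneSided_trivial_of_invariant (fun s => (hν.weight_pos s).ne')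
    (fun s => (hν.weight_lt_top s).ne) hp hν.map_futureFrom_uniCyl hSaper hfr hW hUm' hinvU
    with h | h
  · rw [← hmap] at h
    replace h := ae_of_ae_map hfm.aemeasurable h
    refine eventuallyConst_set'.2 (Or.inr ?_)
    filter_upwards [h, hEU] with z hz hzE
    exact eq_true (hzE.2 hz)
  · rw [← hmap] at h
    replace h := ae_of_ae_map hfm.aemeasurable h
    refine eventuallyConst_set'.2 (Or.inl ?_)
    filter_upwards [h, hEU] with z hz hzE
    exact eq_false (fun h' => hz (hzE.1 h'))

end TwoSidedMarkov

/-! ### The odometer and weighted digit sums -/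

section Odometer

theorem measurable_odometer : Measurable odometer := by
  refine measurable_pi_lambda _ fun n => ?_
  refine Measurable.ite ?_ ((Measurable.of_discrete (f := not)).comp (measurable_pi_apply n))
    (measurable_pi_apply n)
  have : {ω : DyadicSeq | ∀ k < n, ω k = true} =
      ⋂ k, ⋂ (_ : k < n), (fun ω : DyadicSeq => ω k) ⁻¹' {true} := by
    ext ω; simp
  rw [this]
  exact MeasurableSet.iInter fun k => MeasurableSet.iInter fun _ =>
    measurable_pi_apply k (MeasurableSet.of_discrete)

theorem odometer_injective : Function.Injective odometer := by
  intro ω ω' h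
  ext n
  induction n using Nat.strong_induction_on with
  | _ n ih =>
    have h1 := congrFun h n
    have h2 : (∀ k < n, ω k = true) ↔ ∀ k < n, ω' k = true :=
      forall₂_congr fun k hk => by rw [ih k hk]
    simp only [odometer, h2] at h1
    split_ifs at h1
    · exact Bool.not_inj h1
    · exact h1

theorem measurable_firstZero : Measurable firstZero := by
  refine measurable_to_countable' fun n => ?_
  have hc : ∀ k b, MeasurableSet {ω : DyadicSeq | ω k = b} := fun k b =>
    measurable_pi_apply (X := fun _ : ℕ => Bool) k (MeasurableSet.of_discrete (s := {b}))
  have : firstZero ⁻¹' {n} = ({ω | ω n = false} ∩ ⋂ k, ⋂ (_ : k < n), {ω | ω k = true}) ∪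
      ((⋂ k, {ω | ω k = true}) ∩ {_ω | n = 0}) := by
    ext ω
    simp only [mem_preimage, mem_singleton_iff, firstZero, mem_union, mem_inter_iff, mem_iInter,
      mem_ofPred_eq]
    rcases eq_empty_or_nonempty {k | ω k = false} with h | h
    · have h' : ∀ k, ω k = true := fun k => by
        have : k ∉ {k | ω k = false} := by rw [h]; exact notMem_empty k
        simpa using this
      rw [h, Nat.sInf_empty]
      simp [h', eq_comm]
    · constructor
      · rintro rfl
        refine Or.inl ⟨Nat.sInf_mem h, fun k hk => ?_⟩
        have := Nat.notMem_of_lt_sInf hk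
        simpa using this
      · rintro (⟨h1, h2⟩ | ⟨h1, -⟩)
        · refine le_antisymm (Nat.sInf_le h1) (not_lt.1 fun h3 => ?_)
          have h4 := Nat.sInf_mem h
          simp only [mem_ofPred_eq] at h4
          rw [h2 _ h3] at h4
          exact Bool.noConfusion h4
        · obtain ⟨k, hk⟩ := h
          simp only [mem_ofPred_eq, h1 k] at hk
          exact Bool.noConfusion hk
  rw [this]
  exact ((hc n false).inter (MeasurableSet.iInter fun k => MeasurableSet.iInter fun _ =>
    hc k true)).union ((MeasurableSet.iInter fun k => hc k true).inter (MeasurableSet.const _))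

theorem measurable_dyadicCocycle (q : ℕ → ℕ) : Measurable (dyadicCocycle q) :=
  (Measurable.of_discrete (f := fun n => q n - ∑ k ∈ Finset.range n, q k)).comp
    measurable_firstZero

/-- The weighted sum `∑ c l` over the coordinates `l < L` of `ω` which are `1`. -/
def digitSum (c : ℕ → ℤ) (L : ℕ) (ω : DyadicSeq) : ℤ :=
  ∑ l ∈ Finset.range L, if ω l = true then c l else 0

theorem digitSum_succ (c : ℕ → ℤ) (L : ℕ) (ω : DyadicSeq) :
    digitSum c (L + 1) ω = digitSum c L ω + if ω L = true then c L else 0 :=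
  Finset.sum_range_succ _ _

theorem digitSum_sub_congr (c : ℕ → ℤ) {L L' : ℕ} (hL : L ≤ L') {ω ω' : DyadicSeq}
    (h : ∀ l, L ≤ l → ω' l = ω l) :
    digitSum c L' ω' - digitSum c L' ω = digitSum c L ω' - digitSum c L ω := by
  induction L', hL using Nat.le_induction with
  | base => rfl
  | succ n hn ih =>
    rw [digitSum_succ, digitSum_succ, h n hn]
    linarith

theorem apply_firstZero {ω : DyadicSeq} (h : ∃ n, ω n = false) : ω (firstZero ω) = false :=
  Nat.sInf_mem (s := {n | ω n = false}) h

theorem apply_of_lt_firstZero {ω : DyadicSeq} {k : ℕ} (hk : k < firstZero ω) : ω k = true := by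
  have := Nat.notMem_of_lt_sInf hk
  simpa using this

theorem firstZero_le {ω : DyadicSeq} {n : ℕ} (h : ω n = false) : firstZero ω ≤ n :=
  Nat.sInf_le h

theorem odometer_of_firstZero_lt {ω : DyadicSeq} (h : ∃ n, ω n = false) {l : ℕ}
    (hl : firstZero ω < l) : odometer ω l = ω l := by
  rw [odometer, if_neg]
  intro h1
  have h2 := h1 _ hl
  rw [apply_firstZero h] at h2
  exact Bool.noConfusion h2

theorem odometer_firstZero {ω : DyadicSeq} (h : ∃ n, ω n = false) :
    odometer ω (firstZero ω) = true := by
  rw [odometer, if_pos fun k hk => apply_of_lt_firstZero hk, apply_firstZero h]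
  rfl

theorem odometer_of_lt_firstZero {ω : DyadicSeq} {l : ℕ} (hl : l < firstZero ω) :
    odometer ω l = false := by
  rw [odometer, if_pos fun k hk => apply_of_lt_firstZero (hk.trans hl), apply_of_lt_firstZero hl]
  rfl

/-- The effect of the odometer on weighted digit sums. -/
theorem digitSum_odometer (c : ℕ → ℤ) {ω : DyadicSeq} (h : ∃ n, ω n = false) {L : ℕ}
    (hL : firstZero ω < L) : digitSum c L (odometer ω) - digitSum c L ω =
      c (firstZero ω) - ∑ k ∈ Finset.range (firstZero ω), c k := by
  rw [digitSum_sub_congr c hL fun l hl => odometer_of_firstZero_lt h hl, digitSum_succ,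
    digitSum_succ, odometer_firstZero h, apply_firstZero h]
  have h1 : digitSum c (firstZero ω) (odometer ω) = 0 :=
    Finset.sum_eq_zero fun l hl => by
      rw [odometer_of_lt_firstZero (Finset.mem_range.1 hl)]; rfl
  have h2 : digitSum c (firstZero ω) ω = ∑ k ∈ Finset.range (firstZero ω), c k :=
    Finset.sum_congr rfl fun l hl => by
      rw [apply_of_lt_firstZero (Finset.mem_range.1 hl)]; rfl
  rw [h1, h2]
  simp

/-- The dyadic cocycle is the coboundary of the weighted digit sum. -/
theorem IsGrowthSeq.dyadicCocycle_eq {q : ℕ → ℕ} (hq : IsGrowthSeq q) {ω : DyadicSeq}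
    (h : ∃ n, ω n = false) {L : ℕ} (hL : firstZero ω < L) :
    (dyadicCocycle q ω : ℤ) =
      digitSum (fun l => q l) L (odometer ω) - digitSum (fun l => q l) L ω := by
  rw [digitSum_odometer _ h hL, dyadicCocycle, Nat.cast_sub (hq.2 _).le]
  push_cast
  rfl

theorem abs_digitSum_sub_le (q : ℕ → ℕ) (L : ℕ) (ω ω' : DyadicSeq) :
    |digitSum (fun l => q l) L ω' - digitSum (fun l => q l) L ω| ≤
      ∑ l ∈ Finset.range L, (q l : ℤ) := by
  rw [digitSum, digitSum, ← Finset.sum_sub_distrib]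
  refine (Finset.abs_sum_le_sum_abs _ _).trans (Finset.sum_le_sum fun l _ => ?_)
  split_ifs <;> simp

/-- Representations `∑ ε_l q_l` with `ε_l ∈ {-1, 0, 1}` are unique for super growth sequences; here
`x` is the difference of two such digit sequences. -/
theorem IsSuperGrowthSeq.digit_unique {q : ℕ → ℕ} (hq : IsSuperGrowthSeq q) {x : ℕ → ℤ}
    (hx : ∀ l, |x l| ≤ 2) {L : ℕ} (h : ∑ l ∈ Finset.range L, x l * q l = 0) :
    ∀ l < L, x l = 0 := by
  induction L with
  | zero => intro l hl; omega
  | succ L ih =>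
    rw [Finset.sum_range_succ] at h
    have h1 : |∑ l ∈ Finset.range L, x l * (q l : ℤ)| < q L := by
      calc _ ≤ ∑ l ∈ Finset.range L, |x l * (q l : ℤ)| := Finset.abs_sum_le_sum_abs _ _
        _ ≤ ∑ l ∈ Finset.range L, 2 * (q l : ℤ) := Finset.sum_le_sum fun l _ => by
            rw [abs_mul, Nat.abs_cast]
            exact mul_le_mul_of_nonneg_right (hx l) (by positivity)
        _ < q L := by
            rw [← Finset.mul_sum]
            exact_mod_cast hq.2 L
    have h2 : x L = 0 := by
      by_contra hne
      have h3 : 1 ≤ |x L| := Int.one_le_abs hne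
      have h4 : |x L * (q L : ℤ)| < q L := by
        rw [show x L * (q L : ℤ) = -∑ l ∈ Finset.range L, x l * (q l : ℤ) by linarith, abs_neg]
        exact h1
      rw [abs_mul, Nat.abs_cast] at h4
      nlinarith [Int.natCast_nonneg (q L)]
    intro l hl
    rcases Nat.lt_succ_iff_lt_or_eq.1 hl with h3 | h3
    · exact ih (by rw [h2] at h; linarith) l h3
    · rw [h3, h2]

/-- A change of the digit sum determines which digits go up. -/
theorem IsSuperGrowthSeq.digit_eq {q : ℕ → ℕ} (hq : IsSuperGrowthSeq q) {L : ℕ}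
    {ω ω' η η' : DyadicSeq}
    (h : digitSum (fun l => q l) L ω' - digitSum (fun l => q l) L ω =
      digitSum (fun l => q l) L η' - digitSum (fun l => q l) L η) {l : ℕ} (hl : l < L)
    (h0 : ω l = false) (h1 : ω' l = true) : η' l = true := by
  by_contra h2
  have h3 := hq.digit_unique (x := fun l => ((if ω' l = true then 1 else 0) -
    (if ω l = true then 1 else 0)) - ((if η' l = true then 1 else 0) -
    (if η l = true then 1 else 0))) (fun l => by split_ifs <;> simp) (L := L) (by
      simp only [sub_mul, ite_mul, one_mul, zero_mul, Finset.sum_sub_distrib]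
      simp only [digitSum] at h
      linarith) l hl
  rw [Bool.not_eq_true] at h2
  rcases h4 : η l <;> simp [h0, h1, h2, h4] at h3

end Odometer

/-! ### The dyadic measure -/

section DyadicMeasure

theorem dyadicMeasure_cylinder (s : Finset ℕ) (β : DyadicSeq) :
    dyadicMeasure {ω | ∀ l ∈ s, ω l = β l} = (1 / 2) ^ s.card := by
  have : {ω : DyadicSeq | ∀ l ∈ s, ω l = β l} = Set.pi s fun l => {β l} := by
    ext ω; simp [Set.mem_pi]
  rw [this, dyadicMeasure, Measure.infinitePi_pi _ fun l _ => measurableSet_singleton _]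
  simp

instance : IsProbabilityMeasure dyadicMeasure := by
  unfold dyadicMeasure; infer_instance

theorem dyadicMeasure_eq_zero_of_infinite {s : Set ℕ} (hs : s.Infinite) (β : DyadicSeq) :
    dyadicMeasure {ω | ∀ l ∈ s, ω l = β l} = 0 := by
  refine le_antisymm (ge_of_tendsto' (ENNReal.tendsto_pow_atTop_nhds_zero_of_lt_one
    (show (1 / 2 : ℝ≥0∞) < 1 by norm_num)) fun k => ?_) zero_le
  obtain ⟨t, ht, hk⟩ := hs.exists_subset_card_eq k
  rw [← hk, ← dyadicMeasure_cylinder t β]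
  exact measure_mono fun ω hω l hl => hω l (ht hl)

theorem ae_frequently_eq_false : ∀ᵐ ω ∂dyadicMeasure, ∃ᶠ n in atTop, ω n = false := by
  have h1 : ∀ N : ℕ, ∀ᵐ ω ∂dyadicMeasure, ¬ ∀ l ∈ Ici N, ω l = true := fun N =>
    measure_eq_zero_iff_ae_notMem.1
      (dyadicMeasure_eq_zero_of_infinite (Ici_infinite N) fun _ => true)
  filter_upwards [ae_all_iff.2 h1] with ω hω
  rw [frequently_atTop]
  intro N
  have := hω N
  push Not at this
  obtain ⟨l, hl, hl'⟩ := this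
  exact ⟨l, hl, by simpa using hl'⟩

end DyadicMeasure

/-! ### The tower transformation and its orbits -/

section Tower

variable {q : ℕ → ℕ}

theorem measurableSet_dyadicTower (q : ℕ → ℕ) :
    MeasurableSet {z : DyadicSeq × ℕ | 1 ≤ z.2 ∧ z.2 ≤ dyadicCocycle q z.1} :=
  (measurableSet_le measurable_const measurable_snd).inter
    (measurableSet_le measurable_snd ((measurable_dyadicCocycle q).comp measurable_fst))

instance : StandardBorelSpace (DyadicTower q) := (measurableSet_dyadicTower q).standardBorel

theorem measurable_towerMap (hq : IsGrowthSeq q) : Measurable (towerMap hq) := by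
  have hω : Measurable fun z : DyadicTower q => z.1.1 := measurable_fst.comp measurable_subtype_coe
  have hn : Measurable fun z : DyadicTower q => z.1.2 := measurable_snd.comp measurable_subtype_coe
  have h1 : Measurable fun z : DyadicTower q => (towerMap hq z).1 := by
    have : (fun z : DyadicTower q => (towerMap hq z).1) = fun z =>
        if z.1.2 + 1 ≤ dyadicCocycle q z.1.1 then (z.1.1, z.1.2 + 1)
        else (odometer z.1.1, 1) := by
      ext z : 1
      simp only [towerMap]
      split_ifs <;> rfl
    rw [this]
    exact Measurable.ite (measurableSet_le (hn.add_const 1) ((measurable_dyadicCocycle q).comp hω))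
      (hω.prodMk (hn.add_const 1)) ((measurable_odometer.comp hω).prodMk measurable_const)
  exact h1.subtype_mk

theorem towerMap_injective (hq : IsGrowthSeq q) : Function.Injective (towerMap hq) := by
  rintro ⟨⟨ω, i⟩, hi, hi'⟩ ⟨⟨η, j⟩, hj, hj'⟩ h
  simp only at hi hi' hj hj'
  have h' := congrArg Subtype.val h
  simp only [towerMap] at h'
  split_ifs at h' with h1 h2 h2 <;> simp only [Prod.mk.injEq] at h'
  · obtain ⟨rfl, h3⟩ := h'
    obtain rfl : i = j := by omega
    rfl
  · omega
  · omega
  · obtain rfl := odometer_injective h'.1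
    obtain rfl : i = j := by omega
    rfl

theorem measurableSet_level (q : ℕ → ℕ) (i : ℕ) :
    MeasurableSet {z : DyadicTower q | z.1.2 = i} :=
  (measurable_snd.comp measurable_subtype_coe) (measurableSet_singleton i)

theorem measurableSet_towerBase (q : ℕ → ℕ) : MeasurableSet (towerBase q) :=
  measurableSet_level q 1

theorem measurable_column : Measurable fun z : DyadicTower q => z.1.1 :=
  measurable_fst.comp measurable_subtype_coe

theorem towerMeasure_apply (s : Set (DyadicTower q)) :
    towerMeasure q s = (dyadicMeasure.prod Measure.count) (Subtype.val '' s) :=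
  (MeasurableEmbedding.subtype_coe (measurableSet_dyadicTower q)).comap_apply _ _

theorem towerMeasure_level_le (G : Set DyadicSeq) (i : ℕ) :
    towerMeasure q {z | z.1.1 ∈ G ∧ z.1.2 = i} ≤ dyadicMeasure G := by
  rw [towerMeasure_apply]
  calc _ ≤ (dyadicMeasure.prod Measure.count) (G ×ˢ ({i} : Set ℕ)) := by
        refine measure_mono ?_
        rintro _ ⟨z, hz, rfl⟩
        exact hz
    _ = _ := by rw [Measure.prod_prod, Measure.count_singleton, mul_one]

theorem towerMeasure_base (hq : IsGrowthSeq q) (G : Set DyadicSeq) :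
    towerMeasure q {z | z.1.1 ∈ G ∧ z.1.2 = 1} = dyadicMeasure G := by
  rw [towerMeasure_apply]
  have : Subtype.val '' {z : DyadicTower q | z.1.1 ∈ G ∧ z.1.2 = 1} = G ×ˢ ({1} : Set ℕ) := by
    ext ⟨ω, i⟩
    constructor
    · rintro ⟨z, hz, h⟩
      rw [← h]
      exact hz
    · rintro ⟨h1, h2⟩
      obtain rfl : i = 1 := h2
      exact ⟨⟨(ω, 1), le_rfl, hq.one_le_dyadicCocycle ω⟩, ⟨h1, rfl⟩, rfl⟩
  rw [this, Measure.prod_prod, Measure.count_singleton, mul_one]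

theorem towerMeasure_towerBase (hq : IsGrowthSeq q) : towerMeasure q (towerBase q) = 1 := by
  have h1 := towerMeasure_base hq univ
  simp only [mem_univ, true_and, measure_univ] at h1
  exact h1

theorem towerMeasure_level_lt_top (i : ℕ) : towerMeasure q {z | z.1.2 = i} < ∞ := by
  have h1 := towerMeasure_level_le (q := q) univ i
  simp only [mem_univ, true_and, measure_univ] at h1
  exact h1.trans_lt ENNReal.one_lt_top

instance : SigmaFinite (towerMeasure q) := by
  refine Measure.sigmaFinite_of_countable (S := range fun i : ℕ => {z : DyadicTower q | z.1.2 = i})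
    (countable_range _) ?_ ?_
  · rintro _ ⟨i, rfl⟩
    exact towerMeasure_level_lt_top i
  · exact eq_univ_of_forall fun z => ⟨_, ⟨z.1.2, rfl⟩, rfl⟩

theorem towerMeasure_column_eq_zero {G : Set DyadicSeq} (hG : dyadicMeasure G = 0) :
    towerMeasure q {z | z.1.1 ∈ G} = 0 := by
  have : {z : DyadicTower q | z.1.1 ∈ G} = ⋃ i, {z | z.1.1 ∈ G ∧ z.1.2 = i} := by
    ext z; simp
  rw [this, measure_iUnion_null_iff]
  intro i
  exact le_antisymm ((towerMeasure_level_le G i).trans hG.le) zero_le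

theorem ae_frequently_column_eq_false :
    ∀ᵐ z ∂towerMeasure q, ∃ᶠ n in atTop, z.1.1 n = false :=
  towerMeasure_column_eq_zero ae_frequently_eq_false

/-- Along an orbit of the tower the base coordinate changes in finitely many places, and the elapsed
time is the change of the level plus the change of the weighted digit sum. -/
theorem towerMap_orbit (hq : IsGrowthSeq q) (z : DyadicTower q)
    (hz : ∃ᶠ n in atTop, z.1.1 n = false) (k : ℕ) :
    ∃ L₀, ∀ L ≥ L₀, ((towerMap hq)^[k] z).1.1 L = z.1.1 L ∧
      (k : ℤ) = ((towerMap hq)^[k] z).1.2 - z.1.2 +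
        (digitSum (fun l => q l) L ((towerMap hq)^[k] z).1.1 -
          digitSum (fun l => q l) L z.1.1) := by
  induction k with
  | zero => exact ⟨0, fun L _ => ⟨rfl, by simp⟩⟩
  | succ k ih =>
    obtain ⟨L₀, hL₀⟩ := ih
    rw [Function.iterate_succ_apply']
    set z' := (towerMap hq)^[k] z
    have hex : ∃ n, z'.1.1 n = false := by
      obtain ⟨n, hn, hn'⟩ := frequently_atTop.1 hz L₀
      exact ⟨n, (hL₀ n hn).1.trans hn'⟩
    by_cases h : z'.1.2 + 1 ≤ dyadicCocycle q z'.1.1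
    · have h1 : towerMap hq z' = ⟨(z'.1.1, z'.1.2 + 1), Nat.le_add_left 1 _, h⟩ := by
        rw [towerMap, dif_pos h]
      rw [h1]
      refine ⟨L₀, fun L hL => ⟨(hL₀ L hL).1, ?_⟩⟩
      have := (hL₀ L hL).2
      push_cast
      linarith
    · have h1 : towerMap hq z' =
          ⟨(odometer z'.1.1, 1), le_refl 1, hq.one_le_dyadicCocycle _⟩ := by
        rw [towerMap, dif_neg h]
      rw [h1]
      refine ⟨max L₀ (firstZero z'.1.1 + 1), fun L hL => ⟨?_, ?_⟩⟩
      · have h2 : firstZero z'.1.1 < L := le_trans (le_max_right _ _) hL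
        exact (odometer_of_firstZero_lt hex h2).trans (hL₀ L (le_trans (le_max_left _ _) hL)).1
      · have h2 : firstZero z'.1.1 < L := le_trans (le_max_right _ _) hL
        have h3 := hq.dyadicCocycle_eq hex h2
        have h4 := (hL₀ L (le_trans (le_max_left _ _) hL)).2
        have h5 : (z'.1.2 : ℤ) = dyadicCocycle q z'.1.1 := by
          have := z'.2.2
          omega
        push_cast
        linarith

/-- Going up a column of the tower. -/
theorem towerMap_iterate_column (hq : IsGrowthSeq q) (z : DyadicTower q) (j : ℕ)
    (h : z.1.2 + j ≤ dyadicCocycle q z.1.1) :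
    (towerMap hq)^[j] z = ⟨(z.1.1, z.1.2 + j), z.2.1.trans (Nat.le_add_right _ _), h⟩ := by
  induction j with
  | zero => rfl
  | succ j ih =>
    rw [Function.iterate_succ_apply', ih (by omega), towerMap, dif_pos (by simp only; omega)]
    rfl

theorem towerMap_iterate_dyadicCocycle (hq : IsGrowthSeq q) (z : DyadicTower q)
    (hz : z.1.2 = 1) : (towerMap hq)^[dyadicCocycle q z.1.1] z =
      ⟨(odometer z.1.1, 1), le_refl 1, hq.one_le_dyadicCocycle _⟩ := by
  have h1 := hq.one_le_dyadicCocycle z.1.1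
  obtain ⟨j, hj⟩ := Nat.exists_eq_add_of_le h1
  rw [hj, add_comm 1 j, Function.iterate_succ_apply',
    towerMap_iterate_column hq z j (by omega), towerMap, dif_neg (by simp only; omega)]

/-- The least time after which an orbit can be back in the base with the coordinate of index `l`
changed from `0` to `1` and all later ones unchanged: `q_l - ∑_{k < l} q_k`. -/
def gapSeq (q : ℕ → ℕ) (l : ℕ) : ℕ := q l - ∑ k ∈ Finset.range l, q k

theorem IsSuperGrowthSeq.sum_lt_gapSeq (hq : IsSuperGrowthSeq q) (l : ℕ) :
    ∑ k ∈ Finset.range l, q k < gapSeq q l := by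
  have := hq.2 l
  rw [gapSeq]
  omega

theorem IsSuperGrowthSeq.monotone_gapSeq (hq : IsSuperGrowthSeq q) : Monotone (gapSeq q) := by
  refine monotone_nat_of_le_succ fun l => ?_
  have h1 := hq.sum_lt_gapSeq (l + 1)
  rw [Finset.sum_range_succ] at h1
  have h2 : gapSeq q l ≤ q l := Nat.sub_le _ _
  omega

theorem IsSuperGrowthSeq.le_gapSeq (hq : IsSuperGrowthSeq q) (l : ℕ) : l ≤ gapSeq q l := by
  have h1 := hq.sum_lt_gapSeq l
  have h2 : ∑ k ∈ Finset.range l, 1 ≤ ∑ k ∈ Finset.range l, q k :=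
    Finset.sum_le_sum fun k _ => by
      have := hq.2 k
      omega
  simp at h2
  omega

open scoped Classical in
/-- The times `k < n` at which the orbit of `z` is in the base. -/
noncomputable def baseVisits (hq : IsGrowthSeq q) (n : ℕ) (z : DyadicTower q) : Finset ℕ :=
  (Finset.range n).filter fun k => (towerMap hq)^[k] z ∈ towerBase q

/-- Before time `q_K - ∑_{k < K} q_k` only the first `K` coordinates can change, and the return
time is determined by their new values. -/
theorem card_baseVisits_le (hq : IsSuperGrowthSeq q) {z : DyadicTower q} (hz1 : z.1.2 = 1)
    (hz : ∃ᶠ n in atTop, z.1.1 n = false) {n K : ℕ} (hn : n ≤ gapSeq q K) :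
    (baseVisits hq.isGrowthSeq n z).card ≤ 2 ^ K := by
  classical
  set T := towerMap hq.isGrowthSeq
  have hret : ∀ k ∈ baseVisits hq.isGrowthSeq n z, (∀ l ≥ K, (T^[k] z).1.1 l = z.1.1 l) ∧
      (k : ℤ) = digitSum (fun l => q l) K (T^[k] z).1.1 - digitSum (fun l => q l) K z.1.1 := by
    intro k hk
    obtain ⟨hkn, hkb⟩ := Finset.mem_filter.1 hk
    rw [Finset.mem_range] at hkn
    obtain ⟨L₀, hL₀⟩ := towerMap_orbit hq.isGrowthSeq z hz k
    have hkb' : (T^[k] z).1.2 = 1 := hkb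
    have hdig : ∀ L ≥ L₀, (k : ℤ) =
        digitSum (fun l => q l) L (T^[k] z).1.1 - digitSum (fun l => q l) L z.1.1 := by
      intro L hL
      have := (hL₀ L hL).2
      rw [hkb', hz1] at this
      linarith
    have hfix : ∀ l ≥ K, (T^[k] z).1.1 l = z.1.1 l := by
      by_contra! hne
      -- the last coordinate `l ≥ K` which changes
      obtain ⟨l, ⟨hlK, hl⟩, hmax⟩ : ∃ l, (l ≥ K ∧ (T^[k] z).1.1 l ≠ z.1.1 l) ∧
          ∀ l' > l, (T^[k] z).1.1 l' = z.1.1 l' := by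
        set S := (Finset.range L₀).filter fun l => l ≥ K ∧ (T^[k] z).1.1 l ≠ z.1.1 l
        have hS : S.Nonempty := by
          obtain ⟨l, hl, hl'⟩ := hne
          refine ⟨l, Finset.mem_filter.2 ⟨Finset.mem_range.2 ?_, hl, hl'⟩⟩
          by_contra h
          exact hl' (hL₀ l (not_lt.1 h)).1
        refine ⟨S.max' hS, (Finset.mem_filter.1 (S.max'_mem hS)).2, fun l' hl' => ?_⟩
        by_contra h
        have hlt : l' < L₀ := by
          by_contra h1
          exact h (hL₀ l' (not_lt.1 h1)).1
        have hK := (Finset.mem_filter.1 (S.max'_mem hS)).2.1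
        have : l' ∈ S := Finset.mem_filter.2 ⟨Finset.mem_range.2 hlt, by omega, h⟩
        exact absurd (S.le_max' _ this) (not_le.2 hl')
      have h1 := hdig (max L₀ (l + 1)) (le_max_left _ _)
      rw [digitSum_sub_congr _ (le_max_right L₀ (l + 1)) fun l' hl' => hmax l' hl', digitSum_succ,
        digitSum_succ] at h1
      have h2 := abs_le.1 (abs_digitSum_sub_le q l z.1.1 (T^[k] z).1.1)
      have h3 := hq.sum_lt_gapSeq l
      have h4 : gapSeq q l + ∑ k ∈ Finset.range l, q k = q l :=
        Nat.sub_add_cancel (hq.isGrowthSeq.2 l).le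
      have h5 := hq.monotone_gapSeq hlK
      have h6 : (gapSeq q l : ℤ) + ∑ k ∈ Finset.range l, (q k : ℤ) = q l := by exact_mod_cast h4
      have h7 : ∑ k ∈ Finset.range l, (q k : ℤ) < gapSeq q l := by exact_mod_cast h3
      have h8 : (n : ℤ) ≤ gapSeq q l := by exact_mod_cast hn.trans h5
      have h9 : (k : ℤ) < n := by exact_mod_cast hkn
      have h10 : (0 : ℤ) ≤ k := Int.natCast_nonneg k
      rcases hb : z.1.1 l <;> rcases hb' : (T^[k] z).1.1 l <;>
        simp only [hb, hb', if_true, Bool.false_eq_true, if_false] at h1 hl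
      · exact hl rfl
      · linarith [h2.1]
      · linarith [h2.2]
      · exact hl rfl
    refine ⟨hfix, ?_⟩
    rw [hdig (max L₀ K) (le_max_left _ _), digitSum_sub_congr _ (le_max_right L₀ K) hfix]
  have hcard : (Finset.univ : Finset (Fin K → Bool)).card = 2 ^ K := by simp
  rw [← hcard]
  refine Finset.card_le_card_of_injOn (fun k (l : Fin K) => (T^[k] z).1.1 l)
    (fun _ _ => Finset.mem_coe.2 (Finset.mem_univ _)) ?_
  intro k hk k' hk' h
  have h1 : digitSum (fun l => (q l : ℤ)) K (T^[k] z).1.1 =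
      digitSum (fun l => q l) K (T^[k'] z).1.1 :=
    Finset.sum_congr rfl fun l hl => by
      have := congrFun h ⟨l, Finset.mem_range.1 hl⟩
      simp only at this
      rw [this]
  have h2 := (hret k hk).2
  have h3 := (hret k' hk').2
  rw [h1] at h2
  exact_mod_cast h2.trans h3.symm

/-- Starting from a coordinate `0` at index `J`, the odometer can be applied `2 ^ J - 1` times
while only the first `J + 1` coordinates change. -/
theorem le_card_baseVisits (hq : IsSuperGrowthSeq q) {z : DyadicTower q} (hz1 : z.1.2 = 1)
    (hz : ∃ᶠ n in atTop, z.1.1 n = false) {n J : ℕ} (hJ : z.1.1 J = false)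
    (hn : ∑ k ∈ Finset.range (J + 1), q k < n) :
    2 ^ J ≤ (baseVisits hq.isGrowthSeq n z).card := by
  classical
  set T := towerMap hq.isGrowthSeq
  -- the binary value of the first `J + 1` coordinates, which the odometer raises by `1`
  set b : DyadicSeq → ℤ := digitSum (fun l => 2 ^ l) (J + 1) with hb
  have hgeom : ∀ j : ℕ, ∑ l ∈ Finset.range j, (2 : ℤ) ^ l = 2 ^ j - 1 := fun j => by
    have := geom_sum_mul (2 : ℤ) j
    linarith
  have hbJ : b z.1.1 ≤ 2 ^ J - 1 := by
    rw [hb, digitSum_succ, hJ, if_neg Bool.false_ne_true, add_zero, ← hgeom J]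
    refine Finset.sum_le_sum fun l _ => ?_
    split_ifs
    · exact le_rfl
    · positivity
  have key : ∀ i : ℕ, i < 2 ^ J → ∃ k, (T^[k] z).1.2 = 1 ∧
      (∀ l, J + 1 ≤ l → (T^[k] z).1.1 l = z.1.1 l) ∧ b (T^[k] z).1.1 = b z.1.1 + i := by
    intro i
    induction i with
    | zero => exact fun _ => ⟨0, hz1, fun _ _ => rfl, by simp⟩
    | succ i ih =>
      intro hi
      obtain ⟨k, hk1, hk2, hk3⟩ := ih (by omega)
      set z' := T^[k] z
      have hex : ∃ l, l < J + 1 ∧ z'.1.1 l = false := by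
        by_contra! hne
        have h1 : b z'.1.1 = 2 ^ (J + 1) - 1 := by
          rw [← hgeom]
          refine Finset.sum_congr rfl fun l hl => ?_
          rw [if_pos (by simpa using hne l (Finset.mem_range.1 hl))]
        have h2 : ((i + 1 : ℕ) : ℤ) < 2 ^ J := by exact_mod_cast hi
        rw [h1, pow_succ] at hk3
        push_cast at h2
        linarith
      obtain ⟨l, hl, hl'⟩ := hex
      have hlt : firstZero z'.1.1 < J + 1 := (firstZero_le hl').trans_lt hl
      refine ⟨dyadicCocycle q z'.1.1 + k, ?_⟩
      rw [Function.iterate_add_apply]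
      rw [show (T^[dyadicCocycle q z'.1.1] (T^[k] z)) = _ from
        towerMap_iterate_dyadicCocycle hq.isGrowthSeq z' hk1]
      refine ⟨rfl, fun l hl => ?_, ?_⟩
      · exact (odometer_of_firstZero_lt ⟨_, hl'⟩ (hlt.trans_le hl)).trans (hk2 l hl)
      · have h1 := digitSum_odometer (fun l => 2 ^ l) ⟨_, hl'⟩ hlt
        rw [hgeom] at h1
        simp only [hb] at hk3 ⊢
        push_cast
        linarith
  choose! f hf1 hf2 hf3 using key
  have hcard : (Finset.range (2 ^ J)).card = 2 ^ J := Finset.card_range _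
  conv_lhs => rw [← hcard]
  refine Finset.card_le_card_of_injOn f (fun i hi => ?_) (fun i hi i' hi' h => ?_)
  · have hi' : i < 2 ^ J := Finset.mem_range.1 (Finset.mem_coe.1 hi)
    refine Finset.mem_coe.2 (Finset.mem_filter.2 ⟨Finset.mem_range.2 ?_, hf1 i hi'⟩)
    obtain ⟨L₀, hL₀⟩ := towerMap_orbit hq.isGrowthSeq z hz (f i)
    have h1 := (hL₀ (max L₀ (J + 1)) (le_max_left _ _)).2
    rw [show ((towerMap hq.isGrowthSeq)^[f i] z).1.2 = 1 from hf1 i hi', hz1,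
      digitSum_sub_congr _ (le_max_right L₀ (J + 1)) (hf2 i hi')] at h1
    have h2 := (abs_le.1 (abs_digitSum_sub_le q (J + 1) z.1.1 (T^[f i] z).1.1)).2
    have h3 : ∑ k ∈ Finset.range (J + 1), (q k : ℤ) < n := by exact_mod_cast hn
    have h4 : (f i : ℤ) < n := by linarith
    exact_mod_cast h4
  · have h1 := hf3 i (Finset.mem_range.1 (Finset.mem_coe.1 hi))
    have h2 := hf3 i' (Finset.mem_range.1 (Finset.mem_coe.1 hi'))
    rw [h, h2] at h1
    have h3 : (i' : ℤ) = i := by linarith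
    exact_mod_cast h3.symm

end Tower

/-! ### Visits to the base of the tower -/

section TowerVisits

variable {q : ℕ → ℕ}

theorem card_baseVisits (hq : IsGrowthSeq q) (n : ℕ) (z : DyadicTower q) :
    ((baseVisits hq n z).card : ℝ) =
      ∑ k ∈ Finset.range n, ((towerMap hq)^[k] ⁻¹' towerBase q).indicator (fun _ => (1 : ℝ)) z := by
  classical
  rw [baseVisits, Finset.card_filter, Nat.cast_sum]
  refine Finset.sum_congr rfl fun k _ => ?_
  by_cases h : (towerMap hq)^[k] z ∈ towerBase q
  · rw [if_pos h, indicator_of_mem (mem_preimage.2 h), Nat.cast_one]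
  · rw [if_neg h, indicator_of_notMem (mt mem_preimage.1 h), Nat.cast_zero]

theorem integral_card_baseVisits (hq : IsGrowthSeq q) (n : ℕ) {H : Set (DyadicTower q)}
    (hH : towerMeasure q H ≠ ∞) :
    ∫ z in H, ((baseVisits hq n z).card : ℝ) ∂towerMeasure q =
      ∑ k ∈ Finset.range n, (towerMeasure q).real (H ∩ (towerMap hq)^[k] ⁻¹' towerBase q) := by
  have hmeas : ∀ k, MeasurableSet ((towerMap hq)^[k] ⁻¹' towerBase q) := fun k =>
    (measurable_towerMap hq).iterate k (measurableSet_towerBase q)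
  have : Fact (towerMeasure q H < ∞) := ⟨hH.lt_top⟩
  simp_rw [card_baseVisits]
  rw [integral_finsetSum _ fun k _ => (integrable_const (1 : ℝ)).indicator (hmeas k)]
  refine Finset.sum_congr rfl fun k _ => ?_
  rw [integral_indicator_const _ (hmeas k), measureReal_restrict_apply (hmeas k), inter_comm,
    smul_eq_mul, mul_one]

theorem integrable_card_baseVisits (hq : IsGrowthSeq q) (n : ℕ) {H : Set (DyadicTower q)}
    (hH : towerMeasure q H ≠ ∞) :
    IntegrableOn (fun z => ((baseVisits hq n z).card : ℝ)) H (towerMeasure q) := by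
  have : Fact (towerMeasure q H < ∞) := ⟨hH.lt_top⟩
  simp_rw [card_baseVisits]
  exact integrable_finsetSum _ fun k _ => (integrable_const (1 : ℝ)).indicator
    ((measurable_towerMap hq).iterate k (measurableSet_towerBase q))

/-- The number of visits to the base up to time `n` is at most a constant multiple of its mean.
With `K` minimal such that `n ≤ q_K - ∑_{k < K} q_k` it is at most `2 ^ K`, while on the half of the
base where the coordinate of index `K - 2` vanishes it is at least `2 ^ (K - 2)`. -/
theorem card_baseVisits_le_mul_sum (hq : IsSuperGrowthSeq q) {z : DyadicTower q} (hz1 : z.1.2 = 1)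
    (hz : ∃ᶠ n in atTop, z.1.1 n = false) (n : ℕ) :
    ((baseVisits hq.isGrowthSeq n z).card : ℝ) ≤
      8 * ∑ k ∈ Finset.range n,
        (towerMeasure q).real (towerBase q ∩ (towerMap hq.isGrowthSeq)^[k] ⁻¹' towerBase q) := by
  classical
  have hG := hq.isGrowthSeq
  set μ := towerMeasure q with hμ
  have hb : μ (towerBase q) = 1 := towerMeasure_towerBase hG
  rcases Nat.eq_zero_or_pos n with rfl | hn
  · simp [baseVisits]
  have hex : ∃ K, n ≤ gapSeq q K := ⟨n, hq.le_gapSeq n⟩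
  have hK := Nat.find_spec hex
  have hmin : ∀ K' < Nat.find hex, ¬ n ≤ gapSeq q K' := fun K' h => Nat.find_min hex h
  set K := Nat.find hex
  have hup : ((baseVisits hG n z).card : ℝ) ≤ 2 ^ K := by
    exact_mod_cast card_baseVisits_le hq hz1 hz hK
  refine hup.trans ?_
  -- for `K < 2` the visit at time `0` suffices
  rcases Nat.lt_or_ge K 2 with hK2 | hK2
  · have h1 : (1 : ℝ) ≤ ∑ k ∈ Finset.range n,
        μ.real (towerBase q ∩ (towerMap hG)^[k] ⁻¹' towerBase q) := by
      have h2 : μ.real (towerBase q ∩ (towerMap hG)^[0] ⁻¹' towerBase q) = 1 := by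
        rw [Function.iterate_zero, preimage_id, inter_self, measureReal_def, hb, ENNReal.toReal_one]
      rw [← h2]
      exact Finset.single_le_sum (f := fun k =>
        μ.real (towerBase q ∩ (towerMap hG)^[k] ⁻¹' towerBase q))
        (fun _ _ => measureReal_nonneg) (Finset.mem_range.2 hn)
    have h3 : (2 : ℝ) ^ K ≤ 2 ^ 1 := pow_le_pow_right₀ one_le_two (by omega)
    linarith
  · obtain ⟨J, hJ⟩ := Nat.exists_eq_add_of_le hK2
    have hlt : ∑ k ∈ Finset.range (J + 1), q k < n :=
      (hq.sum_lt_gapSeq (J + 1)).trans (not_le.1 (hmin (J + 1) (by omega)))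
    set H : Set (DyadicTower q) := {z | z.1.1 ∈ {ω : DyadicSeq | ω J = false} ∧ z.1.2 = 1} with hHdef
    have hHm : MeasurableSet H :=
      ((measurable_pi_apply J).comp measurable_column (measurableSet_singleton false)).inter
        (measurableSet_level q 1)
    have hHμ : μ.real H = 1 / 2 := by
      have h1 := dyadicMeasure_cylinder {J} fun _ => false
      simp only [Finset.mem_singleton, forall_eq] at h1
      rw [measureReal_def, hHdef, hμ, towerMeasure_base hG, h1]
      simp
    have hHb : H ⊆ towerBase q := fun z hz => hz.2
    have hHtop : μ H ≠ ∞ := measure_ne_top_of_subset hHb (by rw [hb]; exact ENNReal.one_ne_top)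
    have hint : (2 : ℝ) ^ J * (1 / 2) ≤ ∫ z in H, ((baseVisits hG n z).card : ℝ) ∂μ := by
      have h1 : ∫ _ in H, (2 : ℝ) ^ J ∂μ = 2 ^ J * (1 / 2) := by
        rw [setIntegral_const, hHμ, smul_eq_mul, mul_comm]
      rw [← h1]
      refine setIntegral_mono_ae_restrict (integrableOn_const hHtop)
        (integrable_card_baseVisits hG n hHtop) ?_
      filter_upwards [ae_restrict_of_ae ae_frequently_column_eq_false,
        ae_restrict_mem hHm] with x hx hxH
      have := le_card_baseVisits hq hxH.2 hx hxH.1 hlt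
      exact_mod_cast this
    rw [integral_card_baseVisits hG n hHtop] at hint
    have hsum : ∑ k ∈ Finset.range n, μ.real (H ∩ (towerMap hG)^[k] ⁻¹' towerBase q) ≤
        ∑ k ∈ Finset.range n, μ.real (towerBase q ∩ (towerMap hG)^[k] ⁻¹' towerBase q) :=
      Finset.sum_le_sum fun k _ => measureReal_mono (inter_subset_inter_left _ hHb)
        (measure_ne_top_of_subset inter_subset_left (by rw [hb]; exact ENNReal.one_ne_top))
    rw [hJ, pow_add]
    linarith

end TowerVisits

/-! ### Products with a recurrent event -/

theorem prod_inter_preimage_iterate {Y X : Type*} {S : Y → Y} {T : X → X} {A : Set Y} {B : Set X}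
    (k : ℕ) (C : Set Y) (D : Set X) :
    (A ×ˢ B) ∩ (Prod.map S T)^[k] ⁻¹' (C ×ˢ D) =
      (A ∩ S^[k] ⁻¹' C) ×ˢ (B ∩ T^[k] ⁻¹' D) := by
  rw [Prod.map_iterate]
  ext ⟨y, x⟩
  simp only [mem_inter_iff, mem_preimage, mem_prod, Prod.map_apply]
  tauto

section ProductWithRecurrentEvent

variable {Y X : Type*} [MeasurableSpace Y] [MeasurableSpace X] {S : Y → Y} {T : X → X}
  {ν : Measure Y} {m : Measure X} {A : Set Y} {B : Set X}

theorem IsRecurrentEvent.measureReal_inter_inter (hA : IsRecurrentEvent S ν A) (a b : ℕ) :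
    ν.real (A ∩ (S^[a] ⁻¹' A ∩ S^[a + b] ⁻¹' A)) =
      ν.real A * (renewalSeq S ν A a * renewalSeq S ν A b) := by
  have h := hA.renewal 2 fun i => if i = 0 then a else b
  simp only [Finset.prod_range_succ, Finset.prod_range_zero, one_mul, if_true, one_ne_zero,
    if_false] at h
  rw [← h]
  congr 1
  ext y
  simp only [mem_inter_iff, mem_preimage, mem_ofPred_eq]
  constructor
  · rintro ⟨h0, h1, h2⟩ i hi
    interval_cases i
    · exact h0
    · simpa using h1
    · simpa [Finset.sum_range_succ] using h2
  · intro h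
    refine ⟨by simpa using h 0 (by omega), by simpa using h 1 (by omega), ?_⟩
    simpa [Finset.sum_range_succ] using h 2 le_rfl

/-- If, from almost every point of `B`, the number of visits to `B` is bounded by a multiple of its
mean, then the product of `B` with a recurrent event with antitone renewal sequence satisfies a Rényi
inequality: the renewal sequence factors over successive gaps, and summation by parts transfers the
bound on the visits to the weights given by the renewal sequence. -/
theorem IsRecurrentEvent.hasRenyiBound_prod [SFinite m] (hA : IsRecurrentEvent S ν A)
    (hanti : Antitone (renewalSeq S ν A)) (hT : MeasurePreserving T m m) (hB : MeasurableSet B)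
    (hBtop : m B < ∞) {c : ℝ} (hvis : ∀ᵐ x ∂m, x ∈ B → ∀ n,
      ∑ k ∈ Finset.range n, (T^[k] ⁻¹' B).indicator (fun _ => (1 : ℝ)) x ≤
        c * ∑ k ∈ Finset.range n, m.real (B ∩ T^[k] ⁻¹' B)) :
    HasRenyiBound (Prod.map S T) (ν.prod m) (A ×ˢ B) (c / ν.real A) := by
  intro n
  set u := renewalSeq S ν A with hu
  set v : ℕ → ℝ := fun k => m.real (B ∩ T^[k] ⁻¹' B) with hv
  have hAr : 0 < ν.real A := ENNReal.toReal_pos hA.pos.ne' hA.lt_top.ne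
  have hu0 : ∀ k, 0 ≤ u k := fun k => div_nonneg measureReal_nonneg hAr.le
  have hTm : ∀ k, MeasurableSet (T^[k] ⁻¹' B) := fun k => hT.measurable.iterate k hB
  have hone : ∀ k, (ν.prod m).real ((A ×ˢ B) ∩ (Prod.map S T)^[k] ⁻¹' (A ×ˢ B)) =
      ν.real A * (u k * v k) := fun k => by
    rw [prod_inter_preimage_iterate, measureReal_prod_prod, ← mul_assoc, hu, renewalSeq,
      mul_div_cancel₀ _ hAr.ne']
  have htwo : ∀ a b, (ν.prod m).real ((A ×ˢ B) ∩ ((Prod.map S T)^[a] ⁻¹' (A ×ˢ B) ∩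
      (Prod.map S T)^[a + b] ⁻¹' (A ×ˢ B))) =
      ν.real A * (u a * (u b * m.real (B ∩ (T^[a] ⁻¹' B ∩ T^[a + b] ⁻¹' B)))) := fun a b => by
    have : (A ×ˢ B) ∩ ((Prod.map S T)^[a] ⁻¹' (A ×ˢ B) ∩ (Prod.map S T)^[a + b] ⁻¹' (A ×ˢ B)) =
        (A ∩ (S^[a] ⁻¹' A ∩ S^[a + b] ⁻¹' A)) ×ˢ (B ∩ (T^[a] ⁻¹' B ∩ T^[a + b] ⁻¹' B)) := by
      simp only [Prod.map_iterate]
      ext ⟨y, x⟩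
      simp only [mem_inter_iff, mem_preimage, mem_prod, Prod.map_apply]
      tauto
    rw [this, measureReal_prod_prod, hA.measureReal_inter_inter]
    ring
  have hpart : ∀ a k, ∑ b ∈ Finset.range k, m.real (B ∩ (T^[a] ⁻¹' B ∩ T^[a + b] ⁻¹' B)) ≤
      ∑ b ∈ Finset.range k, v a * c * v b := by
    intro a k
    set D := B ∩ T^[a] ⁻¹' B
    have hDtop : m D ≠ ∞ := measure_ne_top_of_subset inter_subset_left hBtop.ne
    have : Fact (m D < ∞) := ⟨hDtop.lt_top⟩
    have hint : ∀ b, Integrable ((T^[a + b] ⁻¹' B).indicator fun _ => (1 : ℝ)) (m.restrict D) :=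
      fun b => (integrable_const (1 : ℝ)).indicator (hTm _)
    have h1 : ∀ b, m.real (B ∩ (T^[a] ⁻¹' B ∩ T^[a + b] ⁻¹' B)) =
        ∫ x in D, (T^[a + b] ⁻¹' B).indicator (fun _ => (1 : ℝ)) x ∂m := fun b => by
      rw [integral_indicator_const _ (hTm _), measureReal_restrict_apply (hTm _), smul_eq_mul,
        mul_one, ← inter_assoc, inter_comm]
    have h2 : ∀ x ∈ D, ∀ b, (T^[a + b] ⁻¹' B).indicator (fun _ => (1 : ℝ)) x =
        (T^[b] ⁻¹' B).indicator (fun _ => (1 : ℝ)) (T^[a] x) := fun x _ b => by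
      rw [add_comm a b, Function.iterate_add, preimage_comp]
      rfl
    calc _ = ∫ x in D, ∑ b ∈ Finset.range k,
          (T^[a + b] ⁻¹' B).indicator (fun _ => (1 : ℝ)) x ∂m := by
          rw [integral_finsetSum _ fun b _ => hint b]
          exact Finset.sum_congr rfl fun b _ => h1 b
      _ ≤ ∫ _ in D, c * ∑ b ∈ Finset.range k, v b ∂m := by
          refine setIntegral_mono_ae_restrict (integrable_finsetSum _ fun b _ => hint b)
            (integrableOn_const hDtop) ?_
          filter_upwards [ae_restrict_of_ae ((hT.iterate a).quasiMeasurePreserving.ae hvis),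
            ae_restrict_mem (hB.inter (hTm a))] with x hx hxD
          rw [Finset.sum_congr rfl fun b _ => h2 x hxD b]
          exact hx hxD.2 k
      _ = _ := by
          rw [setIntegral_const, smul_eq_mul, ← mul_assoc, Finset.mul_sum]
  simp only [hone, htwo, ← Finset.mul_sum]
  calc _ ≤ ν.real A * ∑ a ∈ Finset.range n, u a *
        ∑ b ∈ Finset.range n, u b * (v a * c * v b) := by
        refine mul_le_mul_of_nonneg_left (Finset.sum_le_sum fun a _ => ?_) hAr.le
        exact mul_le_mul_of_nonneg_left (sum_antitone_mul_le hanti hu0 (hpart a) n) (hu0 a)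
    _ = ν.real A * (c * (∑ k ∈ Finset.range n, u k * v k) ^ 2) := by
        rw [sq, Finset.sum_mul, Finset.mul_sum (a := c)]
        congr 1
        refine Finset.sum_congr rfl fun a _ => ?_
        simp only [Finset.mul_sum]
        exact Finset.sum_congr rfl fun b _ => by ring
    _ = _ := by
        field_simp

theorem tendsto_measure_prod_inter_preimage [SFinite m] (hAtop : ν A < ∞) (h0 : ν A ≠ 0)
    (hBtop : m B < ∞) (h : Tendsto (renewalSeq S ν A) atTop (𝓝 0)) :
    Tendsto (fun n : ℕ => (ν.prod m) ((A ×ˢ B) ∩ (Prod.map S T)^[n] ⁻¹' (A ×ˢ B))) atTop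
      (𝓝 0) := by
  have hA : Tendsto (fun n : ℕ => ν (A ∩ S^[n] ⁻¹' A)) atTop (𝓝 0) := by
    have h1 : Tendsto (fun n : ℕ => ENNReal.ofReal (renewalSeq S ν A n * ν.real A)) atTop
        (𝓝 0) := by
      simpa using ENNReal.tendsto_ofReal (h.mul_const (ν.real A))
    refine h1.congr fun n => ?_
    rw [renewalSeq, div_mul_cancel₀ _ (measureReal_ne_zero_iff hAtop.ne |>.2 h0), measureReal_def,
      ENNReal.ofReal_toReal (measure_ne_top_of_subset inter_subset_left hAtop.ne)]
  refine tendsto_of_tendsto_of_tendsto_of_le_of_le tendsto_const_nhds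
    (h := fun n => ν (A ∩ S^[n] ⁻¹' A) * m B) ?_ (fun _ => zero_le) fun n => ?_
  · simpa using ENNReal.Tendsto.mul_const hA (Or.inr hBtop.ne)
  · simp only [prod_inter_preimage_iterate]
    rw [Measure.prod_prod]
    gcongr
    exact inter_subset_left

end ProductWithRecurrentEvent

/-! ### Weak mixing of the product -/

section WeakMixingProduct

/-- The product of an aperiodic conservative ergodic Markov shift with a weakly mixing transformation
is weakly mixing as soon as it is conservative. A further finite measure preserving factor does not
affect the recurrence to rectangles. -/
theorem IsMarkovMeasure.isWeaklyMixing_prod {ι X : Type*} [Countable ι] [MeasurableSpace ι]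
    [DiscreteMeasurableSpace ι] [MeasurableSpace X] {T : X → X} {m : Measure X} [SigmaFinite m]
    {p : ι → ι → ℝ≥0∞} {w : ι → ℝ≥0∞} {ν : Measure (ℤ → ι)} (hν : IsMarkovMeasure p w ν)
    (hScons : Conservative (biShift ι) ν) (hSerg : Ergodic (biShift ι) ν)
    (hSaper : IsAperiodic p) (hT : IsWeaklyMixing T m) (hTm : Measurable T)
    (hST : Conservative (Prod.map (biShift ι) T) (ν.prod m)) :
    IsWeaklyMixing (Prod.map (biShift ι) T) (ν.prod m) := by
  intro Z _ _ ρ _ R hR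
  have := hν.sigmaFinite
  set K : ℕ → Set X := spanningSets m
  have hKm : ∀ i, MeasurableSet (K i) := measurableSet_spanningSets m
  have hW := hT Z ρ R hR
  have herg : Ergodic (Prod.map (biShift ι) (Prod.map T R)) (ν.prod (m.prod ρ)) := by
    refine hν.ergodic_prod hScons hSerg hSaper hW (K := fun i => K i ×ˢ univ)
      (fun i => (hKm i).prod MeasurableSet.univ) (fun i => ?_) ?_ fun s i => ?_
    · rw [Measure.prod_prod, measure_univ, mul_one]
      exact (measure_spanningSets_lt_top m i).ne
    · rw [← iUnion_prod_const, iUnion_spanningSets, univ_prod_univ]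
    · have h1 := hST.ae_mem_imp_frequently_image_mem
        ((measurableSet_state s).prod (hKm i)).nullMeasurableSet
      have hproj : MeasurePreserving (Prod.map id Prod.fst) (ν.prod (m.prod ρ)) (ν.prod m) :=
        (MeasurePreserving.id ν).prod measurePreserving_fst
      filter_upwards [hproj.quasiMeasurePreserving.ae h1] with z hz hzK
      refine (hz ⟨hzK.1, hzK.2.1⟩).mono fun n hn => ?_
      simp only [Prod.map_iterate] at hn ⊢
      exact ⟨hn.1, hn.2, mem_univ _⟩
  -- regroup the three factors
  have hassoc := (measurePreserving_prodAssoc ν m ρ).symm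
  exact hassoc.ergodic_of_ergodic_semiconj herg
    ((hSerg.measurable.prodMap hTm).prodMap hR.measurable) fun _ => rfl

end WeakMixingProduct

/-! ### Failure of subsequence rational weak mixing -/

section NotSubsequence

variable {q : ℕ → ℕ} {Y : Type*} [MeasurableSpace Y] {S : Y → Y} {ν : Measure Y}

/-- Within a level, a base coordinate cannot change from `0` to `1` and from `1` to `0` after one and
the same time. -/
theorem IsSuperGrowthSeq.not_exchange (hq : IsSuperGrowthSeq q) {k i L : ℕ} {x x' : DyadicTower q}
    (hx : ∃ᶠ n in atTop, x.1.1 n = false) (hx' : ∃ᶠ n in atTop, x'.1.1 n = false)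
    (hxi : x.1.2 = i) (hxi' : x'.1.2 = i)
    (hTx : ((towerMap hq.isGrowthSeq)^[k] x).1.2 = i)
    (hTx' : ((towerMap hq.isGrowthSeq)^[k] x').1.2 = i)
    (h0 : x.1.1 L = false) (h1 : ((towerMap hq.isGrowthSeq)^[k] x).1.1 L = true) :
    ((towerMap hq.isGrowthSeq)^[k] x').1.1 L = true := by
  obtain ⟨L₁, h₁⟩ := towerMap_orbit hq.isGrowthSeq x hx k
  obtain ⟨L₂, h₂⟩ := towerMap_orbit hq.isGrowthSeq x' hx' k
  set M := max (L + 1) (max L₁ L₂)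
  have e₁ := (h₁ M ((le_max_left _ _).trans (le_max_right _ _))).2
  have e₂ := (h₂ M ((le_max_right _ _).trans (le_max_right _ _))).2
  rw [hxi, hTx] at e₁
  rw [hxi', hTx'] at e₂
  exact hq.digit_eq (by linarith) (le_max_left (L + 1) _) h0 h1

/-- A set of positive measure in the product is split by some base coordinate. -/
theorem exists_coordinate_splitting [SFinite ν] {G : Set (Y × DyadicTower q)}
    (hG : (ν.prod (towerMeasure q)) G ≠ 0) :
    ∃ L, (ν.prod (towerMeasure q)) (G ∩ {z | z.2.1.1 L = false}) ≠ 0 ∧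
      (ν.prod (towerMeasure q)) (G ∩ {z | z.2.1.1 L = true}) ≠ 0 := by
  classical
  by_contra! h
  set m := ν.prod (towerMeasure q)
  -- otherwise almost all of `G` would lie over the single point `β`
  set β : DyadicSeq := fun L => decide (m (G ∩ {z | z.2.1.1 L = false}) = 0) with hβ
  have hnull : m (Prod.snd ⁻¹' {x : DyadicTower q | x.1.1 ∈ {ω : DyadicSeq | ∀ l ∈ univ, ω l = β l}})
      = 0 :=
    Measure.quasiMeasurePreserving_snd.preimage_null
      (towerMeasure_column_eq_zero (dyadicMeasure_eq_zero_of_infinite infinite_univ β))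
  have hae : ∀ᵐ z ∂m, ∀ L, z ∈ G → z.2.1.1 L = β L := by
    refine ae_all_iff.2 fun L => ?_
    by_cases hL : m (G ∩ {z | z.2.1.1 L = false}) = 0
    · filter_upwards [measure_eq_zero_iff_ae_notMem.1 hL] with z hz hzG
      rw [hβ]
      simp only [hL, decide_true]
      rw [← Bool.not_eq_false]
      exact fun h => hz ⟨hzG, h⟩
    · filter_upwards [measure_eq_zero_iff_ae_notMem.1 (h L hL)] with z hz hzG
      rw [hβ]
      simp only [hL, decide_false]
      rw [← Bool.not_eq_true]
      exact fun h => hz ⟨hzG, h⟩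
  refine hG (measure_eq_zero_iff_ae_notMem.2 ?_)
  filter_upwards [hae, measure_eq_zero_iff_ae_notMem.1 hnull] with z hz hz' hzG
  exact hz' fun l _ => hz l hzG

/-- Inside any set `F` of positive finite measure there are sets `B`, `C` of positive measure, lying
in one level and distinguished by one base coordinate, such that at each time `k` one of
`B ∩ T⁻ᵏ C` and `C ∩ T⁻ᵏ B` is null; so the two deviations from `m(B) m(C) u_k(F)` add up to at least
`m(B) m(C) u_k(F)`. -/
theorem not_isSubseqRationallyWeaklyMixing_prod [SFinite ν] (hq : IsSuperGrowthSeq q) :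
    ¬ IsSubseqRationallyWeaklyMixing (Prod.map S (towerMap hq.isGrowthSeq))
      (ν.prod (towerMeasure q)) := by
  rintro ⟨F, hF, h0, htop, N, hN, h⟩
  set m := ν.prod (towerMeasure q)
  set V := Prod.map S (towerMap hq.isGrowthSeq) with hV
  have hgood : ∀ᵐ z ∂m, ∃ᶠ n in atTop, z.2.1.1 n = false :=
    Measure.quasiMeasurePreserving_snd.ae ae_frequently_column_eq_false
  obtain ⟨i, hi⟩ : ∃ i : ℕ, m (F ∩ {z | z.2.1.2 = i}) ≠ 0 := by
    by_contra! hi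
    refine h0.ne' ?_
    have : F = ⋃ i : ℕ, F ∩ {z | z.2.1.2 = i} := by
      ext z; simp
    rw [this, measure_iUnion_null_iff]
    exact hi
  obtain ⟨L, hB, hC⟩ := exists_coordinate_splitting hi
  have hcoord : ∀ b : Bool, MeasurableSet {z : Y × DyadicTower q | z.2.1.1 L = b} := fun b =>
    (((measurable_pi_apply L).comp measurable_column).comp measurable_snd) (measurableSet_singleton b)
  have hlev : MeasurableSet (F ∩ {z | z.2.1.2 = i}) :=
    hF.inter (measurable_snd (measurableSet_level q i))
  set B := F ∩ {z : Y × DyadicTower q | z.2.1.2 = i} ∩ {z | z.2.1.1 L = false} with hBdef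
  set C := F ∩ {z : Y × DyadicTower q | z.2.1.2 = i} ∩ {z | z.2.1.1 L = true} with hCdef
  have hBF : B ⊆ F := inter_subset_left.trans inter_subset_left
  have hCF : C ⊆ F := inter_subset_left.trans inter_subset_left
  have hBr : 0 < m.real B := ENNReal.toReal_pos hB (measure_ne_top_of_subset hBF htop.ne)
  have hCr : 0 < m.real C := ENNReal.toReal_pos hC (measure_ne_top_of_subset hCF htop.ne)
  have hFr : 0 < m.real F := ENNReal.toReal_pos h0.ne' htop.ne
  -- two points exchanging the two sets at time `k` would contradict uniqueness of the digits
  have hdis : ∀ k, m.real (B ∩ V^[k] ⁻¹' C) = 0 ∨ m.real (C ∩ V^[k] ⁻¹' B) = 0 := by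
    intro k
    by_contra! hne
    have hex : ∀ {s : Set (Y × DyadicTower q)}, m.real s ≠ 0 →
        ∃ z ∈ s, ∃ᶠ n in atTop, z.2.1.1 n = false := by
      intro s hs
      have hs' : m s ≠ 0 := fun h => hs (by rw [measureReal_def, h, ENNReal.toReal_zero])
      exact ((frequently_ae_mem_iff.2 hs').and_eventually hgood).exists
    obtain ⟨z, ⟨hz1, hz2⟩, hz⟩ := hex hne.1
    obtain ⟨z', ⟨hz1', hz2'⟩, hz'⟩ := hex hne.2
    rw [mem_preimage, hV, Prod.map_iterate] at hz2 hz2'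
    have h1 := hq.not_exchange hz hz' hz1.1.2 hz1'.1.2 hz2.1.2 hz2'.1.2 hz1.2 hz2.2
    have h2 : ((towerMap hq.isGrowthSeq)^[k] z'.2).1.1 L = false := hz2'.2
    rw [h1] at h2
    exact Bool.noConfusion h2
  have hu : ∀ k, 0 ≤ returnProb V m F k := fun k => div_nonneg measureReal_nonneg (sq_nonneg _)
  have hpos : ∀ n, 0 < n → 0 < returnSeq V m F n := by
    intro n hn
    refine Finset.sum_pos' (fun k _ => hu k) ⟨0, Finset.mem_range.2 hn, ?_⟩
    rw [returnProb, Function.iterate_zero, preimage_id, inter_self]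
    positivity
  have hlim := (h B C (hlev.inter (hcoord _)) (hlev.inter (hcoord _)) hBF hCF).add
    (h C B (hlev.inter (hcoord _)) (hlev.inter (hcoord _)) hCF hBF)
  rw [add_zero] at hlim
  refine absurd (ge_of_tendsto hlim (b := m.real B * m.real C) ?_) (not_le.2 (mul_pos hBr hCr))
  filter_upwards [eventually_gt_atTop 0] with j hj
  rw [← add_div, le_div_iff₀ (hpos _ ((Nat.zero_le _).trans_lt (hN hj))), returnSeq,
    Finset.mul_sum, ← Finset.sum_add_distrib]
  refine Finset.sum_le_sum fun k _ => ?_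
  have hnn : 0 ≤ m.real B * m.real C * returnProb V m F k := mul_nonneg (mul_pos hBr hCr).le (hu k)
  rcases hdis k with h1 | h1
  · rw [h1, zero_sub, abs_neg, abs_of_nonneg hnn]
    linarith [abs_nonneg (m.real (C ∩ V^[k] ⁻¹' B) - m.real C * m.real B * returnProb V m F k)]
  · rw [h1, zero_sub, abs_neg, mul_comm (m.real C), abs_of_nonneg hnn]
    linarith [abs_nonneg (m.real (B ∩ V^[k] ⁻¹' C) - m.real B * m.real C * returnProb V m F k)]

end NotSubsequence

/-! ### The product of the Markov shift and the tower -/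

theorem biShift_injective (ι : Type*) : Function.Injective (biShift ι) := fun y y' h => by
  ext i
  have := congrFun h (i - 1)
  simpa only [biShift, sub_add_cancel] using this

theorem mainTheorem3 {ι : Type*} [Countable ι] [MeasurableSpace ι] [DiscreteMeasurableSpace ι]
    (q : ℕ → ℕ) (hq : IsSuperGrowthSeq q)
    (hT : IsWeaklyMixing (towerMap hq.isGrowthSeq) (towerMeasure q))
    (p : ι → ι → ℝ≥0∞) (w : ι → ℝ≥0∞) (ν : Measure (ℤ → ι)) (hν : IsMarkovMeasure p w ν)
    (hScons : Conservative (biShift ι) ν) (hSerg : Ergodic (biShift ι) ν)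
    (hSaper : IsAperiodic p)
    (A : Set (ℤ → ι)) (hA : IsRecurrentEvent (biShift ι) ν A)
    (hK : IsKaluza (renewalSeq (biShift ι) ν A))
    (hST : Conservative (Prod.map (biShift ι) (towerMap hq.isGrowthSeq))
      (ν.prod (towerMeasure q))) :
    (ν univ = ∞ →
      IsZeroType (Prod.map (biShift ι) (towerMap hq.isGrowthSeq)) (ν.prod (towerMeasure q))) ∧
    IsRationallyErgodic (Prod.map (biShift ι) (towerMap hq.isGrowthSeq))
      (ν.prod (towerMeasure q)) ∧
    IsRenyiSet (Prod.map (biShift ι) (towerMap hq.isGrowthSeq)) (ν.prod (towerMeasure q))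
      (A ×ˢ towerBase q) ∧
    A ×ˢ towerBase q ∈
      rationalSets (Prod.map (biShift ι) (towerMap hq.isGrowthSeq)) (ν.prod (towerMeasure q)) ∧
    IsWeaklyMixing (Prod.map (biShift ι) (towerMap hq.isGrowthSeq)) (ν.prod (towerMeasure q)) ∧
    ¬ IsSubseqRationallyWeaklyMixing (Prod.map (biShift ι) (towerMap hq.isGrowthSeq))
      (ν.prod (towerMeasure q)) := by
  have hG := hq.isGrowthSeq
  have := hν.sigmaFinite
  have hTm : Measurable (towerMap hG) := measurable_towerMap hG
  have hTerg : Ergodic (towerMap hG) (towerMeasure q) := hT.ergodic hTm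
  have hwm : IsWeaklyMixing (Prod.map (biShift ι) (towerMap hG)) (ν.prod (towerMeasure q)) :=
    hν.isWeaklyMixing_prod hScons hSerg hSaper hT hTm hST
  have herg := hwm.ergodic (hSerg.measurable.prodMap hTm)
  have hanti : Antitone (renewalSeq (biShift ι) ν A) := hK.antitone (renewalSeq_le_one hA.lt_top)
  have hBm : MeasurableSet (towerBase q) := measurableSet_towerBase q
  have hB1 : towerMeasure q (towerBase q) = 1 := towerMeasure_towerBase hG
  have hBtop : towerMeasure q (towerBase q) < ∞ := hB1 ▸ ENNReal.one_lt_top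
  have hFm : MeasurableSet (A ×ˢ towerBase q) := hA.measurableSet.prod hBm
  have hFμ : (ν.prod (towerMeasure q)) (A ×ˢ towerBase q) = ν A := by
    rw [Measure.prod_prod, hB1, mul_one]
  have hF0 : (ν.prod (towerMeasure q)) (A ×ˢ towerBase q) ≠ 0 := hFμ ▸ hA.pos.ne'
  have hFtop : (ν.prod (towerMeasure q)) (A ×ˢ towerBase q) < ∞ := hFμ ▸ hA.lt_top
  have hR := hA.hasRenyiBound_prod hanti hTerg.toMeasurePreserving hBm hBtop (c := 8) (by
    filter_upwards [ae_frequently_column_eq_false] with z hz hz1 n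
    rw [← card_baseVisits hG]
    exact card_baseVisits_le_mul_sum hq hz1 hz n)
  have hRen := hR.isRenyiSet herg.measurable hFm hF0 hFtop
  refine ⟨fun htop => ?_, ⟨hST, herg, _, hRen⟩, hRen, ?_, hwm,
    not_isSubseqRationallyWeaklyMixing_prod hq⟩
  · exact isZeroType_of_tendsto hST herg hFm hF0
      (tendsto_measure_prod_inter_preimage hA.lt_top hA.pos.ne' hBtop
        (tendsto_renewalSeq_zero hSerg htop hA.measurableSet hA.lt_top hA.pos.ne' hanti))
  · exact hR.mem_rationalSets hST herg
      ((biShift_injective ι).prodMap (towerMap_injective hG)) hFm hF0 hFtop
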